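/- Let $(M^6,J,g)$ be a smooth almost Hermitian manifold with Levi-Civita connection $\nabla$ and fundamental form $\omega(X,Y)=g(JX,Y)$. Assume that it is strict nearly Kähler of constant type $\lambda>0$, that is, $(\nabla_XJ)X=0$ for all $X$, $\nabla_XJ\neq0$ for all $X\neq0$, and $$\|(\nabla_XJ)Y\|^2=\lambda^2\big(\|X\|^2\|Y\|^2-\langle X,Y\rangle^2-\langle JX,Y\rangle^2\big)\quad\text{for all }x\in M,\ X,Y\in T_xM .$$ Let $\Phi(X,Y,Z)=\frac1{3\lambda}\big(d\omega(X,Y,Z)-\sqrt{-1}\,d\omega(X,Y,JZ)\big)$. Let $f:L^3\to M^6$ be an (immersed) Lagrangian submanifold, i.e. $f^*\omega=0$, where $L$ is a smooth manifold without boundary carrying the induced metric $f^*g$ and the orientation for which $-\operatorname{Im}\Phi|_L$ is positive. Let $V$ be a smooth normal vector field along $L$ with compact support, and put $L_\omega(V)=(V\rfloor\omega)|_L\in\Omega^1(L)$. Let $\phi_t:L\to M$, $|t|<\varepsilon$, be a smooth variation of $L$ with variation field $V$: $(t,x)\mapsto\phi_t(x)$ is smooth, $\phi_0=f$, $\frac{\partial}{\partial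 t}\big|_{t=0}\phi_t=V$, and for some compact set $K\subset L$ one has $\phi_t=f$ on $L\setminus K$ for all $|t|<\varepsilon$. Let $\mathrm{vol}(L_t)$ denote the $3$-dimensional volume of $\phi_t|_K$ (if $L$ is compact, one may take $K=L$, which gives the total volume). Then $\mathrm{vol}(L_t)$ is finite and differentiable in $t$ for $t$ near $0$ and twice differentiable at $t=0$, the integrands below are integrable on $L$, and $$\frac{d^2}{dt^2}\Big|_{t=0}\mathrm{vol}(L_t)=\int_L\big\langle d(L_\omega(V))-3\lambda*L_\omega(V),\ d(L_\omega(V))+\lambda*L_\omega(V)\big\rangle\,d\mathrm{vol}_L+\int_L\|d*L_\omega(V)\|^2\,d\mathrm{vol}_L ,$$ where $*$, $\langle\cdot,\cdot\rangle$, $\|\cdot\|$ and $d\mathrm{vol}_L$ are taken with respect to the induced metric and the above orientation of $L$, and forms $e^{i_1}\wedge\dots\wedge e^{i_k}$ with $i_1<\dots<i_k$ built from an orthonormal coframe are orthonormal. -/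

import Mathlib

open Set Filter MeasureTheory Bundle
open scoped Manifold ContDiff Topology

namespace NearlyKahler

section Forms

variable {n : ℕ} {M : Type*} [TopologicalSpace M] [ChartedSpace (EuclideanSpace ℝ (Fin n)) M]

/-- The coordinate expression, on the model space, of a differential `k`-form `η` on a manifold
in the chart around `x`: the pullback of `ω` under the inverse of that chart. -/
noncomputable def formInChart {k : ℕ}
    (η : ∀ y : M, TangentSpace (𝓡 n) y [⋀^Fin k]→L[ℝ] ℝ) (x : M) :
    EuclideanSpace ℝ (Fin n) → EuclideanSpace ℝ (Fin n) [⋀^Fin k]→L[ℝ] ℝ :=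
  fun u => (η ((extChartAt (𝓡 n) x).symm u)).compContinuousLinearMap
    (mfderiv 𝓘(ℝ, EuclideanSpace ℝ (Fin n)) (𝓡 n) (extChartAt (𝓡 n) x).symm u)

/-- The exterior derivative `dη` of a `k`-form on a manifold, with the normalization
`dη(v₀, …, v_k) = ∑ (-1)^i v_i(η(v₀, …, v̂_i, …, v_k))` on coordinate fields: at the point `x` it is
computed in the chart around `x` and pulled back by that chart. -/
noncomputable def dForm {k : ℕ}
    (η : ∀ y : M, TangentSpace (𝓡 n) y [⋀^Fin k]→L[ℝ] ℝ) (x : M) :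
    TangentSpace (𝓡 n) x [⋀^Fin (k + 1)]→L[ℝ] ℝ :=
  (extDeriv (formInChart η x) (extChartAt (𝓡 n) x x)).compContinuousLinearMap
    (mfderiv (𝓡 n) 𝓘(ℝ, EuclideanSpace ℝ (Fin n)) (extChartAt (𝓡 n) x) x)

end Forms

section LinearAlgebra

variable {E : Type*} [NormedAddCommGroup E] [InnerProductSpace ℝ E] [FiniteDimensional ℝ E]

/-- The inner product of two `k`-forms on a Euclidean space, for which the forms
`e^{i₁} ∧ … ∧ e^{i_k}`, `i₁ < … < i_k`, are orthonormal whenever `e` is an orthonormal basis. -/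
noncomputable def formInner {k : ℕ} (α β : E [⋀^Fin k]→L[ℝ] ℝ) : ℝ :=
  (k.factorial : ℝ)⁻¹ * ∑ i : Fin k → Fin (Module.finrank ℝ E),
    α (fun j => stdOrthonormalBasis ℝ E (i j)) * β (fun j => stdOrthonormalBasis ℝ E (i j))

/-- The Hodge star of a `1`-form on an oriented Euclidean space of dimension `3`: the contraction
of the volume form with the vector dual to the `1`-form. On a positive orthonormal basis,
`*e¹ = e² ∧ e³`. -/
noncomputable def hodgeStar [Fact (Module.finrank ℝ E = 3)] (o : Orientation ℝ E (Fin 3))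
    (θ : E →L[ℝ] ℝ) : E [⋀^Fin 2]→L[ℝ] ℝ :=
  AlternatingMap.mkContinuous
    (o.volumeForm.curryLeft ((InnerProductSpace.toDual ℝ E).symm θ))
    ‖(InnerProductSpace.toDual ℝ E).symm θ‖ (fun v => by
      have h := o.abs_volumeForm_apply_le
        (Matrix.vecCons ((InnerProductSpace.toDual ℝ E).symm θ) v)
      rw [Fin.prod_univ_succ] at h
      simpa using h)

end LinearAlgebra

section TangentSpaces

variable {n : ℕ} {M : Type*} [TopologicalSpace M] [ChartedSpace (EuclideanSpace ℝ (Fin n)) M]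

instance (x : M) : FiniteDimensional ℝ (TangentSpace (𝓡 n) x) :=
  inferInstanceAs (FiniteDimensional ℝ (EuclideanSpace ℝ (Fin n)))

instance (x : M) : Fact (Module.finrank ℝ (TangentSpace (𝓡 n) x) = n) :=
  ⟨finrank_euclideanSpace_fin (𝕜 := ℝ) (n := n)⟩

end TangentSpaces

section AlmostHermitian

variable (n : ℕ) (M : Type*) [TopologicalSpace M] [ChartedSpace (EuclideanSpace ℝ (Fin n)) M]
  [IsManifold (𝓡 n) ∞ M] [RiemannianBundle (fun x : M => TangentSpace (𝓡 n) x)]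

/-- A smooth almost complex structure `J` on a Riemannian manifold, orthogonal for the metric. -/
structure AlmostHermitianStructure where
  /-- The almost complex structure. -/
  J : ∀ x : M, TangentSpace (𝓡 n) x →L[ℝ] TangentSpace (𝓡 n) x
  smooth : ContMDiff (𝓡 n)
    ((𝓡 n).prod 𝓘(ℝ, EuclideanSpace ℝ (Fin n) →L[ℝ] EuclideanSpace ℝ (Fin n))) ∞
    (fun x => Bundle.TotalSpace.mk'
      (E := fun x : M => TangentSpace (𝓡 n) x →L[ℝ] TangentSpace (𝓡 n) x)
      (EuclideanSpace ℝ (Fin n) →L[ℝ] EuclideanSpace ℝ (Fin n)) x (J x))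
  J_J : ∀ (x : M) (v : TangentSpace (𝓡 n) x), J x (J x v) = -v
  inner_J_J : ∀ (x : M) (v w : TangentSpace (𝓡 n) x),
    inner ℝ (J x v) (J x w) = inner ℝ v w

variable {n M}

theorem AlmostHermitianStructure.inner_J_self (A : AlmostHermitianStructure n M) (x : M)
    (v : TangentSpace (𝓡 n) x) : inner ℝ (A.J x v) v = 0 := by
  have h := A.inner_J_J x v (A.J x v)
  rw [A.J_J, inner_neg_right, real_inner_comm] at h
  have h' : inner ℝ (A.J x v) v = inner ℝ v (A.J x v) := real_inner_comm _ _
  linarith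

/-- The fundamental `2`-form `ω(v, w) = g(Jv, w)`. -/
noncomputable def AlmostHermitianStructure.omega (A : AlmostHermitianStructure n M) (x : M) :
    TangentSpace (𝓡 n) x [⋀^Fin 2]→L[ℝ] ℝ where
  toFun v := inner ℝ (A.J x (v 0)) (v 1)
  map_update_add' v i a b := by
    have h : i = 0 ∨ i = 1 := by omega
    rcases h with rfl | rfl <;> simp [inner_add_left, inner_add_right]
  map_update_smul' v i c a := by
    have h : i = 0 ∨ i = 1 := by omega
    rcases h with rfl | rfl <;> simp [inner_smul_left, inner_smul_right]
  map_eq_zero_of_eq' v i j hv hij := by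
    have h : v 0 = v 1 := by
      have hi : i = 0 ∨ i = 1 := by omega
      have hj : j = 0 ∨ j = 1 := by omega
      rcases hi with rfl | rfl <;> rcases hj with rfl | rfl <;> simp_all
    simpa [h] using A.inner_J_self x (v 1)
  cont := by fun_prop

/-- The derivative `(∇_v J) Y = ∇_v (J Y) - J (∇_v Y)` of the almost complex structure `J` with
respect to the connection `∇`, at the point `x`. -/
noncomputable def covDerivJ
    (nabla : CovariantDerivative (𝓡 n) (EuclideanSpace ℝ (Fin n))
      (fun x : M => TangentSpace (𝓡 n) x))
    (A : AlmostHermitianStructure n M) (x : M) (v : TangentSpace (𝓡 n) x)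
    (Y : ∀ y : M, TangentSpace (𝓡 n) y) : TangentSpace (𝓡 n) x :=
  nabla (fun y => A.J y (Y y)) x v - A.J x (nabla Y x v)

variable [IsContMDiffRiemannianBundle (𝓡 n) ∞ (EuclideanSpace ℝ (Fin n))
    (fun x : M => TangentSpace (𝓡 n) x)]

/-- A smooth Riemannian metric is of class `C¹` (a shortcut for instance search). -/
instance : IsContMDiffRiemannianBundle (𝓡 n) 1 (EuclideanSpace ℝ (Fin n))
    (fun x : M => TangentSpace (𝓡 n) x) :=
  IsContMDiffRiemannianBundle.of_le (n := ∞) (by norm_cast)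

/-- `∇` is the Levi-Civita connection: compatible with the metric and torsion free. -/
def IsLeviCivita (nabla : CovariantDerivative (𝓡 n) (EuclideanSpace ℝ (Fin n))
    (fun x : M => TangentSpace (𝓡 n) x)) : Prop :=
  nabla.IsMetricCompatible ∧ nabla.torsion = 0

/-- `(M, J, g)` is a strict nearly Kähler manifold of constant type `lam`. Tensoriality in `X` and
`Y` allows arbitrary vector fields that are differentiable at the point in question. -/
def IsStrictNearlyKahlerOfConstantType (A : AlmostHermitianStructure n M) (lam : ℝ) : Prop :=
  ∃ nabla : CovariantDerivative (𝓡 n) (EuclideanSpace ℝ (Fin n))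
      (fun x : M => TangentSpace (𝓡 n) x),
    IsLeviCivita nabla ∧
    -- nearly Kähler
    (∀ (x : M) (X : ∀ y : M, TangentSpace (𝓡 n) y),
      MDifferentiableAt (𝓡 n) (𝓡 n).tangent (fun y => (⟨y, X y⟩ : TangentBundle (𝓡 n) M)) x →
      covDerivJ nabla A x (X x) X = 0) ∧
    -- strict
    (∀ (x : M) (v : TangentSpace (𝓡 n) x), v ≠ 0 → ∃ Y : ∀ y : M, TangentSpace (𝓡 n) y,
      MDifferentiableAt (𝓡 n) (𝓡 n).tangent (fun y => (⟨y, Y y⟩ : TangentBundle (𝓡 n) M)) x ∧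
      covDerivJ nabla A x v Y ≠ 0) ∧
    -- constant type
    0 < lam ∧
    (∀ (x : M) (v : TangentSpace (𝓡 n) x) (Y : ∀ y : M, TangentSpace (𝓡 n) y),
      MDifferentiableAt (𝓡 n) (𝓡 n).tangent (fun y => (⟨y, Y y⟩ : TangentBundle (𝓡 n) M)) x →
      ‖covDerivJ nabla A x v Y‖ ^ 2 = lam ^ 2 *
        (‖v‖ ^ 2 * ‖Y x‖ ^ 2 - inner ℝ v (Y x) ^ 2 - inner ℝ (A.J x v) (Y x) ^ 2))

/-- The imaginary part of the complex volume form
`Φ(u, v, w) = (1 / 3λ) (dω(u, v, w) - i dω(u, v, Jw))`. -/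
noncomputable def imPhi (A : AlmostHermitianStructure n M) (lam : ℝ) (x : M)
    (u v w : TangentSpace (𝓡 n) x) : ℝ :=
  -(1 / (3 * lam)) * dForm A.omega x ![u, v, A.J x w]

end AlmostHermitian

section Volume

variable (m n : ℕ) {L M : Type*}
  [TopologicalSpace L] [ChartedSpace (EuclideanSpace ℝ (Fin m)) L] [MeasurableSpace L]
  [TopologicalSpace M] [ChartedSpace (EuclideanSpace ℝ (Fin n)) M]
  [RiemannianBundle (fun x : M => TangentSpace (𝓡 n) x)]

/-- The density `√det ⟨∂ᵢφ, ∂ⱼφ⟩` of a map `φ` into a Riemannian manifold, as a function of the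
coordinates `u` of the chart around `x`. -/
noncomputable def chartDensity (φ : L → M) (x : L) (u : EuclideanSpace ℝ (Fin m)) : ℝ :=
  Real.sqrt (Matrix.of fun i j : Fin m =>
    (inner ℝ
      (mfderiv 𝓘(ℝ, EuclideanSpace ℝ (Fin m)) (𝓡 n) (φ ∘ (extChartAt (𝓡 m) x).symm) u
        (EuclideanSpace.single i 1 : EuclideanSpace ℝ (Fin m)))
      (mfderiv 𝓘(ℝ, EuclideanSpace ℝ (Fin m)) (𝓡 n) (φ ∘ (extChartAt (𝓡 m) x).symm) u
        (EuclideanSpace.single j 1 : EuclideanSpace ℝ (Fin m))) : ℝ)).det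

/-- The `m`-dimensional volume of `φ` on the domain of the chart around `x`: the measure with
density `√det ⟨∂ᵢφ, ∂ⱼφ⟩ du` in the coordinates `u`. -/
noncomputable def chartVolume (φ : L → M) (x : L) : Measure L :=
  Measure.map (extChartAt (𝓡 m) x).symm
    ((volume.restrict (extChartAt (𝓡 m) x).target).withDensity fun u =>
      ENNReal.ofReal (chartDensity m n φ x u))

/-- The volume measure on `L` of the pulled back metric `φ^* g`. The local measures `chartVolume`
agree on overlaps of charts, so their supremum is the measure that restricts to each of them. -/
noncomputable def inducedVolume (φ : L → M) : Measure L := ⨆ x : L, chartVolume m n φ x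

end Volume

section Submanifolds

variable {n : ℕ} {L M : Type*}
  [TopologicalSpace M] [ChartedSpace (EuclideanSpace ℝ (Fin n)) M]
  [IsManifold (𝓡 n) ∞ M] [RiemannianBundle (fun x : M => TangentSpace (𝓡 n) x)]
  [TopologicalSpace L] [ChartedSpace (EuclideanSpace ℝ (Fin 3)) L]

/-- `f : L → M` is a (possibly only immersed) Lagrangian submanifold of dimension `3`, and the
metric of `L` is the one induced by `f`. -/
structure IsLagrangian [RiemannianBundle (fun x : L => TangentSpace (𝓡 3) x)]
    (A : AlmostHermitianStructure n M) (f : L → M) : Prop where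
  smooth : ContMDiff (𝓡 3) (𝓡 n) ∞ f
  isometric : ∀ (x : L) (u v : TangentSpace (𝓡 3) x),
    inner ℝ (mfderiv (𝓡 3) (𝓡 n) f x u) (mfderiv (𝓡 3) (𝓡 n) f x v) = inner ℝ u v
  lagrangian : ∀ (x : L) (u v : TangentSpace (𝓡 3) x),
    A.omega (f x) ![mfderiv (𝓡 3) (𝓡 n) f x u, mfderiv (𝓡 3) (𝓡 n) f x v] = 0

/-- The orientation of `L` for which `-Im Φ` is positive on `L`. -/
def IsCanonicalOrientation (A : AlmostHermitianStructure n M) (lam : ℝ) (f : L → M)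
    (o : ∀ x : L, Orientation ℝ (TangentSpace (𝓡 3) x) (Fin 3)) : Prop :=
  ∀ (x : L) (b : Module.Basis (Fin 3) ℝ (TangentSpace (𝓡 3) x)), b.orientation = o x →
    0 < -imPhi A lam (f x) (mfderiv (𝓡 3) (𝓡 n) f x (b 0)) (mfderiv (𝓡 3) (𝓡 n) f x (b 1))
      (mfderiv (𝓡 3) (𝓡 n) f x (b 2))

/-- `V` is a smooth normal vector field along `f` with compact support. -/
structure IsNormalField (f : L → M) (V : ∀ x : L, TangentSpace (𝓡 n) (f x)) : Prop where
  smooth : ContMDiff (𝓡 3) (𝓡 n).tangent ∞ (fun x => (⟨f x, V x⟩ : TangentBundle (𝓡 n) M))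
  normal : ∀ (x : L) (u : TangentSpace (𝓡 3) x),
    inner ℝ (V x) (mfderiv (𝓡 3) (𝓡 n) f x u) = 0
  compact_support : IsCompact (closure {x : L | V x ≠ 0})

/-- `φ` is a smooth variation of `f`, defined for times `|t| < ε` and supported in `K`, with
variation field `V`. -/
structure IsVariation (f : L → M) (V : ∀ x : L, TangentSpace (𝓡 n) (f x)) (K : Set L) (ε : ℝ)
    (φ : ℝ → L → M) : Prop where
  pos : 0 < ε
  smooth : ContMDiffOn (𝓘(ℝ, ℝ).prod (𝓡 3)) (𝓡 n) ∞ (fun p : ℝ × L => φ p.1 p.2)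
    (Ioo (-ε) ε ×ˢ univ)
  zero : φ 0 = f
  velocity : ∀ x : L, (⟨φ 0 x, mfderiv 𝓘(ℝ, ℝ) (𝓡 n) (fun t => φ t x) 0 (1 : ℝ)⟩ :
    TangentBundle (𝓡 n) M) = ⟨f x, V x⟩
  support : ∀ t ∈ Ioo (-ε) ε, ∀ x ∉ K, φ t x = f x

/-- The `1`-form `L_ω(V) = V ⌟ ω` on `L`, that is, `u ↦ ω(V, df(u))`. -/
noncomputable def lOmega (A : AlmostHermitianStructure n M) (f : L → M)
    (V : ∀ x : L, TangentSpace (𝓡 n) (f x)) (x : L) : TangentSpace (𝓡 3) x →L[ℝ] ℝ :=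
  (innerSL ℝ (A.J (f x) (V x))).comp (mfderiv (𝓡 3) (𝓡 n) f x)

/-- The `2`-form `*L_ω(V)` on `L`. -/
noncomputable def starLOmega [RiemannianBundle (fun x : L => TangentSpace (𝓡 3) x)]
    (A : AlmostHermitianStructure n M) (f : L → M)
    (o : ∀ x : L, Orientation ℝ (TangentSpace (𝓡 3) x) (Fin 3))
    (V : ∀ x : L, TangentSpace (𝓡 n) (f x)) (x : L) : TangentSpace (𝓡 3) x [⋀^Fin 2]→L[ℝ] ℝ :=
  hodgeStar (o x) (lOmega A f V x)

/-- The exterior derivative of a `1`-form on `L`. -/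
noncomputable def dOne (θ : ∀ x : L, TangentSpace (𝓡 3) x →L[ℝ] ℝ) (x : L) :
    TangentSpace (𝓡 3) x [⋀^Fin 2]→L[ℝ] ℝ :=
  dForm (fun y => ContinuousAlternatingMap.ofSubsingleton ℝ _ _ (0 : Fin 1) (θ y)) x

end Submanifolds

end NearlyKahler

/-!
Let `T(X, Y, Z) = g((∇_X J) Y, Z)` and `S = T(·, ·, J ·)`. On a nearly Kähler manifold `T` is totally
skew, so that `dω = 3 T`, and `T - i S` is a form of type `(3, 0)`; constant type `λ` fixes its norm,
and `T = λ Re Φ`, `S = -λ Im Φ`. The proof rests on a pointwise identity (`gram_det`). For three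
vectors `u₀, u₁, u₂` with Gram matrix `G`, and with `w = (ω(u₁, u₂), ω(u₂, u₀), ω(u₀, u₁))`,

  `λ² det G = T(u₀, u₁, u₂)² + S(u₀, u₁, u₂)² + λ² ∑ wᵢ wⱼ Gᵢⱼ`.

It is `det H = |det Z|²` for the Hermitian Gram matrix `H` and the complex coordinates `Z` of the
vectors in a unitary frame. Applied to a coordinate frame of the slices of a variation, it expresses
the volume density `R` by the restrictions of `T`, `S` and `ω` to the slices. On a Lagrangian slice
`ω` vanishes, `T = dω / 3` vanishes, and `S` is `λ` times the volume form. The second derivative of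
the identity at time zero is therefore (`HasJetTwo.second_deriv_of_sq_eq`)

  `λ² R R'' = T'² + S S'' + λ² ∑ wᵢ' wⱼ' Gᵢⱼ`.

With `θ = L_ω(V)`, Cartan's formula computes the three terms (`second_variation_density`,
`fderiv_fderiv_densityInChart`):

* `ω' = dθ + 3 V ⌟ T = dθ - 3λ *θ`, as `V ⌟ T` restricts to `-λ *θ` on a Lagrangian subspace
  (`torsion_contraction_eq_hodgeStar`);
* `T' = dω' / 3 = -λ d*θ`;
* `S'' = 4 λ² θ ∧ ω' + dβ'`, where `β` is the restriction of `V ⌟ S`, because `dS = 2 λ² ω ∧ ω`.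

Up to the exact term `dβ'` the ratio `R'' / R` is `|ω'|² + 4λ ⟨*θ, ω'⟩ + |d*θ|²`, and this is the
integrand, since `ω' + 4λ *θ = dθ + λ *θ`.

The formula for `dS` follows from `∇_W T = -λ² W ∧ ω` (`covDeriv_eq`), which is proved here without
curvature: the difference of the two sides is of type `(3, 0)` in its three last arguments, has no
component along `T` because the norm of `T` is constant, and has vanishing skew-symmetrization
because `T` is closed; such a tensor is zero (`eq_zero_of_alternation`). Only the Christoffel symbols
at a single point enter.

The exact term is dealt with globally. The form `λ⁻¹ β'` is dual to a vector field `W` on `L`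
(`exists_fluxVector`); with a partition of unity `ρᵢ` on a neighbourhood of the support, integration
by parts in charts turns the exact term into `-∫ ∑ dρᵢ(W)`, which vanishes as `∑ ρᵢ` is locally
constant there (`second_variation_localized`, `second_variation_volume`).
-/

namespace NearlyKahler

set_option maxSynthPendingDepth 3
set_option linter.unusedSimpArgs false
set_option linter.unusedSectionVars false
set_option synthInstance.maxHeartbeats 200000

/-! ### Algebra of nearly Kähler structures at a point -/

section SpecialUnitaryAlgebra

variable {E : Type*} [NormedAddCommGroup E] [NormedSpace ℝ E]

/-- `g` is a Euclidean inner product on `E` and `J` an orthogonal complex structure. -/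
structure IsHermitianPair (g : E →L[ℝ] E →L[ℝ] ℝ) (J : E →L[ℝ] E) : Prop where
  symm : ∀ u v, g u v = g v u
  pos : ∀ v, v ≠ 0 → 0 < g v v
  J_J : ∀ v, J (J v) = -v
  orth : ∀ u v, g (J u) (J v) = g u v

/-- `Q` is an alternating trilinear form. -/
structure IsAltThree (Q : E → E → E → ℝ) : Prop where
  linear : ∀ u v, IsLinearMap ℝ (Q u v)
  swap₁₂ : ∀ u v w, Q u v w = -Q v u w
  swap₂₃ : ∀ u v w, Q u v w = -Q u w v

/-- `Q` is the real part of a `3`-form of type `(3, 0)`: alternating, and `J` may be moved from one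
argument to another. -/
structure IsTypeThreeZero (J : E →L[ℝ] E) (Q : E → E → E → ℝ) : Prop
    extends IsAltThree Q where
  move_J : ∀ u v w, Q u v (J w) = Q u (J v) w

/-- The algebra of a strict nearly Kähler structure of constant type `lam` at one point:
`T(u, v, w) = g((∇_u J) v, w)`. -/
structure IsNearlyKahlerAlgebra (g : E →L[ℝ] E →L[ℝ] ℝ) (J : E →L[ℝ] E)
    (T : E → E → E → ℝ) (lam : ℝ) : Prop
    extends IsHermitianPair g J, IsTypeThreeZero J T where
  lam_pos : 0 < lam
  exists_cross : ∀ u v, ∃ a, (∀ w, T u v w = g a w) ∧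
    g a a = lam ^ 2 * (g u u * g v v - g u v ^ 2 - g (J u) v ^ 2)

/-- `e` is a unitary basis (over `ℂ`) of a Hermitian space of complex dimension `3`. -/
structure IsUnitaryFrame (g : E →L[ℝ] E →L[ℝ] ℝ) (J : E →L[ℝ] E) (e : Fin 3 → E) : Prop where
  ortho : ∀ i j, g (e i) (e j) = if i = j then 1 else 0
  orthoJ : ∀ i j, g (J (e i)) (e j) = 0

namespace IsHermitianPair

variable {g : E →L[ℝ] E →L[ℝ] ℝ} {J : E →L[ℝ] E} (h : IsHermitianPair g J)
include h

theorem skew (u v : E) : g (J u) v = -g u (J v) := by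
  have := h.orth u (J v)
  rw [h.J_J] at this
  simp only [map_neg] at this
  linarith

theorem omega_swap (u v : E) : g (J u) v = -g (J v) u := by
  rw [h.skew, h.symm]

theorem omega_self (u : E) : g (J u) u = 0 := by
  have := h.omega_swap u u
  linarith

theorem cauchy_schwarz (u v : E) : g u v ^ 2 ≤ g u u * g v v := by
  by_cases hv : v = 0
  · simp [hv]
  have hpos := h.pos v hv
  have hx : 0 ≤ g (g v v • u - g u v • v) (g v v • u - g u v • v) := by
    by_cases hx : g v v • u - g u v • v = 0
    · simp [hx]
    · exact (h.pos _ hx).le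
  simp only [map_sub, map_smul, sub_apply, smul_apply, smul_eq_mul, h.symm v u] at hx
  have : 0 ≤ g v v * (g u u * g v v - g u v ^ 2) := by linarith
  have := nonneg_of_mul_nonneg_right this hpos
  linarith

end IsHermitianPair

namespace IsUnitaryFrame

variable {g : E →L[ℝ] E →L[ℝ] ℝ} {J : E →L[ℝ] E} {e : Fin 3 → E}

/-- The complex coordinates of a vector in a unitary frame. -/
noncomputable def coord (g : E →L[ℝ] E →L[ℝ] ℝ) (J : E →L[ℝ] E) (e : Fin 3 → E) (v : E) (k : Fin 3) : ℂ :=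
  ⟨g v (e k), g v (J (e k))⟩

variable (h : IsHermitianPair g J) (he : IsUnitaryFrame g J e)
include h he

/-- A unitary frame, together with its image under `J`, is an orthonormal basis over `ℝ`. -/
theorem expand (hE : Module.finrank ℝ E = 6) (v : E) :
    v = ∑ k, (g v (e k) • e k + g v (J (e k)) • J (e k)) := by
  have hfin : FiniteDimensional ℝ E := Module.finite_of_finrank_pos (by omega)
  have h1 : ∀ i j, g (e i) (J (e j)) = 0 := fun i j => by rw [h.symm, he.orthoJ]
  have h2 : ∀ i j, g (J (e i)) (J (e j)) = if i = j then 1 else 0 := fun i j => by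
    rw [h.orth, he.ortho]
  -- A vector orthogonal to the six members of `b` vanishes; `r` is the remainder of the expansion.
  let b : Fin 3 ⊕ Fin 3 → E := Sum.elim e (fun k => J (e k))
  have hb : ∀ i j, g (b i) (b j) = if i = j then 1 else 0 := by
    rintro (i | i) (j | j) <;> simp [b, he.ortho, he.orthoJ, h1, h2]
  have hli : LinearIndependent ℝ b := by
    rw [Fintype.linearIndependent_iff]
    intro c hc i
    have := congrArg (fun x => g x (b i)) hc
    simpa [-Fintype.sum_sum_type, hb] using this
  have hspan : Submodule.span ℝ (Set.range b) = ⊤ :=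
    hli.span_eq_top_of_card_eq_finrank' (by simp [hE])
  set r : E := v - ∑ k, (g v (e k) • e k + g v (J (e k)) • J (e k)) with hr
  have hrb : ∀ i, g r (b i) = 0 := by
    rintro (i | i) <;>
      simp [b, hr, Finset.sum_add_distrib, he.ortho, he.orthoJ, h1, h2, -Finset.sum_sub_distrib]
  have hle : Submodule.span ℝ (Set.range b) ≤ LinearMap.ker (g r : E →ₗ[ℝ] ℝ) := by
    rw [Submodule.span_le]
    rintro _ ⟨i, rfl⟩
    exact hrb i
  have hrr : g r r = 0 := by
    have : r ∈ LinearMap.ker (g r : E →ₗ[ℝ] ℝ) := hle (hspan ▸ Submodule.mem_top)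
    exact this
  have hr0 : r = 0 := by
    by_contra hne
    exact (h.pos r hne).ne' hrr
  exact sub_eq_zero.1 hr0

/-- The Hermitian product in terms of complex coordinates. -/
theorem sum_coord_mul_conj (hE : Module.finrank ℝ E = 6) (u v : E) :
    ∑ k, coord g J e u k * star (coord g J e v k) = ⟨g u v, -g (J u) v⟩ := by
  have h1 : g u v = ∑ k, (g u (e k) * g v (e k) + g u (J (e k)) * g v (J (e k))) := by
    conv_lhs => rw [expand h he hE v]
    simp only [map_sum, map_add, map_smul, smul_eq_mul]
    exact Finset.sum_congr rfl fun k _ => by ring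
  have h2 : g (J u) v = ∑ k, (-g u (J (e k)) * g v (e k) + g u (e k) * g v (J (e k))) := by
    conv_lhs => rw [expand h he hE v]
    simp only [map_sum, map_add, map_smul, smul_eq_mul, h.orth, h.skew u (e _)]
    exact Finset.sum_congr rfl fun k _ => by ring
  rw [h1, h2]
  apply Complex.ext
  · simp [coord, Complex.mul_re]
  · simp only [Complex.im_sum, ← Finset.sum_neg_distrib]
    exact Finset.sum_congr rfl fun k _ => by simp [coord]

/-- A form of type `(3, 0)` is a multiple of the complex determinant. -/
theorem complex_form_eq_det (hE : Module.finrank ℝ E = 6)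
    {Q : E → E → E → ℝ} (hQ : IsTypeThreeZero J Q) (u : Fin 3 → E) :
    (⟨Q (u 0) (u 1) (u 2), -Q (u 0) (u 1) (J (u 2))⟩ : ℂ) =
      ⟨Q (e 0) (e 1) (e 2), -Q (e 0) (e 1) (J (e 2))⟩ *
        (Matrix.of fun i k => coord g J e (u i) k).det := by
  have hmove1 : ∀ u v w, Q (J u) v w = Q u v (J w) := fun u v w => by
    rw [hQ.swap₁₂, ← hQ.move_J, hQ.swap₁₂, neg_neg]
  -- The complex trilinear form `τ = Q - i Q(·, ·, J ·)`.
  let τ : E → E → E → ℂ := fun u v w => ⟨Q u v w, -Q u v (J w)⟩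
  have t12 : ∀ u v w, τ u v w = -τ v u w := fun u v w => by
    apply Complex.ext <;> simp only [τ, Complex.neg_re, Complex.neg_im] <;> rw [hQ.swap₁₂]
  have t23 : ∀ u v w, τ u v w = -τ u w v := fun u v w => by
    apply Complex.ext <;> simp only [τ, Complex.neg_re, Complex.neg_im]
    · rw [hQ.swap₂₃]
    · rw [hQ.move_J, hQ.swap₂₃]
  have t3 : ∀ u v w, τ u v w = ∑ k, coord g J e w k * τ u v (e k) := fun u v w => by
    have h1 : ∀ x, Q u v x = ∑ k, (g x (e k) * Q u v (e k) + g x (J (e k)) * Q u v (J (e k))) :=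
      fun x => by
        conv_lhs => rw [expand h he hE x]
        change (hQ.linear u v).mk' _ _ = _
        simp only [map_sum, map_add, map_smul, smul_eq_mul, IsLinearMap.mk'_apply]
    apply Complex.ext
    · simp only [τ, h1 w, Complex.re_sum]
      exact Finset.sum_congr rfl fun k _ => by simp [coord]
    · simp only [τ, h1 (J w), Complex.im_sum, ← Finset.sum_neg_distrib]
      exact Finset.sum_congr rfl fun k _ => by
        rw [h.orth, h.skew]; simp [coord]
  have t2 : ∀ u v w, τ u v w = ∑ k, coord g J e v k * τ u (e k) w := fun u v w => by
    rw [t23, t3, ← Finset.sum_neg_distrib]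
    exact Finset.sum_congr rfl fun k _ => by rw [t23 u w]; ring
  have t1 : ∀ u v w, τ u v w = ∑ k, coord g J e u k * τ (e k) v w := fun u v w => by
    rw [t12, t2, ← Finset.sum_neg_distrib]
    exact Finset.sum_congr rfl fun k _ => by rw [t12 v]; ring
  have d12 : ∀ u w, τ u u w = 0 := fun u w => self_eq_neg.1 (t12 u u w)
  have d23 : ∀ u w, τ u w w = 0 := fun u w => self_eq_neg.1 (t23 u w w)
  have d13 : ∀ u w, τ u w u = 0 := fun u w => by rw [t23, d12, neg_zero]
  change τ (u 0) (u 1) (u 2) = τ (e 0) (e 1) (e 2) * _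
  have e021 : τ (e 0) (e 2) (e 1) = -τ (e 0) (e 1) (e 2) := t23 _ _ _
  have e102 : τ (e 1) (e 0) (e 2) = -τ (e 0) (e 1) (e 2) := t12 _ _ _
  have e120 : τ (e 1) (e 2) (e 0) = τ (e 0) (e 1) (e 2) := by rw [t23, e102, neg_neg]
  have e201 : τ (e 2) (e 0) (e 1) = τ (e 0) (e 1) (e 2) := by rw [t12, e021, neg_neg]
  have e210 : τ (e 2) (e 1) (e 0) = -τ (e 0) (e 1) (e 2) := by rw [t12, e120]
  rw [t1 (u 0), Matrix.det_fin_three]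
  simp only [t2 _ (u 1), t3 _ _ (u 2), Fin.sum_univ_three, d12, d23, d13, e021, e102, e120, e201,
    e210, Matrix.of_apply]
  ring

/-- The Gram determinant of three vectors is the sum of the squared norms of the values of a
complex volume form and of the restriction of the Kähler form: `det (G - iW) = |det Z| ^ 2`
for the Hermitian Gram matrix of `Z`. -/
theorem gram_det_eq (hE : Module.finrank ℝ E = 6)
    {Q : E → E → E → ℝ} (hQ : IsTypeThreeZero J Q) (u : Fin 3 → E) :
    (Q (e 0) (e 1) (e 2) ^ 2 + Q (e 0) (e 1) (J (e 2)) ^ 2) *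
      ((Matrix.of fun i j => g (u i) (u j)).det -
        ∑ i, ∑ j, ![g (J (u 1)) (u 2), g (J (u 2)) (u 0), g (J (u 0)) (u 1)] i *
          ![g (J (u 1)) (u 2), g (J (u 2)) (u 0), g (J (u 0)) (u 1)] j * g (u i) (u j)) =
      Q (u 0) (u 1) (u 2) ^ 2 + Q (u 0) (u 1) (J (u 2)) ^ 2 := by
  have hdet := complex_form_eq_det h he hE hQ u
  -- `Z Z*` is the Hermitian Gram matrix `G - i W` of the three vectors.
  set Z : Matrix (Fin 3) (Fin 3) ℂ := Matrix.of fun i k => coord g J e (u i) k with hZ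
  have hH : Z * Z.conjTranspose =
      Matrix.of fun i j => (⟨g (u i) (u j), -g (J (u i)) (u j)⟩ : ℂ) := by
    ext i j
    rw [Matrix.mul_apply]
    exact sum_coord_mul_conj h he hE (u i) (u j)
  have hdH : (Z.det * star Z.det).re = (Matrix.of fun i j => g (u i) (u j)).det -
        ∑ i, ∑ j, ![g (J (u 1)) (u 2), g (J (u 2)) (u 0), g (J (u 0)) (u 1)] i *
          ![g (J (u 1)) (u 2), g (J (u 2)) (u 0), g (J (u 0)) (u 1)] j * g (u i) (u j) := by
    rw [← Matrix.det_conjTranspose, ← Matrix.det_mul, hH, Matrix.det_fin_three,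
      Matrix.det_fin_three]
    simp only [Matrix.of_apply, Fin.sum_univ_three, h.omega_self, h.omega_swap (u 1) (u 0),
      h.omega_swap (u 2) (u 1), h.omega_swap (u 0) (u 2), h.symm (u 1) (u 0), h.symm (u 2) (u 0),
      h.symm (u 2) (u 1), Complex.add_re, Complex.sub_re, Complex.mul_re, Complex.mul_im,
      Matrix.cons_val]
    ring
  rw [← hdH]
  have hn := congrArg Complex.normSq hdet
  rw [Complex.normSq_mul, Complex.normSq_mk, Complex.normSq_mk] at hn
  have hz : (Z.det * star Z.det).re = Complex.normSq Z.det := by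
    rw [Complex.star_def, Complex.mul_conj, Complex.ofReal_re]
  rw [hz]
  linarith

end IsUnitaryFrame

namespace IsTypeThreeZero

variable {J : E →L[ℝ] E} {Q : E → E → E → ℝ} (hQ : IsTypeThreeZero J Q)
include hQ

theorem move_J₁ (u v w : E) : Q (J u) v w = Q u v (J w) := by
  rw [hQ.swap₁₂, ← hQ.move_J, hQ.swap₁₂, neg_neg]

theorem self₁₂ (u w : E) : Q u u w = 0 := self_eq_neg.1 (hQ.swap₁₂ u u w)

theorem self₂₃ (u w : E) : Q u w w = 0 := self_eq_neg.1 (hQ.swap₂₃ u w w)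

theorem self₁₃ (u w : E) : Q u w u = 0 := by rw [hQ.swap₂₃, hQ.self₁₂, neg_zero]

theorem rotate (u v w : E) : Q u v w = Q v w u := by rw [hQ.swap₁₂, hQ.swap₂₃, neg_neg]

theorem linear₂ (u w : E) : IsLinearMap ℝ fun v => Q u v w := by
  have := (hQ.linear u w)
  constructor
  · intro x y
    rw [hQ.swap₂₃, this.map_add, hQ.swap₂₃ u x, hQ.swap₂₃ u y]
    ring
  · intro c x
    rw [hQ.swap₂₃, this.map_smul, hQ.swap₂₃ u x, smul_neg]

theorem linear₁ (v w : E) : IsLinearMap ℝ fun u => Q u v w := by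
  have := hQ.linear v w
  constructor
  · intro x y
    rw [hQ.rotate, this.map_add, ← hQ.rotate x, ← hQ.rotate y]
  · intro c x
    rw [hQ.rotate, this.map_smul, ← hQ.rotate]

theorem self_J (u w : E) : Q u (J u) w = 0 := by rw [← hQ.move_J, hQ.self₁₂]

end IsTypeThreeZero

namespace IsNearlyKahlerAlgebra

variable {g : E →L[ℝ] E →L[ℝ] ℝ} {J : E →L[ℝ] E} {T : E → E → E → ℝ} {lam : ℝ}
  (h : IsNearlyKahlerAlgebra g J T lam)
include h

/-- The cross product `λ⁻¹ (∇_{e₁} J) e₂` completes two vectors that are orthonormal over `ℂ` to a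
unitary frame. -/
theorem exists_frame {e₁ e₂ : E} (h₁ : g e₁ e₁ = 1) (h₂ : g e₂ e₂ = 1) (h₁₂ : g e₁ e₂ = 0)
    (hJ : g (J e₁) e₂ = 0) :
    ∃ e₃, IsUnitaryFrame g J ![e₁, e₂, e₃] ∧ ∀ w, T e₁ e₂ w = lam * g e₃ w := by
  obtain ⟨a, ha, haa⟩ := h.exists_cross e₁ e₂
  have hl := h.lam_pos.ne'
  have hT := h.toIsTypeThreeZero
  have hT3 : ∀ w, T e₁ e₂ w = lam * g (lam⁻¹ • a) w := fun w => by
    rw [ha, map_smul, smul_apply, smul_eq_mul, mul_inv_cancel_left₀ hl]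
  have key : ∀ w, T e₁ e₂ w = 0 → g (lam⁻¹ • a) w = 0 := fun w hw => by
    have := hT3 w
    rw [hw] at this
    simpa [hl] using this.symm
  have k1 := key e₁ (hT.self₁₃ _ _)
  have k2 := key e₂ (hT.self₂₃ _ _)
  have k1J := key (J e₁) (by rw [hT.swap₂₃, hT.self_J, neg_zero])
  have k2J := key (J e₂) (by rw [hT.rotate, hT.self_J])
  have k3 : g (lam⁻¹ • a) (lam⁻¹ • a) = 1 := by
    simp only [map_smul, smul_apply, smul_eq_mul, haa, h₁, h₂, h₁₂, hJ]
    field_simp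
    ring
  refine ⟨lam⁻¹ • a, ⟨?_, ?_⟩, hT3⟩
  · intro i j
    fin_cases i <;> fin_cases j <;> simp only [Fin.reduceFinMk, Matrix.cons_val, Fin.zero_eta,
      Fin.mk_one, Fin.reduceEq, if_true, if_false] <;>
      first
      | assumption
      | (rw [h.symm]; assumption)
  · intro i j
    fin_cases i <;> fin_cases j <;> simp only [Fin.reduceFinMk, Matrix.cons_val, Fin.zero_eta,
      Fin.mk_one] <;>
      first
      | exact h.omega_self _
      | assumption
      | (rw [h.symm]; assumption)
      | (rw [h.omega_swap, neg_eq_zero]; first | assumption | (rw [h.symm]; assumption))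

/-- In complex dimension `3`, a unit vector extends to a unitary frame adapted to `T`. -/
theorem exists_frame_of_unit (hE : Module.finrank ℝ E = 6) {e₁ : E} (h₁ : g e₁ e₁ = 1) :
    ∃ e₂ e₃, IsUnitaryFrame g J ![e₁, e₂, e₃] ∧ ∀ w, T e₁ e₂ w = lam * g e₃ w := by
  have hfin : FiniteDimensional ℝ E := Module.finite_of_finrank_pos (by omega)
  -- Two linear conditions on a space of dimension six have a common nonzero solution.
  let Λ : E →ₗ[ℝ] (Fin 2 → ℝ) :=
    LinearMap.pi ![(g e₁ : E →ₗ[ℝ] ℝ), (g (J e₁) : E →ₗ[ℝ] ℝ)]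
  have hker : LinearMap.ker Λ ≠ ⊥ := by
    apply LinearMap.ker_ne_bot_of_finrank_lt
    rw [hE, Module.finrank_fin_fun]
    norm_num
  obtain ⟨v, hv, hv0⟩ := Submodule.exists_mem_ne_zero_of_ne_bot hker
  have hΛ : Λ v = 0 := hv
  have hv1 : g e₁ v = 0 := congrFun hΛ 0
  have hv2 : g (J e₁) v = 0 := congrFun hΛ 1
  have hpos := h.pos v hv0
  have hs : Real.sqrt (g v v) ^ 2 = g v v := Real.sq_sqrt hpos.le
  have hs0 : Real.sqrt (g v v) ≠ 0 := (Real.sqrt_pos.2 hpos).ne'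
  refine ⟨(Real.sqrt (g v v))⁻¹ • v, h.exists_frame h₁ ?_ ?_ ?_⟩
  · simp only [map_smul, smul_apply, smul_eq_mul]
    rw [← hs, Real.sqrt_sq (Real.sqrt_nonneg _)]
    field_simp
  · simp [hv1]
  · simp [hv2]

theorem exists_unit (hE : Module.finrank ℝ E = 6) : ∃ e₁ : E, g e₁ e₁ = 1 := by
  have : Nontrivial E := Module.nontrivial_of_finrank_pos (R := ℝ) (by omega)
  obtain ⟨v, hv⟩ := exists_ne (0 : E)
  have hpos := h.pos v hv
  have hs : Real.sqrt (g v v) ^ 2 = g v v := Real.sq_sqrt hpos.le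
  have hs0 : Real.sqrt (g v v) ≠ 0 := (Real.sqrt_pos.2 hpos).ne'
  refine ⟨(Real.sqrt (g v v))⁻¹ • v, ?_⟩
  simp only [map_smul, smul_apply, smul_eq_mul]
  rw [← hs, Real.sqrt_sq (Real.sqrt_nonneg _)]
  field_simp

/-- The squared volume of three vectors is the sum of the squared norms of `Φ` and of the
restriction of `ω` to their span. -/
theorem gram_det (hE : Module.finrank ℝ E = 6) (u : Fin 3 → E) :
    lam ^ 2 * ((Matrix.of fun i j => g (u i) (u j)).det -
        ∑ i, ∑ j, ![g (J (u 1)) (u 2), g (J (u 2)) (u 0), g (J (u 0)) (u 1)] i *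
          ![g (J (u 1)) (u 2), g (J (u 2)) (u 0), g (J (u 0)) (u 1)] j * g (u i) (u j)) =
      T (u 0) (u 1) (u 2) ^ 2 + T (u 0) (u 1) (J (u 2)) ^ 2 := by
  obtain ⟨e₁, h₁⟩ := h.exists_unit hE
  obtain ⟨e₂, e₃, he, hT⟩ := h.exists_frame_of_unit hE h₁
  have h33 : g e₃ e₃ = 1 := by simpa using he.ortho 2 2
  rw [← IsUnitaryFrame.gram_det_eq h.toIsHermitianPair he hE h.toIsTypeThreeZero u]
  simp only [Matrix.cons_val, hT, h33, h.symm e₃ (J e₃), h.omega_self]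
  ring

/-- For a positive Lagrangian orthonormal triple `(u, v, w)` the cross product of `u` and `v` is
`Jw`. -/
theorem cross_of_lagrangian (hE : Module.finrank ℝ E = 6) {u : Fin 3 → E}
    (hu : ∀ i j, g (u i) (u j) = if i = j then 1 else 0) (hω : ∀ i j, g (J (u i)) (u j) = 0)
    (h0 : T (u 0) (u 1) (u 2) = 0) (hp : 0 < T (u 0) (u 1) (J (u 2))) (x : E) :
    T x (u 0) (u 1) = -lam * g (J x) (u 2) := by
  have hG := h.gram_det hE u
  have hS : T (u 0) (u 1) (J (u 2)) = lam := by
    have : (Matrix.of fun i j => g (u i) (u j)) = 1 := by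
      ext i j
      simp [hu, Matrix.one_apply]
    rw [this, h0] at hG
    simp only [hω, Fin.sum_univ_three, Matrix.cons_val, Matrix.det_one] at hG
    have := h.lam_pos
    nlinarith
  obtain ⟨e₃, he, hT⟩ := h.exists_frame (e₁ := u 0) (e₂ := u 1) (by simp [hu]) (by simp [hu])
    (by simp [hu]) (hω 0 1)
  have h33 : g e₃ e₃ = 1 := by simpa using he.ortho 2 2
  have h3J : g e₃ (J (u 2)) = 1 := by
    have := hT (J (u 2))
    rw [hS] at this
    exact (mul_left_cancel₀ h.lam_pos.ne' (by linarith)).symm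
  have he3 : e₃ = J (u 2) := by
    by_contra hne
    have := h.pos _ (sub_ne_zero.2 hne)
    simp only [map_sub, sub_apply, h33, h3J, h.symm (J (u 2)) e₃, h.orth,
      hu] at this
    norm_num at this
  rw [h.toIsTypeThreeZero.rotate, hT, he3, h.omega_swap]
  ring

/-- A `1`-form with values in the forms of type `(3, 0)` vanishes if its values have no component
along `T` and its skew-symmetrization is zero. -/
theorem eq_zero_of_alternation (hE : Module.finrank ℝ E = 6)
    {P : E → E → E → E → ℝ} (hsmul : ∀ (c : ℝ) W x y z, P (c • W) x y z = c * P W x y z)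
    (hP : ∀ W, IsTypeThreeZero J (P W))
    (hcross : ∀ W u v a, g u u = 1 → g v v = 1 → g u v = 0 → g (J u) v = 0 →
      (∀ w, T u v w = g a w) → P W u v a = 0)
    (halt : ∀ W X Y Z, P W X Y Z - P X W Y Z + P Y W X Z - P Z W X Y = 0) (W x y z : E) :
    P W x y z = 0 := by
  have hl := h.lam_pos.ne'
  -- A form of type `(3, 0)` is determined by its value on one unitary frame. In a frame adapted to
  -- `T` that starts with the unit vector `e₁`, the real part of this value vanishes by `hcross`,
  -- and the imaginary part by the skew-symmetrization on `e₁, J e₁, e₂, e₃`.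
  have main : ∀ e₁, g e₁ e₁ = 1 → ∀ u v w, P e₁ u v w = 0 := by
    intro e₁ h₁ u v w
    obtain ⟨e₂, e₃, he, hT⟩ := h.exists_frame_of_unit hE h₁
    have h22 : g e₂ e₂ = 1 := by simpa using he.ortho 1 1
    have h12 : g e₁ e₂ = 0 := by simpa using he.ortho 0 1
    have hJ12 : g (J e₁) e₂ = 0 := by simpa using he.orthoJ 0 1
    have hc : ∀ W, P W e₁ e₂ e₃ = 0 := by
      intro W
      have := hcross W e₁ e₂ (lam • e₃) h₁ h22 h12 hJ12 (fun w => by rw [hT]; simp)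
      rw [((hP W).linear _ _).map_smul] at this
      simpa [hl] using this
    have hJ : P e₁ e₁ e₂ (J e₃) = 0 := by
      have ha := halt e₁ (J e₁) e₂ e₃
      rw [hc (J e₁), (hP e₂).self_J, (hP e₃).self_J, (hP e₁).move_J₁] at ha
      linarith
    have := IsUnitaryFrame.complex_form_eq_det h.toIsHermitianPair he hE (hP e₁) ![u, v, w]
    simp only [Matrix.cons_val, hc, hJ] at this
    have hre := congrArg Complex.re this
    simpa using hre
  by_cases hW : W = 0
  · simpa [hW] using hsmul 0 W x y z
  · have hpos := h.pos W hW
    have hs : Real.sqrt (g W W) ^ 2 = g W W := Real.sq_sqrt hpos.le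
    have hs0 : Real.sqrt (g W W) ≠ 0 := (Real.sqrt_pos.2 hpos).ne'
    have := main ((Real.sqrt (g W W))⁻¹ • W) (by
      simp only [map_smul, smul_apply, smul_eq_mul]
      rw [← hs, Real.sqrt_sq (Real.sqrt_nonneg _)]
      field_simp) x y z
    rw [hsmul] at this
    exact (mul_eq_zero.1 this).resolve_left (inv_ne_zero hs0)

/-- The polarization of the constant type identity. It determines only the part of the left hand
side that is symmetric in `x` and `w`; the skew part is totally skew, and is excluded by moving
`J` around. -/
theorem inner_cross_cross {A : E → E → E} (hA : ∀ u v w, T u v w = g (A u v) w) (x y w z : E) :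
    T x y (A w z) = lam ^ 2 * (g x w * g y z - g x z * g y w - g (J x) w * g (J y) z +
      g (J x) z * g (J y) w) := by
  have hT := h.toIsTypeThreeZero
  have hg := h.symm
  have hskew := h.omega_swap
  have hAA : ∀ u v, T u v (A u v) = lam ^ 2 * (g u u * g v v - g u v ^ 2 - g (J u) v ^ 2) := by
    intro u v
    obtain ⟨a, ha, haa⟩ := h.exists_cross u v
    have : A u v = a := by
      by_contra hne
      have hpos := h.pos _ (sub_ne_zero.2 hne)
      rw [map_sub g, sub_apply, ← hA, ← ha, sub_self] at hpos
      exact lt_irrefl _ hpos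
    rw [this, ha, haa]
  have hpair : ∀ x y w z, T x y (A w z) = T w z (A x y) := fun x y w z => by
    rw [hA, hA, hg]
  have hadd2 : ∀ x y y' z, T x (y + y') z = T x y z + T x y' z := fun x y y' z =>
    (hT.linear₂ x z).map_add y y'
  have hadd1 : ∀ x x' y z, T (x + x') y z = T x y z + T x' y z := fun x x' y z =>
    (hT.linear₁ y z).map_add x x'
  -- Polarization, first in `y` and then in `x`.
  have p1 : ∀ x y z, T x y (A x z) =
      lam ^ 2 * (g x x * g y z - g x y * g x z - g (J x) y * g (J x) z) := by
    intro x y z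
    have e := hAA x (y + z)
    rw [hadd2, hpair x y, hpair x z, hadd2, hadd2, hAA, hAA, hpair x z x y] at e
    simp only [map_add, add_apply, hg z y] at e
    linarith
  have p2 : ∀ x y w z, T x y (A w z) + T w y (A x z) = lam ^ 2 * (2 * g x w * g y z -
      g x y * g w z - g w y * g x z - g (J x) y * g (J w) z - g (J w) y * g (J x) z) := by
    intro x y w z
    have e := p1 (x + w) y z
    rw [hadd1, hpair x y, hpair w y, hadd1, hadd1, hpair x z x y, hpair w z x y, hpair x z w y,
      hpair w z w y, p1, p1] at e
    simp only [map_add, add_apply, hg w x] at e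
    linarith
  -- The difference `R` of the two sides is skew in its first and third arguments and in its pairs;
  -- moving `J` from one argument to another gives `R = -R`.
  let R : E → E → E → E → ℝ := fun x y w z => T x y (A w z) - lam ^ 2 * (g x w * g y z -
    g x z * g y w - g (J x) w * g (J y) z + g (J x) z * g (J y) w)
  have r13 : ∀ x y w z, R x y w z = -R w y x z := by
    intro x y w z
    have e := p2 x y w z
    simp only [R]
    rw [hg w x, hskew w x, hg w y, hskew w y, hg x y, hskew x y] at *
    linarith
  have rpair : ∀ x y w z, R x y w z = R w z x y := by
    intro x y w z
    simp only [R]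
    rw [hpair w z, hg w x, hg z y, hg w y, hg z x, hskew w x, hskew z y, hskew w y, hskew z x]
    ring
  have rJ12 : ∀ x y w z, R (J x) y w z = R x (J y) w z := by
    intro x y w z
    simp only [R]
    rw [← hT.move_J, hT.move_J₁, h.J_J, h.J_J]
    simp only [map_neg, neg_apply]
    ring
  have rJ34 : ∀ x y w z, R x y (J w) z = R x y w (J z) := fun x y w z => by
    rw [rpair, rJ12, rpair]
  have rJ23 : ∀ x y w z, R x (J y) w z = R x y (J w) z := fun x y w z => by
    rw [r13 x y, rJ12, r13 w (J y), neg_neg]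
  have rneg : ∀ x y w z, R x (-y) w z = -R x y w z := fun x y w z => by
    simp only [R]
    rw [(hT.linear₂ x (A w z)).map_neg]
    simp only [map_neg, neg_apply]
    ring
  have rJJ : ∀ x y w z, R x (J y) w (J z) = R x y w z := by
    intro x y w z
    have hAJ : T x (J y) (A w (J z)) = T x y (A w z) := by
      have : A w (J z) = -J (A w z) := by
        by_contra hne
        have hpos := h.pos _ (sub_ne_zero.2 hne)
        have key : ∀ c, g (A w (J z) - -J (A w z)) c = 0 := fun c => by
          rw [map_sub, sub_apply, ← hA, map_neg, neg_apply, h.skew, ← hA, ← hT.move_J]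
          ring
        exact hpos.ne' (key _)
      rw [this, (hT.linear x (J y)).map_neg, hT.move_J, h.J_J, (hT.linear₂ x (A w z)).map_neg,
        neg_neg]
    simp only [R]
    have s : g x (J z) = -g (J x) z := by rw [h.skew, neg_neg]
    rw [hAJ, h.orth y z, h.orth (J y) z, h.orth x z, h.J_J, map_neg, neg_apply, s]
    ring
  have : R x y w z = 0 := by
    have e := rJJ x y w z
    rw [← rJ34, ← rJ23, h.J_J, rneg] at e
    linarith
  simp only [R] at this
  linarith

end IsNearlyKahlerAlgebra

end SpecialUnitaryAlgebra

/-! ### The covariant derivative of the torsion form -/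

section CovariantAlgebra

variable {E : Type*} [NormedAddCommGroup E] [NormedSpace ℝ E]

namespace IsNearlyKahlerAlgebra

variable {g : E →L[ℝ] E →L[ℝ] ℝ} {J : E →L[ℝ] E} {T : E → E → E → ℝ} {lam : ℝ}

/-- Let `DT`, `DJ` be the first derivatives of `T` and `J` in a chart, and `Γ` the Christoffel
symbols. Then the covariant derivative of `T` is `∇_W T = -λ² W ∧ ω`: the difference `P` of the two
sides is of type `(3, 0)`, has no component along `T`, and its skew-symmetrization is zero because
`T` is closed. -/
theorem covDeriv_eq (h : IsNearlyKahlerAlgebra g J T lam) (hE : Module.finrank ℝ E = 6)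
    {Γ DJ : E → E →L[ℝ] E} {DT : E → E → E → E → ℝ} (hsymm : ∀ W X, Γ W X = Γ X W)
    (hT : ∀ X Y Z, T X Y Z = g (DJ X Y + Γ X (J Y) - J (Γ X Y)) Z)
    (hsmul : ∀ (c : ℝ) W X Y Z, DT (c • W) X Y Z = c * DT W X Y Z)
    (hDT : ∀ W, IsAltThree (DT W))
    (hmove : ∀ W X Y Z, DT W X Y (J Z) + T X Y (DJ W Z) = DT W X (J Y) Z + T X (DJ W Y) Z)
    (hclosed : ∀ W X Y Z, DT W X Y Z - DT X W Y Z + DT Y W X Z - DT Z W X Y = 0)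
    (hcross : ∀ W u v a, g u u = 1 → g v v = 1 → g u v = 0 → g (J u) v = 0 →
      (∀ w, T u v w = g a w) → g a a = lam ^ 2 →
      DT W u v a = lam ^ 2 * (g (Γ W u) u + g (Γ W v) v) + g (Γ W a) a) (W X Y Z : E) :
    DT W X Y Z = T (Γ W X) Y Z + T X (Γ W Y) Z + T X Y (Γ W Z) -
      lam ^ 2 * (g W X * g (J Y) Z + g W Y * g (J Z) X + g W Z * g (J X) Y) := by
  have hA0 := h.toIsTypeThreeZero
  have sw12 := hA0.swap₁₂
  have sw23 := hA0.swap₂₃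
  have mvJ := hA0.move_J
  have hquad := h.inner_cross_cross hT
  have gs := h.symm
  have os := h.omega_swap
  have gJ : ∀ x z, g x (J z) = -g (J x) z := fun x z => by rw [h.skew, neg_neg]
  have t3 : ∀ x y z z', T x y (z + z') = T x y z + T x y z' := fun x y => (hA0.linear x y).map_add
  have t3' : ∀ x y z z', T x y (z - z') = T x y z - T x y z' := fun x y => (hA0.linear x y).map_sub
  let P : E → E → E → E → ℝ := fun W X Y Z => DT W X Y Z - T (Γ W X) Y Z - T X (Γ W Y) Z -
    T X Y (Γ W Z) + lam ^ 2 * (g W X * g (J Y) Z + g W Y * g (J Z) X + g W Z * g (J X) Y)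
  suffices hP : P W X Y Z = 0 by
    simp only [P] at hP
    linarith
  refine h.eq_zero_of_alternation hE (P := P) ?_ ?_ ?_ ?_ W X Y Z
  -- Homogeneity in `W`.
  · intro c W X Y Z
    simp only [P, hsymm (c • W), hsymm W, map_smul, smul_apply, smul_eq_mul, hsmul,
      (hA0.linear₁ _ _).map_smul, (hA0.linear₂ _ _).map_smul, (hA0.linear _ _).map_smul]
    ring
  -- The type: differentiate `T(X, Y, J Z) = T(X, J Y, Z)` and use `inner_cross_cross`.
  · intro W
    refine ⟨⟨fun X Y => ⟨fun Z Z' => ?_, fun c Z => ?_⟩, fun X Y Z => ?_, fun X Y Z => ?_⟩,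
      fun X Y Z => ?_⟩
    · simp only [P, map_add, add_apply, t3, ((hDT W).linear _ _).map_add]
      ring
    · simp only [P, map_smul, smul_apply, smul_eq_mul, (hA0.linear _ _).map_smul,
        ((hDT W).linear _ _).map_smul]
      ring
    · simp only [P]
      rw [(hDT W).swap₁₂, sw12 (Γ W X), sw12 X (Γ W Y), sw12 X Y, os Y Z, os Z X, os X Y]
      ring
    · simp only [P]
      rw [(hDT W).swap₂₃, sw23 (Γ W X), sw23 X (Γ W Y), sw23 X Y, os Y Z, os Z X, os X Y]
      ring
    · have e := hmove W X Y Z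
      have e1 := hquad X Y W Z
      have e2 := hquad X Z W Y
      rw [t3', t3, mvJ] at e1 e2
      rw [sw23 X (DJ W Y) Z] at e
      simp only [P]
      rw [mvJ (Γ W X), sw23 X (Γ W Y) (J Z), sw23 X (Γ W (J Y)) Z, h.J_J, h.J_J,
        h.orth, h.orth, map_neg, neg_apply, map_neg, neg_apply, gJ, gJ]
      simp only [gs W X, gs W Y, gs W Z, gs Z X, gs Z Y, gs Y X, os W X, os W Y, os W Z, os Z X,
        os Z Y, os Y X] at e1 e2 ⊢
      linarith
  -- The component along `T`: the value on `u`, `v` and their cross product `a`.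
  · intro W u v a huu hvv huv hJuv ha
    have haa : g a a = lam ^ 2 := by
      obtain ⟨b, hb, hbb⟩ := h.exists_cross u v
      have : a = b := by
        by_contra hne
        have hpos := h.pos _ (sub_ne_zero.2 hne)
        rw [map_sub g, sub_apply, ← ha, ← hb, sub_self] at hpos
        exact lt_irrefl _ hpos
      rw [this, hbb, huu, hvv, huv, hJuv]
      ring
    have hc := hcross W u v a huu hvv huv hJuv ha haa
    have haA : a = DJ u v + Γ u (J v) - J (Γ u v) := by
      by_contra hne
      have hpos := h.pos _ (sub_ne_zero.2 hne)
      rw [map_sub g, sub_apply, ← ha, ← hT, sub_self] at hpos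
      exact lt_irrefl _ hpos
    have q1 := hquad (Γ W u) v u v
    have q2 := hquad u (Γ W v) u v
    rw [← haA] at q1 q2
    have z1 : g (J v) a = 0 := by rw [gs, ← ha, hA0.rotate, hA0.self_J]
    have z2 : g (J a) u = 0 := by rw [os, gs, ← ha, sw23, hA0.self_J, neg_zero, neg_zero]
    have z3 : g (J v) u = 0 := by rw [os, hJuv, neg_zero]
    simp only [P]
    rw [hc, q1, q2, ha (Γ W a), gs a (Γ W a), hJuv, z1, z2, huu, hvv, huv, z3, h.omega_self,
      h.omega_self, gs v u, huv]
    ring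
  -- The skew-symmetrization: the Christoffel symbols cancel by symmetry, and `W ∧ ω` drops out.
  · intro W X Y Z
    have e := hclosed W X Y Z
    simp only [P]
    rw [hsymm X W, hsymm Y W, hsymm Y X, hsymm Z W, hsymm Z X, hsymm Z Y, sw12 X (Γ W Y) Z,
      sw12 W (Γ X Y) Z, sw12 W (Γ X Z) Y, ← hA0.rotate (Γ W Z) X Y, ← hA0.rotate (Γ X Z) W Y,
      ← hA0.rotate (Γ Y Z) W X]
    simp only [gs W X, gs W Y, gs W Z, gs Z X, gs Z Y, gs Y X, os W X, os W Y, os W Z, os Z X,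
        os Z Y, os Y X]
    linarith

/-- The differential of `S = T(·, ·, J ·)` is `2 λ² ω ∧ ω`, because `∇_W S = λ² (W ⌟ ω) ∧ ω`. -/
theorem alternation_star_eq (h : IsNearlyKahlerAlgebra g J T lam) {Γ DJ : E → E →L[ℝ] E}
    {DT : E → E → E → E → ℝ} (hsymm : ∀ W X, Γ W X = Γ X W)
    (hT : ∀ X Y Z, T X Y Z = g (DJ X Y + Γ X (J Y) - J (Γ X Y)) Z)
    (hcov : ∀ W X Y Z, DT W X Y Z = T (Γ W X) Y Z + T X (Γ W Y) Z + T X Y (Γ W Z) -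
      lam ^ 2 * (g W X * g (J Y) Z + g W Y * g (J Z) X + g W Z * g (J X) Y)) (W X Y Z : E) :
    (DT W X Y (J Z) + T X Y (DJ W Z)) - (DT X W Y (J Z) + T W Y (DJ X Z)) +
        (DT Y W X (J Z) + T W X (DJ Y Z)) - (DT Z W X (J Y) + T W X (DJ Z Y)) =
      4 * lam ^ 2 * (g (J W) X * g (J Y) Z - g (J W) Y * g (J X) Z + g (J W) Z * g (J X) Y) := by
  have hA0 := h.toIsTypeThreeZero
  have sw12 := hA0.swap₁₂
  have sw23 := hA0.swap₂₃
  have mvJ := hA0.move_J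
  have hquad := h.inner_cross_cross hT
  have gs := h.symm
  have os := h.omega_swap
  have gJ : ∀ x z, g x (J z) = -g (J x) z := fun x z => by rw [h.skew, neg_neg]
  have t3 : ∀ x y z z', T x y (z + z') = T x y z + T x y z' := fun x y => (hA0.linear x y).map_add
  have t3' : ∀ x y z z', T x y (z - z') = T x y z - T x y z' := fun x y => (hA0.linear x y).map_sub
  have key : ∀ W X Y Z, DT W X Y (J Z) + T X Y (DJ W Z) =
      T (Γ W X) Y (J Z) + T X (Γ W Y) (J Z) + T X Y (J (Γ W Z)) +
        lam ^ 2 * (g (J W) X * g (J Y) Z + g (J W) Y * g (J Z) X + g (J W) Z * g (J X) Y) := by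
    intro W X Y Z
    have e1 := hquad X Y W Z
    rw [t3', t3] at e1
    rw [hcov, h.J_J, h.orth, map_neg, neg_apply, gJ W Z]
    simp only [gs W X, gs W Y, gs W Z, gs Z X, gs Z Y, gs Y X, os W X, os W Y, os W Z, os Z X,
      os Z Y, os Y X] at e1 ⊢
    linarith
  rw [key, key, key, key, hsymm X W, hsymm Y W, hsymm Y X, hsymm Z W, hsymm Z X, hsymm Z Y,
    sw12 X (Γ W Y), sw12 W (Γ X Y), sw12 W (Γ X Z) (J Y), mvJ X Y, mvJ W Y, mvJ W X (Γ Y Z),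
    ← hA0.rotate (Γ W Z) X (J Y), ← hA0.rotate (Γ X Z) W (J Y), ← mvJ W X]
  simp only [gs W X, gs W Y, gs W Z, gs Z X, gs Z Y, gs Y X, os W X, os W Y, os W Z, os Z X,
    os Z Y, os Y X]
  linarith

end IsNearlyKahlerAlgebra

end CovariantAlgebra

/-! ### Nearly Kähler structures on open sets of a vector space -/

section LocalCalculus

variable {E : Type*} [NormedAddCommGroup E] [NormedSpace ℝ E]

/-- The fundamental form `ω(v, w) = g(Jv, w)` of a Hermitian structure on a vector space. -/
noncomputable def kahlerForm (g : E → E →L[ℝ] E →L[ℝ] ℝ) (J : E → E →L[ℝ] E) (p : E) :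
    E →L[ℝ] E →L[ℝ] ℝ :=
  (g p).comp (J p)

@[simp]
theorem kahlerForm_apply (g : E → E →L[ℝ] E →L[ℝ] ℝ) (J : E → E →L[ℝ] E) (p X Y : E) :
    kahlerForm g J p X Y = g p (J p X) Y := rfl

/-- The `3`-form `(1 / 3) dω`, as a trilinear form. -/
noncomputable def torsionForm (g : E → E →L[ℝ] E →L[ℝ] ℝ) (J : E → E →L[ℝ] E) (p : E) :
    E →L[ℝ] E →L[ℝ] E →L[ℝ] ℝ :=
  (1 / 3 : ℝ) • (fderiv ℝ (kahlerForm g J) p - (fderiv ℝ (kahlerForm g J) p).flip +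
    (ContinuousLinearMap.flipₗᵢ ℝ E E ℝ : (E →L[ℝ] E →L[ℝ] ℝ) →L[ℝ] E →L[ℝ] E →L[ℝ] ℝ).comp
      (fderiv ℝ (kahlerForm g J) p).flip)

theorem torsionForm_apply (g : E → E →L[ℝ] E →L[ℝ] ℝ) (J : E → E →L[ℝ] E) (p X Y Z : E) :
    torsionForm g J p X Y Z = (1 / 3) * (fderiv ℝ (kahlerForm g J) p X Y Z -
      fderiv ℝ (kahlerForm g J) p Y X Z + fderiv ℝ (kahlerForm g J) p Z X Y) := rfl

/-- The form `T(·, ·, J ·)`, as a trilinear form. -/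
noncomputable def starTorsionForm (g : E → E →L[ℝ] E →L[ℝ] ℝ) (J : E → E →L[ℝ] E) (p : E) :
    E →L[ℝ] E →L[ℝ] E →L[ℝ] ℝ :=
  (ContinuousLinearMap.compL ℝ E (E →L[ℝ] ℝ) (E →L[ℝ] ℝ)
    ((ContinuousLinearMap.compL ℝ E E ℝ).flip (J p))).comp (torsionForm g J p)

theorem starTorsionForm_apply (g : E → E →L[ℝ] E →L[ℝ] ℝ) (J : E → E →L[ℝ] E) (p X Y Z : E) :
    starTorsionForm g J p X Y Z = torsionForm g J p X Y (J p Z) := rfl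

/-- A nearly Kähler structure of constant type on an open set of a vector space. Of the
Levi-Civita connection only the Christoffel symbols `Γ` at each single point enter; they need not
be assumed smooth. -/
structure IsLocalNearlyKahler (U : Set E) (g : E → E →L[ℝ] E →L[ℝ] ℝ) (J : E → E →L[ℝ] E)
    (lam : ℝ) : Prop where
  isOpen : IsOpen U
  smooth_g : ContDiffOn ℝ ∞ g U
  smooth_J : ContDiffOn ℝ ∞ J U
  hermitian : ∀ p ∈ U, IsHermitianPair (g p) (J p)
  lam_pos : 0 < lam
  connection : ∀ p ∈ U, ∃ Γ : E → E →L[ℝ] E, (∀ W X, Γ W X = Γ X W) ∧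
    (∀ W X Y, fderiv ℝ g p W X Y = g p (Γ W X) Y + g p X (Γ W Y)) ∧
    (∀ X, fderiv ℝ J p X X + Γ X (J p X) - J p (Γ X X) = 0) ∧
    ∀ X Y, g p (fderiv ℝ J p X Y + Γ X (J p Y) - J p (Γ X Y))
        (fderiv ℝ J p X Y + Γ X (J p Y) - J p (Γ X Y)) =
      lam ^ 2 * (g p X X * g p Y Y - g p X Y ^ 2 - g p (J p X) Y ^ 2)

namespace IsLocalNearlyKahler

variable {U : Set E} {g : E → E →L[ℝ] E →L[ℝ] ℝ} {J : E → E →L[ℝ] E} {lam : ℝ}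
  (h : IsLocalNearlyKahler U g J lam) {p : E} (hp : p ∈ U)
include h

theorem smooth_kahlerForm : ContDiffOn ℝ ∞ (kahlerForm g J) U :=
  h.smooth_g.clm_comp h.smooth_J

theorem smooth_fderiv_kahlerForm : ContDiffOn ℝ ∞ (fderiv ℝ (kahlerForm g J)) U :=
  h.smooth_kahlerForm.fderiv_of_isOpen h.isOpen (by simp)

theorem smooth_torsionForm : ContDiffOn ℝ ∞ (torsionForm g J) U := by
  have hD := h.smooth_fderiv_kahlerForm
  have hF : ContDiffOn ℝ ∞ (fun p => (fderiv ℝ (kahlerForm g J) p).flip) U :=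
    (ContinuousLinearMap.flipₗᵢ ℝ E E (E →L[ℝ] ℝ)).contDiff.comp_contDiffOn hD
  exact ((hD.sub hF).add (contDiffOn_const.clm_comp hF)).const_smul _

theorem smooth_starTorsionForm : ContDiffOn ℝ ∞ (starTorsionForm g J) U := by
  have hJ : ContDiffOn ℝ ∞ (fun p => (ContinuousLinearMap.compL ℝ E E ℝ).flip (J p)) U :=
    ((ContinuousLinearMap.compL ℝ E E ℝ).flip).contDiff.comp_contDiffOn h.smooth_J
  have hc : ContDiffOn ℝ ∞ (fun p => ContinuousLinearMap.compL ℝ E (E →L[ℝ] ℝ) (E →L[ℝ] ℝ)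
      ((ContinuousLinearMap.compL ℝ E E ℝ).flip (J p))) U :=
    (ContinuousLinearMap.compL ℝ E (E →L[ℝ] ℝ) (E →L[ℝ] ℝ)).contDiff.comp_contDiffOn hJ
  exact hc.clm_comp h.smooth_torsionForm

include hp

theorem differentiableAt_g : DifferentiableAt ℝ g p :=
  (h.smooth_g.contDiffAt (h.isOpen.mem_nhds hp)).differentiableAt (by simp)

theorem differentiableAt_J : DifferentiableAt ℝ J p :=
  (h.smooth_J.contDiffAt (h.isOpen.mem_nhds hp)).differentiableAt (by simp)

theorem fderiv_kahlerForm (W X Y : E) : fderiv ℝ (kahlerForm g J) p W X Y =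
    fderiv ℝ g p W (J p X) Y + g p (fderiv ℝ J p W X) Y := by
  have : HasFDerivAt (kahlerForm g J) _ p :=
    (h.differentiableAt_g hp).hasFDerivAt.clm_comp (h.differentiableAt_J hp).hasFDerivAt
  rw [this.fderiv]
  simp [add_comm]

/-- The torsion form is `g((∇_X J) Y, Z)`. -/
theorem exists_connection : ∃ Γ : E → E →L[ℝ] E, (∀ W X, Γ W X = Γ X W) ∧
    (∀ W X Y, fderiv ℝ g p W X Y = g p (Γ W X) Y + g p X (Γ W Y)) ∧
    (∀ X Y Z, torsionForm g J p X Y Z =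
      g p (fderiv ℝ J p X Y + Γ X (J p Y) - J p (Γ X Y)) Z) ∧
    IsNearlyKahlerAlgebra (g p) (J p) (fun X Y Z => torsionForm g J p X Y Z) lam := by
  obtain ⟨Γ, hsymm, hcompat, hNK, htype⟩ := h.connection p hp
  have hH := h.hermitian p hp
  have hU : ∀ᶠ q in 𝓝 p, q ∈ U := h.isOpen.mem_nhds hp
  -- `A X Y = (∇_X J) Y`.
  let A : E → E → E := fun X Y => fderiv ℝ J p X Y + Γ X (J p Y) - J p (Γ X Y)
  have hω : ∀ W X Y, fderiv ℝ (kahlerForm g J) p W X Y =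
      g p (A W X) Y + g p (J p (Γ W X)) Y + g p (J p X) (Γ W Y) := by
    intro W X Y
    rw [h.fderiv_kahlerForm hp, hcompat]
    simp only [A, map_add, map_sub, add_apply, sub_apply]
    ring
  have hAadd : ∀ W W' X, A (W + W') X = A W X + A W' X := fun W W' X => by
    simp only [A, hsymm _ (J p X), hsymm _ X, map_add, add_apply]
    abel
  have hAadd' : ∀ W X X', A W (X + X') = A W X + A W X' := fun W X X' => by
    simp only [A, map_add]
    abel
  have hAskew : ∀ W X, A W X = -A X W := fun W X => by
    have h1 : A (W + X) (W + X) = 0 := hNK _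
    rw [hAadd, hAadd', hAadd'] at h1
    have h2 : A W W = 0 := hNK W
    have h3 : A X X = 0 := hNK X
    rw [h2, h3, zero_add, add_zero] at h1
    exact eq_neg_of_add_eq_zero_left h1
  have hωskew : ∀ W X Y, fderiv ℝ (kahlerForm g J) p W X Y =
      -fderiv ℝ (kahlerForm g J) p W Y X := by
    intro W X Y
    have hd : DifferentiableAt ℝ (kahlerForm g J) p :=
      (h.smooth_kahlerForm.contDiffAt (h.isOpen.mem_nhds hp)).differentiableAt (by simp)
    have key : ∀ X Y, fderiv ℝ (fun q => kahlerForm g J q X Y) p W =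
        fderiv ℝ (kahlerForm g J) p W X Y := by
      intro X Y
      have := (hd.hasFDerivAt.clm_apply (hasFDerivAt_const X p)).clm_apply (hasFDerivAt_const Y p)
      rw [this.fderiv]
      simp
    rw [← key, ← key, ← neg_apply, ← fderiv_fun_neg]
    congr 1
    apply Filter.EventuallyEq.fderiv_eq
    filter_upwards [hU] with q hq
    exact (h.hermitian q hq).omega_swap X Y
  have hAg : ∀ W X Y, g p (A W X) Y = -g p (A W Y) X := by
    intro W X Y
    have := hωskew W X Y
    rw [hω, hω, hH.symm (J p X) (Γ W Y), hH.symm (J p Y) (Γ W X), hH.skew (Γ W X) Y,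
      hH.skew (Γ W Y) X] at this
    linarith
  have hJJ : ∀ W X, fderiv ℝ J p W (J p X) + J p (fderiv ℝ J p W X) = 0 := by
    intro W X
    have hd := (h.differentiableAt_J hp).hasFDerivAt
    have h1 := hd.clm_apply (hd.clm_apply (hasFDerivAt_const X p))
    have h2 : HasFDerivAt (fun _ : E => -X) (0 : E →L[ℝ] E) p := hasFDerivAt_const _ _
    have h3 := h1.unique (h2.congr_of_eventuallyEq (by
      filter_upwards [hU] with q hq
      exact (h.hermitian q hq).J_J X))
    have := congrArg (fun L : E →L[ℝ] E => L W) h3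
    simpa [add_comm] using this
  have hAJ : ∀ W X, A W (J p X) = -J p (A W X) := by
    intro W X
    rw [eq_neg_iff_add_eq_zero]
    calc A W (J p X) + J p (A W X)
        = (fderiv ℝ J p W (J p X) + J p (fderiv ℝ J p W X)) + Γ W (J p (J p X)) -
          J p (J p (Γ W X)) := by simp only [A, map_add, map_sub]; abel
      _ = 0 := by rw [hJJ, hH.J_J, hH.J_J, map_neg]; abel
  have hT : ∀ X Y Z, torsionForm g J p X Y Z = g p (A X Y) Z := by
    intro X Y Z
    rw [torsionForm_apply, hω, hω, hω, hAskew Y X, hAskew Z X, hsymm Y X, hsymm Z X, hsymm Z Y,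
      map_neg, map_neg, neg_apply, neg_apply, hAg X Z Y, hH.omega_swap (Γ X Z) Y]
    ring
  refine ⟨Γ, hsymm, hcompat, hT, ⟨hH, ⟨⟨?_, ?_, ?_⟩, ?_⟩, h.lam_pos, ?_⟩⟩
  · intro X Y
    exact (torsionForm g J p X Y).isBoundedLinearMap.toIsLinearMap
  · intro X Y Z
    rw [hT, hT, hAskew]
    simp
  · intro X Y Z
    rw [hT, hT, hAg]
  · intro X Y Z
    rw [hT, hT, hAJ, map_neg, neg_apply, hH.skew, neg_neg]
  · intro X Y
    exact ⟨A X Y, hT X Y, htype X Y⟩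

/-- Total skewness and type `(3, 0)` of `T` are consequences of the nearly Kähler condition. -/
theorem algebra :
    IsNearlyKahlerAlgebra (g p) (J p) (fun X Y Z => torsionForm g J p X Y Z) lam := by
  obtain ⟨Γ, -, -, -, hA⟩ := h.exists_connection hp
  exact hA

theorem hasFDerivAt_torsionForm (X Y Z : E) :
    HasFDerivAt (fun q => torsionForm g J q X Y Z)
      ((((fderiv ℝ (torsionForm g J) p).flip X).flip Y).flip Z) p := by
  have hd : DifferentiableAt ℝ (torsionForm g J) p :=
    (h.smooth_torsionForm.contDiffAt (h.isOpen.mem_nhds hp)).differentiableAt (by simp)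
  have := ((hd.hasFDerivAt.clm_apply (hasFDerivAt_const X p)).clm_apply
    (hasFDerivAt_const Y p)).clm_apply (hasFDerivAt_const Z p)
  simpa only [ContinuousLinearMap.comp_zero, zero_add] using this

theorem fderiv_torsionForm_swap₁₂ (W X Y Z : E) : fderiv ℝ (torsionForm g J) p W X Y Z =
    -fderiv ℝ (torsionForm g J) p W Y X Z := by
  have h1 := h.hasFDerivAt_torsionForm hp X Y Z
  have h2 := (h.hasFDerivAt_torsionForm hp Y X Z).neg
  have h3 := h1.unique (h2.congr_of_eventuallyEq (by
    filter_upwards [h.isOpen.mem_nhds hp] with q hq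
    exact (h.algebra hq).swap₁₂ X Y Z))
  simpa using congrArg (fun L : E →L[ℝ] ℝ => L W) h3

theorem fderiv_torsionForm_swap₂₃ (W X Y Z : E) : fderiv ℝ (torsionForm g J) p W X Y Z =
    -fderiv ℝ (torsionForm g J) p W X Z Y := by
  have h1 := h.hasFDerivAt_torsionForm hp X Y Z
  have h2 := (h.hasFDerivAt_torsionForm hp X Z Y).neg
  have h3 := h1.unique (h2.congr_of_eventuallyEq (by
    filter_upwards [h.isOpen.mem_nhds hp] with q hq
    exact (h.algebra hq).swap₂₃ X Y Z))
  simpa using congrArg (fun L : E →L[ℝ] ℝ => L W) h3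

/-- The derivative of the identity `T(X, Y, J Z) = T(X, J Y, Z)`. -/
theorem fderiv_torsionForm_move_J (W X Y Z : E) :
    fderiv ℝ (torsionForm g J) p W X Y (J p Z) + torsionForm g J p X Y (fderiv ℝ J p W Z) =
      fderiv ℝ (torsionForm g J) p W X (J p Y) Z +
        torsionForm g J p X (fderiv ℝ J p W Y) Z := by
  have hd : HasFDerivAt (torsionForm g J) _ p :=
    ((h.smooth_torsionForm.contDiffAt (h.isOpen.mem_nhds hp)).differentiableAt
      (by simp)).hasFDerivAt
  have hJ := (h.differentiableAt_J hp).hasFDerivAt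
  have h1 := ((hd.clm_apply (hasFDerivAt_const X p)).clm_apply
    (hasFDerivAt_const Y p)).clm_apply (hJ.clm_apply (hasFDerivAt_const Z p))
  have h2 := ((hd.clm_apply (hasFDerivAt_const X p)).clm_apply
    (hJ.clm_apply (hasFDerivAt_const Y p))).clm_apply (hasFDerivAt_const Z p)
  have h3 := h1.unique (h2.congr_of_eventuallyEq (by
    filter_upwards [h.isOpen.mem_nhds hp] with q hq
    exact (h.algebra hq).move_J X Y Z))
  have := congrArg (fun L : E →L[ℝ] ℝ => L W) h3
  simp at this
  linarith

/-- The `3`-form `T = (1 / 3) dω` is closed. -/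
theorem alternation_fderiv_torsionForm (W X Y Z : E) :
    fderiv ℝ (torsionForm g J) p W X Y Z - fderiv ℝ (torsionForm g J) p X W Y Z +
      fderiv ℝ (torsionForm g J) p Y W X Z - fderiv ℝ (torsionForm g J) p Z W X Y = 0 := by
  have hU := h.isOpen.mem_nhds hp
  have hsymm : IsSymmSndFDerivAt ℝ (kahlerForm g J) p :=
    (h.smooth_kahlerForm.contDiffAt hU).isSymmSndFDerivAt
      (by simp; exact ENat.LEInfty.out)
  have hd : HasFDerivAt (fderiv ℝ (kahlerForm g J)) _ p :=
    ((h.smooth_fderiv_kahlerForm.contDiffAt hU).differentiableAt (by simp)).hasFDerivAt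
  have hc : ∀ X Y Z, HasFDerivAt (fun q => fderiv ℝ (kahlerForm g J) q X Y Z) _ p :=
    fun X Y Z => ((hd.clm_apply (hasFDerivAt_const X p)).clm_apply
      (hasFDerivAt_const Y p)).clm_apply (hasFDerivAt_const Z p)
  have key : ∀ W X Y Z, fderiv ℝ (torsionForm g J) p W X Y Z = (1 / 3) *
      (fderiv ℝ (fderiv ℝ (kahlerForm g J)) p W X Y Z -
        fderiv ℝ (fderiv ℝ (kahlerForm g J)) p W Y X Z +
        fderiv ℝ (fderiv ℝ (kahlerForm g J)) p W Z X Y) := by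
    intro W X Y Z
    have h1 := h.hasFDerivAt_torsionForm hp X Y Z
    have h2 := (((hc X Y Z).sub (hc Y X Z)).add (hc Z X Y)).const_mul (1 / 3)
    have := congrArg (fun L : E →L[ℝ] ℝ => L W) (h1.unique h2)
    simp at this
    linarith
  simp only [key]
  rw [hsymm X W, hsymm Y W, hsymm Y X, hsymm Z W, hsymm Z X, hsymm Z Y]
  ring

end IsLocalNearlyKahler

end LocalCalculus

/-! ### The exterior derivative of the form `T(·, ·, J ·)` -/

section StarTorsionForm

variable {E : Type*} [NormedAddCommGroup E] [NormedSpace ℝ E]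

namespace IsLocalNearlyKahler

variable {U : Set E} {g : E → E →L[ℝ] E →L[ℝ] ℝ} {J : E → E →L[ℝ] E} {lam : ℝ}
  (h : IsLocalNearlyKahler U g J lam) {p : E} (hp : p ∈ U)
include h hp

theorem fderiv_starTorsionForm (W X Y Z : E) : fderiv ℝ (starTorsionForm g J) p W X Y Z =
    fderiv ℝ (torsionForm g J) p W X Y (J p Z) + torsionForm g J p X Y (fderiv ℝ J p W Z) := by
  have hU := h.isOpen.mem_nhds hp
  have hS : HasFDerivAt (starTorsionForm g J) _ p :=
    ((h.smooth_starTorsionForm.contDiffAt hU).differentiableAt (by simp)).hasFDerivAt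
  have hd : HasFDerivAt (torsionForm g J) _ p :=
    ((h.smooth_torsionForm.contDiffAt hU).differentiableAt (by simp)).hasFDerivAt
  have hJ := (h.differentiableAt_J hp).hasFDerivAt
  have h1 := ((hS.clm_apply (hasFDerivAt_const X p)).clm_apply
    (hasFDerivAt_const Y p)).clm_apply (hasFDerivAt_const Z p)
  have h2 := ((hd.clm_apply (hasFDerivAt_const X p)).clm_apply
    (hasFDerivAt_const Y p)).clm_apply (hJ.clm_apply (hasFDerivAt_const Z p))
  have := congrArg (fun L : E →L[ℝ] ℝ => L W) (h1.unique h2)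
  simp at this
  linarith

/-- At `p` the function `λ² ‖u ∧ v‖² ‖a‖² - T(u, v, a)²` of the base point has a minimum, if `a` is
the cross product of `u` and `v`. So its derivative is zero. -/
theorem fderiv_torsionForm_cross {Γ : E → E →L[ℝ] E}
    (hcompat : ∀ W X Y, fderiv ℝ g p W X Y = g p (Γ W X) Y + g p X (Γ W Y)) (W u v a : E)
    (huu : g p u u = 1) (hvv : g p v v = 1) (huv : g p u v = 0) (hJuv : g p (J p u) v = 0)
    (ha : ∀ w, torsionForm g J p u v w = g p a w) (haa : g p a a = lam ^ 2) :
    fderiv ℝ (torsionForm g J) p W u v a =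
      lam ^ 2 * (g p (Γ W u) u + g p (Γ W v) v) + g p (Γ W a) a := by
  have hA := h.algebra hp
  have hl := hA.lam_pos
  let f : E → ℝ := fun q => lam ^ 2 * (g q u u * g q v v - g q u v ^ 2 - g q (J q u) v ^ 2) *
    g q a a - torsionForm g J q u v a ^ 2
  have hg := (h.differentiableAt_g hp).hasFDerivAt
  have hc : ∀ X Y, HasFDerivAt (fun q => g q X Y) _ p := fun X Y =>
    (hg.clm_apply (hasFDerivAt_const X p)).clm_apply (hasFDerivAt_const Y p)
  have hω : HasFDerivAt (fun q => g q (J q u) v) _ p :=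
    (hg.clm_apply ((h.differentiableAt_J hp).hasFDerivAt.clm_apply
      (hasFDerivAt_const u p))).clm_apply (hasFDerivAt_const v p)
  have hT := h.hasFDerivAt_torsionForm hp u v a
  have hf : HasFDerivAt f _ p := ((((((hc u u).mul (hc v v)).sub ((hc u v).pow 2)).sub
    (hω.pow 2)).const_mul (lam ^ 2)).mul (hc a a)).sub (hT.pow 2)
  have hmin : IsLocalMin f p := by
    filter_upwards [h.isOpen.mem_nhds hp] with q hq
    have hAq := h.algebra hq
    obtain ⟨b, hb, hbb⟩ := hAq.exists_cross u v
    have h0 : f p = 0 := by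
      simp only [f, huu, hvv, huv, hJuv, haa, ha]
      ring
    have hcs := hAq.cauchy_schwarz b a
    have hba : torsionForm g J q u v a = g q b a := hb a
    rw [h0]
    simp only [f]
    rw [hba, ← hbb]
    linarith
  have h0 := congrArg (fun L : E →L[ℝ] ℝ => L W) (hmin.hasFDerivAt_eq_zero hf)
  have gs := hA.symm
  simp [huu, hvv, huv, hJuv, haa, ha, hcompat] at h0
  rw [gs u, gs v, gs a] at h0
  have : lam ^ 2 * (fderiv ℝ (torsionForm g J) p W u v a -
      (lam ^ 2 * (g p (Γ W u) u + g p (Γ W v) v) + g p (Γ W a) a)) = 0 := by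
    linarith
  have := (mul_eq_zero.1 this).resolve_left (by positivity)
  linarith

/-- The exterior derivative of `T(·, ·, J ·)` is `2 λ² ω ∧ ω`. -/
theorem alternation_fderiv_starTorsionForm (hE : Module.finrank ℝ E = 6) (W X Y Z : E) :
    fderiv ℝ (starTorsionForm g J) p W X Y Z - fderiv ℝ (starTorsionForm g J) p X W Y Z +
        fderiv ℝ (starTorsionForm g J) p Y W X Z - fderiv ℝ (starTorsionForm g J) p Z W X Y =
      4 * lam ^ 2 * (kahlerForm g J p W X * kahlerForm g J p Y Z -
        kahlerForm g J p W Y * kahlerForm g J p X Z +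
        kahlerForm g J p W Z * kahlerForm g J p X Y) := by
  obtain ⟨Γ, hsymm, hcompat, hT, hA⟩ := h.exists_connection hp
  simp only [h.fderiv_starTorsionForm hp, kahlerForm_apply]
  refine hA.alternation_star_eq hsymm hT
    (hA.covDeriv_eq (DT := fun W X Y Z => fderiv ℝ (torsionForm g J) p W X Y Z) hE hsymm hT
      ?_ ?_ ?_ ?_ ?_) W X Y Z
  · intro c W X Y Z
    simp
  · exact fun W => ⟨fun X Y => (fderiv ℝ (torsionForm g J) p W X Y).isBoundedLinearMap.toIsLinearMap,
      h.fderiv_torsionForm_swap₁₂ hp W, h.fderiv_torsionForm_swap₂₃ hp W⟩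
  · exact h.fderiv_torsionForm_move_J hp
  · exact h.alternation_fderiv_torsionForm hp
  · exact h.fderiv_torsionForm_cross hp hcompat

end IsLocalNearlyKahler

end StarTorsionForm

/-! ### Pulling back forms along maps of vector spaces -/

section Pullback

variable {E : Type*} [NormedAddCommGroup E] [NormedSpace ℝ E]
  {X : Type*} [NormedAddCommGroup X] [NormedSpace ℝ X]

/-- The value of the pullback `F^* B` of a field of bilinear forms on two constant vectors. -/
noncomputable def pullTwo (B : E → E →L[ℝ] E →L[ℝ] ℝ) (F : X → E) (a b : X) (z : X) : ℝ :=
  B (F z) (fderiv ℝ F z a) (fderiv ℝ F z b)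

/-- The value of the pullback `F^* B` of a field of trilinear forms on three constant vectors. -/
noncomputable def pullThree (B : E → E →L[ℝ] E →L[ℝ] E →L[ℝ] ℝ) (F : X → E) (a b c : X)
    (z : X) : ℝ :=
  B (F z) (fderiv ℝ F z a) (fderiv ℝ F z b) (fderiv ℝ F z c)

variable {U : Set E} {O : Set X} {F : X → E} (hU : IsOpen U) (hO : IsOpen O)
  (hF : ContDiffOn ℝ ∞ F O) (hFU : MapsTo F O U)

section
include hO hF hFU

theorem contDiffOn_pullTwo {B : E → E →L[ℝ] E →L[ℝ] ℝ} (hB : ContDiffOn ℝ ∞ B U) (a b : X) :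
    ContDiffOn ℝ ∞ (pullTwo B F a b) O := by
  have hD : ContDiffOn ℝ ∞ (fderiv ℝ F) O := hF.fderiv_of_isOpen hO (by simp)
  exact ((hB.comp hF hFU).clm_apply (hD.clm_apply contDiffOn_const)).clm_apply
    (hD.clm_apply contDiffOn_const)

theorem contDiffOn_pullThree {B : E → E →L[ℝ] E →L[ℝ] E →L[ℝ] ℝ} (hB : ContDiffOn ℝ ∞ B U)
    (a b c : X) : ContDiffOn ℝ ∞ (pullThree B F a b c) O := by
  have hD : ContDiffOn ℝ ∞ (fderiv ℝ F) O := hF.fderiv_of_isOpen hO (by simp)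
  exact (((hB.comp hF hFU).clm_apply (hD.clm_apply contDiffOn_const)).clm_apply
    (hD.clm_apply contDiffOn_const)).clm_apply (hD.clm_apply contDiffOn_const)

variable {z : X} (hz : z ∈ O)
include hU hz

theorem fderiv_pullTwo {B : E → E →L[ℝ] E →L[ℝ] ℝ} (hB : ContDiffOn ℝ ∞ B U) (a b v : X) :
    fderiv ℝ (pullTwo B F a b) z v =
      fderiv ℝ B (F z) (fderiv ℝ F z v) (fderiv ℝ F z a) (fderiv ℝ F z b) +
      B (F z) (fderiv ℝ (fderiv ℝ F) z v a) (fderiv ℝ F z b) +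
      B (F z) (fderiv ℝ F z a) (fderiv ℝ (fderiv ℝ F) z v b) := by
  have hD : ContDiffOn ℝ ∞ (fderiv ℝ F) O := hF.fderiv_of_isOpen hO (by simp)
  have h1 := ((hF.contDiffAt (hO.mem_nhds hz)).differentiableAt (by simp)).hasFDerivAt
  have h2 := ((hD.contDiffAt (hO.mem_nhds hz)).differentiableAt (by simp)).hasFDerivAt
  have h3 := ((hB.contDiffAt (hU.mem_nhds (hFU hz))).differentiableAt (by simp)).hasFDerivAt
  have h4 : HasFDerivAt (pullTwo B F a b) _ z := ((h3.comp z h1).clm_apply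
    (h2.clm_apply (hasFDerivAt_const a z))).clm_apply (h2.clm_apply (hasFDerivAt_const b z))
  rw [h4.fderiv]
  simp
  ring

theorem fderiv_pullThree {B : E → E →L[ℝ] E →L[ℝ] E →L[ℝ] ℝ} (hB : ContDiffOn ℝ ∞ B U)
    (a b c v : X) : fderiv ℝ (pullThree B F a b c) z v =
      fderiv ℝ B (F z) (fderiv ℝ F z v) (fderiv ℝ F z a) (fderiv ℝ F z b) (fderiv ℝ F z c) +
      B (F z) (fderiv ℝ (fderiv ℝ F) z v a) (fderiv ℝ F z b) (fderiv ℝ F z c) +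
      B (F z) (fderiv ℝ F z a) (fderiv ℝ (fderiv ℝ F) z v b) (fderiv ℝ F z c) +
      B (F z) (fderiv ℝ F z a) (fderiv ℝ F z b) (fderiv ℝ (fderiv ℝ F) z v c) := by
  have hD : ContDiffOn ℝ ∞ (fderiv ℝ F) O := hF.fderiv_of_isOpen hO (by simp)
  have h1 := ((hF.contDiffAt (hO.mem_nhds hz)).differentiableAt (by simp)).hasFDerivAt
  have h2 := ((hD.contDiffAt (hO.mem_nhds hz)).differentiableAt (by simp)).hasFDerivAt
  have h3 := ((hB.contDiffAt (hU.mem_nhds (hFU hz))).differentiableAt (by simp)).hasFDerivAt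
  have h4 : HasFDerivAt (pullThree B F a b c) _ z := (((h3.comp z h1).clm_apply
    (h2.clm_apply (hasFDerivAt_const a z))).clm_apply
    (h2.clm_apply (hasFDerivAt_const b z))).clm_apply (h2.clm_apply (hasFDerivAt_const c z))
  rw [h4.fderiv]
  simp
  ring

end

section NearlyKahlerPullback

variable {g : E → E →L[ℝ] E →L[ℝ] ℝ} {J : E → E →L[ℝ] E} {lam : ℝ}
  (h : IsLocalNearlyKahler U g J lam) {z : X} (hz : z ∈ O)
include h hFU hz

/-- The Gram determinant of `F` in three directions. -/
theorem gram_det_pullback (hE : Module.finrank ℝ E = 6) (e : Fin 3 → X) :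
    lam ^ 2 * (Matrix.of fun i j => pullTwo g F (e i) (e j) z).det =
      pullThree (torsionForm g J) F (e 0) (e 1) (e 2) z ^ 2 +
        pullThree (starTorsionForm g J) F (e 0) (e 1) (e 2) z ^ 2 +
        lam ^ 2 * ∑ i, ∑ j,
          ![pullTwo (kahlerForm g J) F (e 1) (e 2) z, pullTwo (kahlerForm g J) F (e 2) (e 0) z,
            pullTwo (kahlerForm g J) F (e 0) (e 1) z] i *
          ![pullTwo (kahlerForm g J) F (e 1) (e 2) z, pullTwo (kahlerForm g J) F (e 2) (e 0) z,
            pullTwo (kahlerForm g J) F (e 0) (e 1) z] j * pullTwo g F (e i) (e j) z := by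
  have := (h.algebra (hFU hz)).gram_det hE (fun i => fderiv ℝ F z (e i))
  simp only [pullTwo, pullThree, starTorsionForm_apply, kahlerForm_apply]
  linarith

include hO hF

/-- `d (F^* ω) = 3 F^* T`. -/
theorem alternation_fderiv_pullTwo (v a b : X) :
    fderiv ℝ (pullTwo (kahlerForm g J) F a b) z v - fderiv ℝ (pullTwo (kahlerForm g J) F v b) z a +
      fderiv ℝ (pullTwo (kahlerForm g J) F v a) z b =
      3 * pullThree (torsionForm g J) F v a b z := by
  have hs : IsSymmSndFDerivAt ℝ F z := (hF.contDiffAt (hO.mem_nhds hz)).isSymmSndFDerivAt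
    (by simp; exact ENat.LEInfty.out)
  have hA := h.algebra (hFU hz)
  have os : ∀ u v, kahlerForm g J (F z) u v = -kahlerForm g J (F z) v u := hA.omega_swap
  simp only [fderiv_pullTwo h.isOpen hO hF hFU hz h.smooth_kahlerForm, pullThree,
    torsionForm_apply]
  rw [hs a v, hs b v, hs b a, os (fderiv ℝ F z v) (fderiv ℝ (fderiv ℝ F) z a b),
    os (fderiv ℝ F z a) (fderiv ℝ (fderiv ℝ F) z v b)]
  ring

/-- `d (F^* S) = F^* (2 λ² ω ∧ ω)` for `S = T(·, ·, J ·)`. -/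
theorem alternation_fderiv_pullThree (hE : Module.finrank ℝ E = 6) (v a b c : X) :
    fderiv ℝ (pullThree (starTorsionForm g J) F a b c) z v -
        fderiv ℝ (pullThree (starTorsionForm g J) F v b c) z a +
        fderiv ℝ (pullThree (starTorsionForm g J) F v a c) z b -
        fderiv ℝ (pullThree (starTorsionForm g J) F v a b) z c =
      4 * lam ^ 2 * (pullTwo (kahlerForm g J) F v a z * pullTwo (kahlerForm g J) F b c z -
        pullTwo (kahlerForm g J) F v b z * pullTwo (kahlerForm g J) F a c z +
        pullTwo (kahlerForm g J) F v c z * pullTwo (kahlerForm g J) F a b z) := by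
  have hs : IsSymmSndFDerivAt ℝ F z := (hF.contDiffAt (hO.mem_nhds hz)).isSymmSndFDerivAt
    (by simp; exact ENat.LEInfty.out)
  have hA := h.algebra (hFU hz)
  have s12 : ∀ u v w, starTorsionForm g J (F z) u v w = -starTorsionForm g J (F z) v u w :=
    fun u v w => hA.swap₁₂ u v _
  have s23 : ∀ u v w, starTorsionForm g J (F z) u v w = -starTorsionForm g J (F z) u w v :=
    fun u v w => by
      rw [starTorsionForm_apply, starTorsionForm_apply, hA.move_J u v w, hA.swap₂₃ u _ w]
  have key := h.alternation_fderiv_starTorsionForm (hFU hz) hE (fderiv ℝ F z v) (fderiv ℝ F z a)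
    (fderiv ℝ F z b) (fderiv ℝ F z c)
  simp only [fderiv_pullThree h.isOpen hO hF hFU hz h.smooth_starTorsionForm, pullTwo]
  rw [← key]
  rw [hs a v, hs b v, hs b a, hs c a, hs c b, hs c v]
  generalize fderiv ℝ (fderiv ℝ F) z v a = va
  generalize fderiv ℝ (fderiv ℝ F) z v b = vb
  generalize fderiv ℝ (fderiv ℝ F) z v c = vc
  generalize fderiv ℝ (fderiv ℝ F) z a b = ab
  generalize fderiv ℝ (fderiv ℝ F) z a c = ac
  generalize fderiv ℝ (fderiv ℝ F) z b c = bc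
  generalize fderiv ℝ F z v = v'
  generalize fderiv ℝ F z a = a'
  generalize fderiv ℝ F z b = b'
  generalize fderiv ℝ F z c = c'
  rw [s12 a' vb, s23 a' b' vc, s12 a' vc b', s12 v' ab c', s23 v' b' ac, s12 v' ac b', s23 v' a' bc,
    s12 v' bc a']
  ring

end NearlyKahlerPullback

end Pullback

/-! ### Second order jets of functions of time -/

section SecondOrderJet

/-- `f` is twice differentiable at `0`, with value `a`, first derivative `b` and second
derivative `c` there. -/
def HasJetTwo (f : ℝ → ℝ) (a b c : ℝ) : Prop :=
  f 0 = a ∧ ∃ f' : ℝ → ℝ, (∀ᶠ t in 𝓝 0, HasDerivAt f (f' t) t) ∧ f' 0 = b ∧ HasDerivAt f' c 0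

namespace HasJetTwo

variable {f h : ℝ → ℝ} {a b c a' b' c' : ℝ}

theorem mul (hf : HasJetTwo f a b c) (hh : HasJetTwo h a' b' c') :
    HasJetTwo (fun t => f t * h t) (a * a') (b * a' + a * b') (c * a' + 2 * (b * b') + a * c') := by
  obtain ⟨rfl, f', hf1, rfl, hf2⟩ := hf
  obtain ⟨rfl, h', hh1, rfl, hh2⟩ := hh
  refine ⟨rfl, fun t => f' t * h t + f t * h' t, ?_, rfl, ?_⟩
  · filter_upwards [hf1, hh1] with t h1 h2 using h1.mul h2
  · have := (hf2.mul hh1.self_of_nhds).add (hf1.self_of_nhds.mul hh2)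
    exact this.congr_deriv (by ring)

theorem add (hf : HasJetTwo f a b c) (hh : HasJetTwo h a' b' c') :
    HasJetTwo (fun t => f t + h t) (a + a') (b + b') (c + c') := by
  obtain ⟨rfl, f', hf1, rfl, hf2⟩ := hf
  obtain ⟨rfl, h', hh1, rfl, hh2⟩ := hh
  refine ⟨rfl, fun t => f' t + h' t, ?_, rfl, hf2.add hh2⟩
  filter_upwards [hf1, hh1] with t h1 h2 using h1.add h2

theorem const_mul (r : ℝ) (hf : HasJetTwo f a b c) :
    HasJetTwo (fun t => r * f t) (r * a) (r * b) (r * c) := by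
  obtain ⟨rfl, f', hf1, rfl, hf2⟩ := hf
  refine ⟨rfl, fun t => r * f' t, ?_, rfl, hf2.const_mul r⟩
  filter_upwards [hf1] with t h1 using h1.const_mul r

theorem sum {ι : Type*} {s : Finset ι} {f : ι → ℝ → ℝ} {a b c : ι → ℝ}
    (hf : ∀ i ∈ s, HasJetTwo (f i) (a i) (b i) (c i)) :
    HasJetTwo (fun t => ∑ i ∈ s, f i t) (∑ i ∈ s, a i) (∑ i ∈ s, b i) (∑ i ∈ s, c i) := by
  classical
  induction s using Finset.induction_on with
  | empty => exact ⟨by simp, 0, by simp [hasDerivAt_const], by simp, by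
      simp [hasDerivAt_const]⟩
  | insert i s his ih =>
    simp only [Finset.sum_insert his]
    exact (hf i (by simp)).add (ih fun j hj => hf j (by simp [hj]))

theorem unique (hf : HasJetTwo f a b c) (hh : HasJetTwo h a' b' c') (hfh : f =ᶠ[𝓝 0] h) :
    a = a' ∧ b = b' ∧ c = c' := by
  obtain ⟨rfl, f', hf1, rfl, hf2⟩ := hf
  obtain ⟨rfl, h', hh1, rfl, hh2⟩ := hh
  have h' : f' =ᶠ[𝓝 0] h' := by
    filter_upwards [hf1, hh1, hfh.eventuallyEq_nhds] with t h1 h2 h3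
    exact h1.unique (h2.congr_of_eventuallyEq h3)
  exact ⟨hfh.self_of_nhds, h'.self_of_nhds, hf2.unique (hh2.congr_of_eventuallyEq h')⟩

/-- The second derivative of the square root of a sum of squares, at a point where all the
terms but one vanish. -/
theorem second_deriv_of_sq_eq {lam : ℝ} (hl : lam ≠ 0) {R T S : ℝ → ℝ} {w : Fin 3 → ℝ → ℝ}
    {G : Fin 3 → Fin 3 → ℝ → ℝ} {r r' r'' t' t'' s s' s'' : ℝ} {w' w'' : Fin 3 → ℝ}
    {γ γ' γ'' : Fin 3 → Fin 3 → ℝ} (hR : HasJetTwo R r r' r'') (hr : r ≠ 0)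
    (hT : HasJetTwo T 0 t' t'') (hS : HasJetTwo S s s' s'')
    (hw : ∀ i, HasJetTwo (w i) 0 (w' i) (w'' i))
    (hG : ∀ i j, HasJetTwo (G i j) (γ i j) (γ' i j) (γ'' i j))
    (hE : ∀ᶠ t in 𝓝 0, lam ^ 2 * (R t * R t) = T t * T t + S t * S t +
      lam ^ 2 * ∑ i, ∑ j, w i t * w j t * G i j t) :
    s ^ 2 = lam ^ 2 * r ^ 2 ∧
      lam ^ 2 * (r * r'') = t' ^ 2 + s * s'' + lam ^ 2 * ∑ i, ∑ j, w' i * w' j * γ i j := by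
  have h1 := (hR.mul hR).const_mul (lam ^ 2)
  have h2 := ((hT.mul hT).add (hS.mul hS)).add ((HasJetTwo.sum (s := Finset.univ) fun i _ =>
    HasJetTwo.sum (s := Finset.univ) fun j _ => ((hw i).mul (hw j)).mul (hG i j)).const_mul
      (lam ^ 2))
  obtain ⟨e0, e1, e2⟩ := h1.unique h2 hE
  simp only [mul_zero, zero_mul, Finset.sum_const_zero, add_zero, zero_add] at e0 e1 e2
  have hsum : ∑ i, ∑ j, 2 * (w' i * w' j) * γ i j = 2 * ∑ i, ∑ j, w' i * w' j * γ i j := by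
    simp only [Finset.mul_sum, mul_assoc]
  rw [hsum] at e2
  have e1' : lam ^ 2 * (r * r') = s * s' := by linarith
  -- As `s² = λ² r²` and `λ² r r' = s s'`, the first order terms `λ² r'²` and `s'²` of the second
  -- derivatives cancel.
  have e3 : lam ^ 2 * r' ^ 2 = s' ^ 2 := by
    have : r ^ 2 * lam ^ 2 * (lam ^ 2 * r' ^ 2 - s' ^ 2) = 0 := by
      have h3 : (lam ^ 2 * (r * r')) ^ 2 = (s * s') ^ 2 := by rw [e1']
      have h4 : s ^ 2 = lam ^ 2 * r ^ 2 := by linarith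
      have h5 : (s * s') ^ 2 = lam ^ 2 * r ^ 2 * s' ^ 2 := by rw [mul_pow, h4]
      rw [h5] at h3
      linarith
    have := (mul_eq_zero.1 this).resolve_left (by positivity)
    linarith
  constructor
  · linarith
  · linarith

end HasJetTwo

variable {Y : Type*} [NormedAddCommGroup Y] [NormedSpace ℝ Y]

/-- The second order jet of a smooth function of space-time along a line of constant position. -/
theorem hasJetTwo_of_contDiffAt {h : ℝ × Y → ℝ} {u : Y} (hh : ContDiffAt ℝ ∞ h (0, u)) :
    HasJetTwo (fun t => h (t, u)) (h (0, u)) (fderiv ℝ h (0, u) (1, 0))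
      (fderiv ℝ (fun z => fderiv ℝ h z (1, 0)) (0, u) (1, 0)) := by
  have hline : ∀ t : ℝ, HasDerivAt (fun t : ℝ => ((t, u) : ℝ × Y)) (1, 0) t := fun t =>
    (hasDerivAt_id t).prodMk (hasDerivAt_const t u)
  have hc : Tendsto (fun t : ℝ => ((t, u) : ℝ × Y)) (𝓝 0) (𝓝 (0, u)) :=
    (hline 0).continuousAt
  refine ⟨rfl, fun t => fderiv ℝ h (t, u) (1, 0), ?_, rfl, ?_⟩
  · have h1 : ∀ᶠ z in 𝓝 ((0, u) : ℝ × Y), ContDiffAt ℝ 1 h z :=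
      (hh.of_le (by exact ENat.LEInfty.out)).eventually (by simp)
    filter_upwards [hc.eventually h1] with t ht
    exact (ht.differentiableAt (by simp)).hasFDerivAt.comp_hasDerivAt t (hline t)
  · have h2 : ContDiffAt ℝ 1 (fun z => fderiv ℝ h z (1, 0)) (0, u) :=
      (hh.fderiv_right (m := 1) (by norm_num; exact ENat.LEInfty.out)).clm_apply contDiffAt_const
    exact (h2.differentiableAt (by simp)).hasFDerivAt.comp_hasDerivAt (0 : ℝ) (hline 0)

end SecondOrderJet

/-! ### Evolution of forms on the slices of a variation -/

section SliceCalculus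

variable {E : Type*} [NormedAddCommGroup E] [NormedSpace ℝ E]
  {Y : Type*} [NormedAddCommGroup Y] [NormedSpace ℝ Y]

/-- The time direction in space-time `ℝ × Y`. -/
def timeDir : ℝ × Y := (1, 0)

/-- The space direction `b` in space-time `ℝ × Y`. -/
def spaceDir (b : Y) : ℝ × Y := (0, b)

/-- The Gram determinant of the spatial derivatives of `F` along a frame `b`. -/
noncomputable def gramDet (g : E → E →L[ℝ] E →L[ℝ] ℝ) (F : ℝ × Y → E) (b : Fin 3 → Y)
    (z : ℝ × Y) : ℝ :=
  (Matrix.of fun i j => pullTwo g F (spaceDir (b i)) (spaceDir (b j)) z).det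

/-- The restriction of `F^* ω` to the slices of constant time, as the vector of its components
`ω₂₃, ω₃₁, ω₁₂` in a frame `b`. -/
noncomputable def sliceForm (B : E → E →L[ℝ] E →L[ℝ] ℝ) (F : ℝ × Y → E) (b : Fin 3 → Y)
    (i : Fin 3) : ℝ × Y → ℝ :=
  pullTwo B F (spaceDir (b (i + 1))) (spaceDir (b (i + 2)))

/-- The components of the contraction of `F^* ω` with the time direction. -/
noncomputable def sliceContraction (B : E → E →L[ℝ] E →L[ℝ] ℝ) (F : ℝ × Y → E) (b : Fin 3 → Y)
    (i : Fin 3) : ℝ × Y → ℝ :=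
  pullTwo B F timeDir (spaceDir (b i))

/-- The components of the contraction of a pulled back `3`-form with the time direction, as the
vector of the components `23, 31, 12` of a `2`-form. -/
noncomputable def sliceContractionThree (B : E → E →L[ℝ] E →L[ℝ] E →L[ℝ] ℝ) (F : ℝ × Y → E)
    (b : Fin 3 → Y) (i : Fin 3) : ℝ × Y → ℝ :=
  pullThree B F timeDir (spaceDir (b (i + 1))) (spaceDir (b (i + 2)))

/-- The top component of a pulled back `3`-form on the slices of constant time. -/
noncomputable def sliceTop (B : E → E →L[ℝ] E →L[ℝ] E →L[ℝ] ℝ) (F : ℝ × Y → E)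
    (b : Fin 3 → Y) : ℝ × Y → ℝ :=
  pullThree B F (spaceDir (b 0)) (spaceDir (b 1)) (spaceDir (b 2))

/-- Derivatives of a smooth function of space-time in two directions commute. -/
theorem fderiv_fderiv_comm {X : Type*} [NormedAddCommGroup X] [NormedSpace ℝ X] {f : X → ℝ}
    {z : X} (hf : ContDiffAt ℝ ∞ f z) (a b : X) :
    fderiv ℝ (fun y => fderiv ℝ f y a) z b = fderiv ℝ (fun y => fderiv ℝ f y b) z a := by
  have h1 : ContDiffAt ℝ 1 (fderiv ℝ f) z :=
    hf.fderiv_right (m := 1) (by norm_num; exact ENat.LEInfty.out)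
  have h2 := (h1.differentiableAt (by simp)).hasFDerivAt
  have hs : IsSymmSndFDerivAt ℝ f z := hf.isSymmSndFDerivAt (by simp; exact ENat.LEInfty.out)
  have key : ∀ a b, fderiv ℝ (fun y => fderiv ℝ f y a) z b = fderiv ℝ (fderiv ℝ f) z b a := by
    intro a b
    rw [(h2.clm_apply (hasFDerivAt_const a z)).fderiv]
    simp
  rw [key, key, hs]

theorem contDiffAt_fderiv_apply {X : Type*} [NormedAddCommGroup X] [NormedSpace ℝ X] {f : X → ℝ}
    {z : X} (hf : ContDiffAt ℝ ∞ f z) (a : X) : ContDiffAt ℝ ∞ (fun y => fderiv ℝ f y a) z :=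
  (hf.fderiv_right (m := ∞) (by simp)).clm_apply contDiffAt_const

/-- The derivative of a function of space-time in a space direction is computed in the slice. -/
theorem fderiv_spaceDir {f : ℝ × Y → ℝ} {t : ℝ} {u : Y} (hf : DifferentiableAt ℝ f (t, u))
    (b : Y) : fderiv ℝ f (t, u) (spaceDir b) = fderiv ℝ (fun y => f (t, y)) u b := by
  have h1 : HasFDerivAt (fun y : Y => ((t, y) : ℝ × Y)) (ContinuousLinearMap.inr ℝ ℝ Y) u := by
    have := (hasFDerivAt_const t u).prodMk (hasFDerivAt_id (𝕜 := ℝ) u)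
    exact this
  have h2 := hf.hasFDerivAt.comp u h1
  rw [HasFDerivAt.fderiv (f := fun y => f (t, y)) h2]
  rfl

variable {U : Set E} {O : Set (ℝ × Y)} {F : ℝ × Y → E} (hO : IsOpen O)
  (hF : ContDiffOn ℝ ∞ F O) (hFU : MapsTo F O U)
  {g : E → E →L[ℝ] E →L[ℝ] ℝ} {J : E → E →L[ℝ] E} {lam : ℝ}
  (h : IsLocalNearlyKahler U g J lam) (b : Fin 3 → Y)
include h hO hF hFU

theorem contDiffOn_gramDet : ContDiffOn ℝ ∞ (gramDet g F b) O := by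
  have : gramDet g F b = fun z => (Matrix.of fun i j =>
    pullTwo g F (spaceDir (b i)) (spaceDir (b j)) z).det := rfl
  have hp := fun i j => contDiffOn_pullTwo hO hF hFU h.smooth_g (spaceDir (b i)) (spaceDir (b j))
  simp only [this, Matrix.det_fin_three, Matrix.of_apply]
  have h3 : ∀ i j k l m n, ContDiffOn ℝ ∞ (fun z => pullTwo g F (spaceDir (b i)) (spaceDir (b j)) z *
      pullTwo g F (spaceDir (b k)) (spaceDir (b l)) z *
      pullTwo g F (spaceDir (b m)) (spaceDir (b n)) z) O :=
    fun i j k l m n => ((hp i j).mul (hp k l)).mul (hp m n)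
  exact (((((h3 _ _ _ _ _ _).sub (h3 _ _ _ _ _ _)).sub (h3 _ _ _ _ _ _)).add
    (h3 _ _ _ _ _ _)).add (h3 _ _ _ _ _ _)).sub (h3 _ _ _ _ _ _)

variable {z : ℝ × Y} (hz : z ∈ O)

include hz in
/-- The evolution of the restriction of `ω` to the slices. -/
theorem fderiv_sliceForm_timeDir (i : Fin 3) :
    fderiv ℝ (sliceForm (kahlerForm g J) F b i) z timeDir =
      3 * sliceContractionThree (torsionForm g J) F b i z +
        fderiv ℝ (sliceContraction (kahlerForm g J) F b (i + 2)) z (spaceDir (b (i + 1))) -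
        fderiv ℝ (sliceContraction (kahlerForm g J) F b (i + 1)) z (spaceDir (b (i + 2))) := by
  have := alternation_fderiv_pullTwo hO hF hFU h hz timeDir (spaceDir (b (i + 1)))
    (spaceDir (b (i + 2)))
  simp only [sliceForm, sliceContraction, sliceContractionThree]
  linarith

include hz in
/-- The divergence of the restriction of `ω` to the slices. -/
theorem sum_fderiv_sliceForm :
    ∑ i, fderiv ℝ (sliceForm (kahlerForm g J) F b i) z (spaceDir (b i)) =
      3 * sliceTop (torsionForm g J) F b z := by
  have := alternation_fderiv_pullTwo hO hF hFU h hz (spaceDir (b 0)) (spaceDir (b 1))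
    (spaceDir (b 2))
  have hsk : fderiv ℝ (pullTwo (kahlerForm g J) F (spaceDir (b 2)) (spaceDir (b 0))) z =
      -fderiv ℝ (pullTwo (kahlerForm g J) F (spaceDir (b 0)) (spaceDir (b 2))) z := by
    rw [← fderiv_fun_neg]
    apply Filter.EventuallyEq.fderiv_eq
    filter_upwards [hO.mem_nhds hz] with y hy
    exact (h.algebra (hFU hy)).omega_swap _ _
  simp only [sliceForm, sliceTop, Fin.sum_univ_three, Fin.isValue, zero_add, Fin.reduceAdd] at *
  rw [hsk, neg_apply]
  linarith

include hz in
/-- The evolution of `T` on the slices: a third of the divergence of the evolution of `ω`. -/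
theorem fderiv_sliceTop_torsionForm :
    fderiv ℝ (sliceTop (torsionForm g J) F b) z timeDir =
      (1 / 3) * ∑ i, fderiv ℝ (fun y => fderiv ℝ (sliceForm (kahlerForm g J) F b i) y timeDir) z
        (spaceDir (b i)) := by
  have hw : ∀ i, ContDiffAt ℝ ∞ (sliceForm (kahlerForm g J) F b i) z := fun i =>
    (contDiffOn_pullTwo hO hF hFU h.smooth_kahlerForm _ _).contDiffAt (hO.mem_nhds hz)
  have hev : sliceTop (torsionForm g J) F b =ᶠ[𝓝 z] fun y =>
      (1 / 3) * ∑ i, fderiv ℝ (sliceForm (kahlerForm g J) F b i) y (spaceDir (b i)) := by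
    filter_upwards [hO.mem_nhds hz] with y hy
    rw [sum_fderiv_sliceForm hO hF hFU h b hy]
    ring
  have hd : ∀ i, DifferentiableAt ℝ
      (fun y => fderiv ℝ (sliceForm (kahlerForm g J) F b i) y (spaceDir (b i))) z := fun i =>
    (contDiffAt_fderiv_apply (hw i) _).differentiableAt (by simp)
  rw [hev.fderiv_eq, fderiv_const_mul (DifferentiableAt.fun_sum fun i _ => hd i),
    fderiv_fun_sum fun i _ => hd i]
  simp only [smul_apply, sum_apply, smul_eq_mul]
  congr 1
  exact Finset.sum_congr rfl fun i _ => fderiv_fderiv_comm (hw i) _ _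

/-- The second time derivative of the top component of `S = T(·, ·, J ·)` on a slice that is
Lagrangian: a divergence, and the term that comes from `dS = 2 λ² ω ∧ ω`. -/
theorem fderiv_fderiv_sliceTop_star (hE : Module.finrank ℝ E = 6) (hz : z ∈ O)
    (hL : ∀ i, sliceForm (kahlerForm g J) F b i z = 0) :
    fderiv ℝ (fun y => fderiv ℝ (sliceTop (starTorsionForm g J) F b) y timeDir) z timeDir =
      4 * lam ^ 2 * ∑ i, sliceContraction (kahlerForm g J) F b i z *
        fderiv ℝ (sliceForm (kahlerForm g J) F b i) z timeDir +
      ∑ i, fderiv ℝ (fun y => fderiv ℝ (sliceContractionThree (starTorsionForm g J) F b i) y timeDir) z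
        (spaceDir (b i)) := by
  have hw : ∀ i, ContDiffAt ℝ ∞ (sliceForm (kahlerForm g J) F b i) z := fun i =>
    (contDiffOn_pullTwo hO hF hFU h.smooth_kahlerForm _ _).contDiffAt (hO.mem_nhds hz)
  have hθ : ∀ i, ContDiffAt ℝ ∞ (sliceContraction (kahlerForm g J) F b i) z := fun i =>
    (contDiffOn_pullTwo hO hF hFU h.smooth_kahlerForm _ _).contDiffAt (hO.mem_nhds hz)
  have hY : ∀ i, ContDiffAt ℝ ∞ (sliceContractionThree (starTorsionForm g J) F b i) z := fun i =>
    (contDiffOn_pullThree hO hF hFU h.smooth_starTorsionForm _ _ _).contDiffAt (hO.mem_nhds hz)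
  have hev : (fun y => fderiv ℝ (sliceTop (starTorsionForm g J) F b) y timeDir) =ᶠ[𝓝 z] fun y =>
      4 * lam ^ 2 * (∑ i, sliceContraction (kahlerForm g J) F b i y *
        sliceForm (kahlerForm g J) F b i y) +
      ∑ i, fderiv ℝ (sliceContractionThree (starTorsionForm g J) F b i) y (spaceDir (b i)) := by
    filter_upwards [hO.mem_nhds hz] with y hy
    have key := alternation_fderiv_pullThree hO hF hFU h hy hE timeDir (spaceDir (b 0))
      (spaceDir (b 1)) (spaceDir (b 2))
    have hsk : fderiv ℝ (pullThree (starTorsionForm g J) F timeDir (spaceDir (b 2))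
        (spaceDir (b 0))) y = -fderiv ℝ (pullThree (starTorsionForm g J) F timeDir (spaceDir (b 0))
        (spaceDir (b 2))) y := by
      rw [← fderiv_fun_neg]
      apply Filter.EventuallyEq.fderiv_eq
      filter_upwards [hO.mem_nhds hy] with x hx
      simp only [pullThree, starTorsionForm_apply]
      rw [(h.algebra (hFU hx)).move_J, (h.algebra (hFU hx)).swap₂₃]
    have hsk' : pullTwo (kahlerForm g J) F (spaceDir (b 2)) (spaceDir (b 0)) y =
        -pullTwo (kahlerForm g J) F (spaceDir (b 0)) (spaceDir (b 2)) y :=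
      (h.algebra (hFU hy)).omega_swap _ _
    simp only [sliceForm, sliceTop, sliceContraction, sliceContractionThree, Fin.sum_univ_three,
      Fin.isValue, zero_add, Fin.reduceAdd] at *
    rw [hsk, hsk', neg_apply]
    linarith
  have hd : ∀ i, DifferentiableAt ℝ
      (fun y => fderiv ℝ (sliceContractionThree (starTorsionForm g J) F b i) y (spaceDir (b i))) z :=
    fun i => (contDiffAt_fderiv_apply (hY i) _).differentiableAt (by simp)
  have hp : ∀ i, HasFDerivAt (fun y => sliceContraction (kahlerForm g J) F b i y *
        sliceForm (kahlerForm g J) F b i y) _ z := fun i =>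
    ((hθ i).differentiableAt (by simp)).hasFDerivAt.mul
      ((hw i).differentiableAt (by simp)).hasFDerivAt
  have hfd := ((HasFDerivAt.fun_sum (u := Finset.univ) fun i _ => hp i).const_mul
    (4 * lam ^ 2)).add (HasFDerivAt.fun_sum (u := Finset.univ) fun i _ => (hd i).hasFDerivAt)
  rw [hev.fderiv_eq]
  erw [hfd.fderiv]
  simp only [add_apply, smul_apply, sum_apply, smul_eq_mul, hL, zero_mul, add_zero]
  congr 1
  exact Finset.sum_congr rfl fun i _ => fderiv_fderiv_comm (hY i) _ _

/-- `T` vanishes on Lagrangian slices. -/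
theorem sliceTop_torsionForm_eq_zero {u : Y} (hz : (0, u) ∈ O)
    (hL : ∀ y, (0, y) ∈ O → ∀ i, sliceForm (kahlerForm g J) F b i (0, y) = 0) :
    sliceTop (torsionForm g J) F b (0, u) = 0 := by
  have hw : ∀ i, ContDiffAt ℝ ∞ (sliceForm (kahlerForm g J) F b i) (0, u) := fun i =>
    (contDiffOn_pullTwo hO hF hFU h.smooth_kahlerForm _ _).contDiffAt (hO.mem_nhds hz)
  have hzero : ∀ i, fderiv ℝ (sliceForm (kahlerForm g J) F b i) (0, u) (spaceDir (b i)) = 0 := by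
    intro i
    rw [fderiv_spaceDir ((hw i).differentiableAt (by simp))]
    have hev : (fun y => sliceForm (kahlerForm g J) F b i (0, y)) =ᶠ[𝓝 u] fun _ => 0 := by
      have hc : Tendsto (fun y : Y => ((0, y) : ℝ × Y)) (𝓝 u) (𝓝 (0, u)) := by
        have : Continuous (fun y : Y => ((0, y) : ℝ × Y)) := by fun_prop
        exact this.tendsto u
      filter_upwards [hc.eventually (hO.mem_nhds hz)] with y hy using hL y hy i
    rw [hev.fderiv_eq]
    simp
  have := sum_fderiv_sliceForm hO hF hFU h b hz
  simp only [hzero, Finset.sum_const_zero] at this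
  linarith

/-- The second time derivative of the volume density of a variation of a Lagrangian slice. -/
theorem second_variation_density (hE : Module.finrank ℝ E = 6) {u : Y} (hz : (0, u) ∈ O)
    (hL : ∀ y, (0, y) ∈ O → ∀ i, sliceForm (kahlerForm g J) F b i (0, y) = 0)
    (hD : 0 < gramDet g F b (0, u)) :
    sliceTop (starTorsionForm g J) F b (0, u) ^ 2 = lam ^ 2 * gramDet g F b (0, u) ∧
    lam ^ 2 * (Real.sqrt (gramDet g F b (0, u)) *
      fderiv ℝ (fun y => fderiv ℝ (fun x => Real.sqrt (gramDet g F b x)) y timeDir) (0, u)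
        timeDir) =
      ((1 / 3) * ∑ i, fderiv ℝ (fun y => fderiv ℝ (sliceForm (kahlerForm g J) F b i) y timeDir)
        (0, u) (spaceDir (b i))) ^ 2 +
      sliceTop (starTorsionForm g J) F b (0, u) *
        (4 * lam ^ 2 * ∑ i, sliceContraction (kahlerForm g J) F b i (0, u) *
          fderiv ℝ (sliceForm (kahlerForm g J) F b i) (0, u) timeDir +
        ∑ i, fderiv ℝ (fun y =>
          fderiv ℝ (sliceContractionThree (starTorsionForm g J) F b i) y timeDir) (0, u)
            (spaceDir (b i))) +
      lam ^ 2 * ∑ i, ∑ j, fderiv ℝ (sliceForm (kahlerForm g J) F b i) (0, u) timeDir *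
        fderiv ℝ (sliceForm (kahlerForm g J) F b j) (0, u) timeDir *
          pullTwo g F (spaceDir (b i)) (spaceDir (b j)) (0, u) := by
  have hOz := hO.mem_nhds hz
  have hw : ∀ i, ContDiffAt ℝ ∞ (sliceForm (kahlerForm g J) F b i) (0, u) := fun i =>
    (contDiffOn_pullTwo hO hF hFU h.smooth_kahlerForm _ _).contDiffAt hOz
  have hG : ∀ i j, ContDiffAt ℝ ∞ (pullTwo g F (spaceDir (b i)) (spaceDir (b j))) (0, u) :=
    fun i j => (contDiffOn_pullTwo hO hF hFU h.smooth_g _ _).contDiffAt hOz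
  have hT : ContDiffAt ℝ ∞ (sliceTop (torsionForm g J) F b) (0, u) :=
    (contDiffOn_pullThree hO hF hFU h.smooth_torsionForm _ _ _).contDiffAt hOz
  have hS : ContDiffAt ℝ ∞ (sliceTop (starTorsionForm g J) F b) (0, u) :=
    (contDiffOn_pullThree hO hF hFU h.smooth_starTorsionForm _ _ _).contDiffAt hOz
  have hDs := (contDiffOn_gramDet hO hF hFU h b).contDiffAt hOz
  have hR : ContDiffAt ℝ ∞ (fun x => Real.sqrt (gramDet g F b x)) (0, u) := hDs.sqrt hD.ne'
  have hline : Tendsto (fun t : ℝ => ((t, u) : ℝ × Y)) (𝓝 0) (𝓝 (0, u)) := by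
    have : Continuous (fun t : ℝ => ((t, u) : ℝ × Y)) := by fun_prop
    exact this.tendsto 0
  have hT0 := sliceTop_torsionForm_eq_zero hO hF hFU h b hz hL
  have jT := hasJetTwo_of_contDiffAt hT
  rw [hT0] at jT
  have jw := fun i => hasJetTwo_of_contDiffAt (hw i)
  simp only [hL u hz] at jw
  have hr : Real.sqrt (gramDet g F b (0, u)) ≠ 0 := (Real.sqrt_pos.2 hD).ne'
  have key := HasJetTwo.second_deriv_of_sq_eq h.lam_pos.ne' (hasJetTwo_of_contDiffAt hR) hr jT
    (hasJetTwo_of_contDiffAt hS) jw (fun i j => hasJetTwo_of_contDiffAt (hG i j)) (by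
      filter_upwards [hline.eventually hOz,
        hline.eventually (hDs.continuousAt.eventually_const_lt hD)] with t ht hpos
      have e := gram_det_pullback hFU h ht hE (fun i => spaceDir (b i))
      rw [Real.mul_self_sqrt hpos.le]
      simp only [Fin.sum_univ_three, Matrix.cons_val, sliceForm, Fin.isValue, zero_add,
        Fin.reduceAdd] at e ⊢
      rw [gramDet, e, sliceTop, sliceTop]
      ring)
  rw [Real.sq_sqrt hD.le] at key
  refine ⟨key.1, ?_⟩
  have e2 := key.2
  have e3 := fderiv_fderiv_sliceTop_star hO hF hFU h b hE hz (hL u hz)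
  have e4 := fderiv_sliceTop_torsionForm hO hF hFU h b hz
  rw [← e3, ← e4]
  exact e2

end SliceCalculus

/-! ### Coordinate vector fields on manifolds -/

section Coordinates

variable {n : ℕ} {M : Type*} [TopologicalSpace M] [ChartedSpace (EuclideanSpace ℝ (Fin n)) M]

/-- The derivative of the inverse of the chart around `y₀`, identifying the model space with the
tangent space. -/
noncomputable def chartFrame (y₀ : M) (p : EuclideanSpace ℝ (Fin n)) :
    EuclideanSpace ℝ (Fin n) →L[ℝ] TangentSpace (𝓡 n) ((extChartAt (𝓡 n) y₀).symm p) :=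
  mfderiv 𝓘(ℝ, EuclideanSpace ℝ (Fin n)) (𝓡 n) (extChartAt (𝓡 n) y₀).symm p

/-- The derivative of the chart around `y₀` at the point with coordinates `p`. -/
noncomputable def chartCoframe (y₀ : M) (p : EuclideanSpace ℝ (Fin n)) :
    TangentSpace (𝓡 n) ((extChartAt (𝓡 n) y₀).symm p) →L[ℝ] EuclideanSpace ℝ (Fin n) :=
  mfderiv (𝓡 n) 𝓘(ℝ, EuclideanSpace ℝ (Fin n)) (extChartAt (𝓡 n) y₀)
    ((extChartAt (𝓡 n) y₀).symm p)

/-- The coordinate vector field of the chart around `y₀` in the direction `X`. -/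
noncomputable def coordField (y₀ : M) (X : EuclideanSpace ℝ (Fin n)) (y : M) :
    TangentSpace (𝓡 n) y :=
  VectorField.mpullback (𝓡 n) 𝓘(ℝ, EuclideanSpace ℝ (Fin n)) (extChartAt (𝓡 n) y₀) (fun _ => X) y

variable [IsManifold (𝓡 n) ∞ M]

theorem chartCoframe_chartFrame (y₀ : M) {p : EuclideanSpace ℝ (Fin n)}
    (hp : p ∈ (extChartAt (𝓡 n) y₀).target) (X : EuclideanSpace ℝ (Fin n)) :
    chartCoframe y₀ p (chartFrame y₀ p X) = X := by
  have : IsManifold (𝓡 n) 1 M := IsManifold.of_le (n := ∞) (by simp)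
  have h := mfderiv_extChartAt_comp_mfderivWithin_extChartAt_symm (I := 𝓡 n) hp
  rw [ModelWithCorners.range_eq_univ, mfderivWithin_univ] at h
  exact congrArg (fun A => A X) h

theorem chartFrame_chartCoframe (y₀ : M) {p : EuclideanSpace ℝ (Fin n)}
    (hp : p ∈ (extChartAt (𝓡 n) y₀).target)
    (v : TangentSpace (𝓡 n) ((extChartAt (𝓡 n) y₀).symm p)) :
    chartFrame y₀ p (chartCoframe y₀ p v) = v := by
  have : IsManifold (𝓡 n) 1 M := IsManifold.of_le (n := ∞) (by simp)
  have h := mfderivWithin_extChartAt_symm_comp_mfderiv_extChartAt (I := 𝓡 n) hp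
  rw [ModelWithCorners.range_eq_univ, mfderivWithin_univ] at h
  exact congrArg (fun A => A v) h

/-- The coordinate vector fields at a point of the chart form the coordinate frame. -/
theorem coordField_chart (y₀ : M) {p : EuclideanSpace ℝ (Fin n)}
    (hp : p ∈ (extChartAt (𝓡 n) y₀).target) (X : EuclideanSpace ℝ (Fin n)) :
    coordField y₀ X ((extChartAt (𝓡 n) y₀).symm p) = chartFrame y₀ p X := by
  have h1 : (chartCoframe y₀ p).inverse = chartFrame y₀ p := by
    apply ContinuousLinearMap.inverse_eq
    · ext1 v; exact chartCoframe_chartFrame y₀ hp v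
    · ext1 v; exact chartFrame_chartCoframe y₀ hp v
  rw [← h1]
  rfl

/-- The derivatives of a smooth map on an open subset of a vector space, applied to a constant
vector, form a smooth field along the map. -/
theorem contMDiffOn_mfderiv_apply {G : Type*} [NormedAddCommGroup G] [NormedSpace ℝ G]
    {O : Set G} (hO : IsOpen O) {φ : G → M} (hφ : ContMDiffOn 𝓘(ℝ, G) (𝓡 n) ∞ φ O) (X : G) :
    ContMDiffOn 𝓘(ℝ, G) (𝓡 n).tangent ∞
      (fun p => (⟨φ p, mfderiv 𝓘(ℝ, G) (𝓡 n) φ p X⟩ : TangentBundle (𝓡 n) M)) O := by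
  have h := hφ.contMDiffOn_tangentMapWithin (m := ∞) (by simp) hO.uniqueMDiffOn
  have hc : ContMDiffOn 𝓘(ℝ, G) 𝓘(ℝ, G).tangent ∞
      (fun p => (⟨p, X⟩ : TangentBundle 𝓘(ℝ, G) G)) O := by
    exact fun p _ => contMDiffWithinAt_vectorSpace_iff_contDiffWithinAt.2 contDiffWithinAt_const
  refine (h.comp hc (fun p hp => hp)).congr fun p hp => ?_
  simp only [Function.comp, tangentMapWithin]
  rw [mfderivWithin_of_isOpen hO hp]

theorem contMDiffOn_chartFrame (y₀ : M) (X : EuclideanSpace ℝ (Fin n)) :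
    ContMDiffOn 𝓘(ℝ, EuclideanSpace ℝ (Fin n)) (𝓡 n).tangent ∞
      (fun p => (⟨(extChartAt (𝓡 n) y₀).symm p, chartFrame y₀ p X⟩ : TangentBundle (𝓡 n) M))
      (extChartAt (𝓡 n) y₀).target :=
  contMDiffOn_mfderiv_apply (isOpen_extChartAt_target y₀) (contMDiffOn_extChartAt_symm y₀) X

theorem contMDiffOn_coordField (y₀ : M) (X : EuclideanSpace ℝ (Fin n)) :
    ContMDiffOn (𝓡 n) (𝓡 n).tangent ∞
      (fun y => (⟨y, coordField y₀ X y⟩ : TangentBundle (𝓡 n) M))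
      (extChartAt (𝓡 n) y₀).source := by
  have h := (contMDiffOn_chartFrame y₀ X).comp
    (contMDiffOn_extChartAt (I := 𝓡 n) (x := y₀) (n := ∞)) (fun y hy => by
      exact (extChartAt (𝓡 n) y₀).map_source (by simpa using hy))
  rw [← extChartAt_source (𝓡 n)] at h
  refine h.congr fun y hy => ?_
  have h2 := coordField_chart y₀ ((extChartAt (𝓡 n) y₀).map_source hy) X
  simp only [Function.comp]
  rw [← h2, (extChartAt (𝓡 n) y₀).left_inv hy]

theorem mdifferentiableAt_coordField (y₀ : M) (X : EuclideanSpace ℝ (Fin n)) {y : M}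
    (hy : y ∈ (extChartAt (𝓡 n) y₀).source) :
    MDifferentiableAt (𝓡 n) (𝓡 n).tangent
      (fun y => (⟨y, coordField y₀ X y⟩ : TangentBundle (𝓡 n) M)) y :=
  (((contMDiffOn_coordField y₀ X) y hy).contMDiffAt
    ((isOpen_extChartAt_source y₀).mem_nhds hy)).mdifferentiableAt (by simp)

/-- Coordinate vector fields commute. -/
theorem mlieBracket_coordField (y₀ : M) (X Y : EuclideanSpace ℝ (Fin n)) {y : M}
    (hy : y ∈ (extChartAt (𝓡 n) y₀).source) :
    VectorField.mlieBracket (𝓡 n) (coordField y₀ X) (coordField y₀ Y) y = 0 := by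
  have : IsManifold (𝓡 n) (minSmoothness ℝ 3) M := IsManifold.of_le (n := ∞) (by
    simp [minSmoothness_of_isRCLikeNormedField]; exact ENat.LEInfty.out)
  have hc : ∀ X : EuclideanSpace ℝ (Fin n), MDifferentiableAt 𝓘(ℝ, EuclideanSpace ℝ (Fin n))
      𝓘(ℝ, EuclideanSpace ℝ (Fin n)).tangent
      (fun p => (⟨p, X⟩ : TangentBundle 𝓘(ℝ, EuclideanSpace ℝ (Fin n)) (EuclideanSpace ℝ (Fin n))))
      (extChartAt (𝓡 n) y₀ y) := fun X =>
    (contMDiffAt_vectorSpace_iff_contDiffAt.2 (contDiffAt_const (n := 1))).mdifferentiableAt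
      (by simp)
  have h := VectorField.mpullback_mlieBracket (I := 𝓡 n) (I' := 𝓘(ℝ, EuclideanSpace ℝ (Fin n)))
    (f := extChartAt (𝓡 n) y₀) (n := ∞) (x₀ := y) (hc X) (hc Y)
    (contMDiffAt_extChartAt' (by simpa using hy))
    (by simp [minSmoothness_of_isRCLikeNormedField]; exact ENat.LEInfty.out)
  have h0 : VectorField.mlieBracket 𝓘(ℝ, EuclideanSpace ℝ (Fin n))
      (fun _ : EuclideanSpace ℝ (Fin n) => X) (fun _ : EuclideanSpace ℝ (Fin n) => Y) = 0 := by
    refine (VectorField.mlieBracketWithin_univ (I := 𝓘(ℝ, EuclideanSpace ℝ (Fin n)))).symm.trans ?_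
    refine (VectorField.mlieBracketWithin_eq_lieBracketWithin (s := univ)).trans ?_
    ext1 p
    simp [VectorField.lieBracketWithin]
    rfl
  refine h.symm.trans ?_
  have h1 := congrArg (fun W => VectorField.mpullback (𝓡 n) 𝓘(ℝ, EuclideanSpace ℝ (Fin n))
    (extChartAt (𝓡 n) y₀) W y) h0
  refine h1.trans ?_
  simp [VectorField.mpullback_apply]

end Coordinates

/-! ### Metric, complex structure and connection in charts -/

section ChartStructure

variable {n : ℕ} {M : Type*} [TopologicalSpace M] [ChartedSpace (EuclideanSpace ℝ (Fin n)) M]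
  [IsManifold (𝓡 n) ∞ M] [RiemannianBundle (fun x : M => TangentSpace (𝓡 n) x)]

/-- The coordinate expression of the metric in the chart around `y₀`. -/
noncomputable def chartMetric (y₀ : M) (p : EuclideanSpace ℝ (Fin n)) :
    EuclideanSpace ℝ (Fin n) →L[ℝ] EuclideanSpace ℝ (Fin n) →L[ℝ] ℝ :=
  LinearMap.toContinuousLinearMap
    ((LinearMap.toContinuousLinearMap (𝕜 := ℝ) (E := EuclideanSpace ℝ (Fin n)) (F' := ℝ)).toLinearMap ∘ₗ
    LinearMap.mk₂ ℝ (fun X Y => inner ℝ (chartFrame y₀ p X) (chartFrame y₀ p Y))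
      (fun X X' Y => by rw [map_add, inner_add_left])
      (fun c X Y => by rw [map_smul, real_inner_smul_left]; rfl)
      (fun X Y Y' => by rw [map_add, inner_add_right])
      (fun c X Y => by rw [map_smul, real_inner_smul_right]; rfl))

theorem chartMetric_apply (y₀ : M) (p X Y : EuclideanSpace ℝ (Fin n)) :
    chartMetric y₀ p X Y = inner ℝ (chartFrame y₀ p X) (chartFrame y₀ p Y) := rfl

/-- The coordinate expression of the almost complex structure in the chart around `y₀`. -/
noncomputable def chartJ (A : AlmostHermitianStructure n M) (y₀ : M)
    (p : EuclideanSpace ℝ (Fin n)) : EuclideanSpace ℝ (Fin n) →L[ℝ] EuclideanSpace ℝ (Fin n) :=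
  (chartCoframe y₀ p).comp ((A.J ((extChartAt (𝓡 n) y₀).symm p)).comp (chartFrame y₀ p))

theorem chartFrame_chartJ (A : AlmostHermitianStructure n M) (y₀ : M)
    {p : EuclideanSpace ℝ (Fin n)} (hp : p ∈ (extChartAt (𝓡 n) y₀).target)
    (X : EuclideanSpace ℝ (Fin n)) :
    chartFrame y₀ p (chartJ A y₀ p X) =
      A.J ((extChartAt (𝓡 n) y₀).symm p) (chartFrame y₀ p X) :=
  chartFrame_chartCoframe y₀ hp _

theorem isHermitianPair_chart (A : AlmostHermitianStructure n M) (y₀ : M)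
    {p : EuclideanSpace ℝ (Fin n)} (hp : p ∈ (extChartAt (𝓡 n) y₀).target) :
    IsHermitianPair (chartMetric y₀ p) (chartJ A y₀ p) where
  symm X Y := by rw [chartMetric_apply, chartMetric_apply, real_inner_comm]
  pos X hX := by
    rw [chartMetric_apply]
    refine real_inner_self_pos.2 fun h0 => hX ?_
    rw [← chartCoframe_chartFrame y₀ hp X, h0, map_zero]
  J_J X := by
    have h : chartFrame y₀ p (chartJ A y₀ p (chartJ A y₀ p X)) = chartFrame y₀ p (-X) := by
      rw [chartFrame_chartJ A y₀ hp, chartFrame_chartJ A y₀ hp, A.J_J, map_neg]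
    rw [← chartCoframe_chartFrame y₀ hp (-X), ← h, chartCoframe_chartFrame y₀ hp]
  orth X Y := by
    simp only [chartMetric_apply]
    rw [chartFrame_chartJ A y₀ hp, chartFrame_chartJ A y₀ hp, A.inner_J_J]

variable [IsContMDiffRiemannianBundle (𝓡 n) ∞ (EuclideanSpace ℝ (Fin n))
    (fun x : M => TangentSpace (𝓡 n) x)]

theorem contDiffOn_chartMetric (y₀ : M) :
    ContDiffOn ℝ ∞ (chartMetric y₀) (extChartAt (𝓡 n) y₀).target := by
  rw [contDiffOn_clm_apply]
  intro X
  rw [contDiffOn_clm_apply]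
  intro Y
  exact ((contMDiffOn_chartFrame y₀ X).inner_bundle (contMDiffOn_chartFrame y₀ Y)).contDiffOn

theorem contDiffOn_chartJ (A : AlmostHermitianStructure n M) (y₀ : M) :
    ContDiffOn ℝ ∞ (chartJ A y₀) (extChartAt (𝓡 n) y₀).target := by
  rw [contDiffOn_clm_apply]
  intro X p hp
  have h1 := contMDiffOn_chartFrame y₀ X p hp
  have hc := contMDiffOn_extChartAt_symm (I := 𝓡 n) (n := ∞) y₀ p hp
  have h2 := (A.smooth.contMDiffAt (x := (extChartAt (𝓡 n) y₀).symm p)).comp_contMDiffWithinAt p hc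
  have h3 := ContMDiffWithinAt.clm_bundle_apply (F₁ := EuclideanSpace ℝ (Fin n))
    (F₂ := EuclideanSpace ℝ (Fin n)) (E₁ := fun x : M => TangentSpace (𝓡 n) x)
    (E₂ := fun x : M => TangentSpace (𝓡 n) x) h2 h1
  have h4 := (contMDiffOn_extChartAt (I := 𝓡 n) (x := y₀) (n := ∞)).contMDiffOn_tangentMapWithin
    (m := ∞) (by simp) (chartAt (EuclideanSpace ℝ (Fin n)) y₀).open_source.uniqueMDiffOn
  have h5 := (h4 _ (by simpa using (extChartAt (𝓡 n) y₀).map_target hp)).comp p h3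
    (t := TotalSpace.proj ⁻¹' (chartAt (EuclideanSpace ℝ (Fin n)) y₀).source)
    (fun q hq => by simpa using (extChartAt (𝓡 n) y₀).map_target hq)
  have h6 := (contMDiff_snd_tangentBundle_modelSpace (EuclideanSpace ℝ (Fin n))
    𝓘(ℝ, EuclideanSpace ℝ (Fin n))).contMDiffAt.comp_contMDiffWithinAt p h5
  refine ContMDiffWithinAt.contDiffWithinAt (h6.congr_of_eventuallyEq ?_ ?_)
  · filter_upwards [self_mem_nhdsWithin] with q hq
    have hs : (extChartAt (𝓡 n) y₀).symm q ∈ (chartAt (EuclideanSpace ℝ (Fin n)) y₀).source := by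
      simpa using (extChartAt (𝓡 n) y₀).map_target hq
    simp only [Function.comp, tangentMapWithin]
    rw [mfderivWithin_of_isOpen (chartAt (EuclideanSpace ℝ (Fin n)) y₀).open_source hs]
    rfl
  · have hs : (extChartAt (𝓡 n) y₀).symm p ∈ (chartAt (EuclideanSpace ℝ (Fin n)) y₀).source := by
      simpa using (extChartAt (𝓡 n) y₀).map_target hp
    simp only [Function.comp, tangentMapWithin]
    rw [mfderivWithin_of_isOpen (chartAt (EuclideanSpace ℝ (Fin n)) y₀).open_source hs]
    rfl

variable (nabla : CovariantDerivative (𝓡 n) (EuclideanSpace ℝ (Fin n))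
  (fun x : M => TangentSpace (𝓡 n) x))

theorem coordField_add (y₀ : M) (X Y : EuclideanSpace ℝ (Fin n)) :
    coordField y₀ (X + Y) = coordField y₀ X + coordField y₀ Y := by
  funext y
  exact map_add _ _ _

theorem coordField_smul (y₀ : M) (c : ℝ) (X : EuclideanSpace ℝ (Fin n)) :
    coordField y₀ (c • X) = c • coordField y₀ X := by
  funext y
  exact map_smul _ _ _

/-- The Christoffel symbols of a connection in the chart around `y₀`. -/
noncomputable def christoffel (y₀ : M) (p : EuclideanSpace ℝ (Fin n))
    (hp : p ∈ (extChartAt (𝓡 n) y₀).target) (W : EuclideanSpace ℝ (Fin n)) :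
    EuclideanSpace ℝ (Fin n) →L[ℝ] EuclideanSpace ℝ (Fin n) :=
  LinearMap.toContinuousLinearMap
    { toFun := fun X => chartCoframe y₀ p
        (nabla (coordField y₀ X) ((extChartAt (𝓡 n) y₀).symm p) (chartFrame y₀ p W))
      map_add' := fun X Y => by
        have hs := (extChartAt (𝓡 n) y₀).map_target hp
        rw [coordField_add, nabla.isCovariantDerivativeOnUniv.add (mdifferentiableAt_coordField y₀ X hs)
          (mdifferentiableAt_coordField y₀ Y hs)]
        exact map_add _ _ _
      map_smul' := fun c X => by
        have hs := (extChartAt (𝓡 n) y₀).map_target hp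
        rw [coordField_smul, nabla.isCovariantDerivativeOnUniv.smul_const c
          (mdifferentiableAt_coordField y₀ X hs)]
        exact map_smul (chartCoframe y₀ p) c (nabla (coordField y₀ X)
          ((extChartAt (𝓡 n) y₀).symm p) (chartFrame y₀ p W)) }

theorem chartFrame_christoffel (y₀ : M) {p : EuclideanSpace ℝ (Fin n)}
    (hp : p ∈ (extChartAt (𝓡 n) y₀).target) (W X : EuclideanSpace ℝ (Fin n)) :
    chartFrame y₀ p (christoffel nabla y₀ p hp W X) =
      nabla (coordField y₀ X) ((extChartAt (𝓡 n) y₀).symm p) (chartFrame y₀ p W) :=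
  chartFrame_chartCoframe y₀ hp _

omit [RiemannianBundle (fun x : M => TangentSpace (𝓡 n) x)]
  [IsContMDiffRiemannianBundle (𝓡 n) ∞ (EuclideanSpace ℝ (Fin n))
    (fun x : M => TangentSpace (𝓡 n) x)] in
/-- The differential of a function on the coordinate frame of a chart. -/
theorem mvfderiv_chartFrame (y₀ : M) {p : EuclideanSpace ℝ (Fin n)}
    (hp : p ∈ (extChartAt (𝓡 n) y₀).target) {h : M → ℝ}
    (hh : MDifferentiableAt (𝓡 n) 𝓘(ℝ, ℝ) h ((extChartAt (𝓡 n) y₀).symm p))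
    (W : EuclideanSpace ℝ (Fin n)) :
    mvfderiv (𝓡 n) h ((extChartAt (𝓡 n) y₀).symm p) (chartFrame y₀ p W) =
      fderiv ℝ (h ∘ (extChartAt (𝓡 n) y₀).symm) p W := by
  have hc : MDifferentiableAt 𝓘(ℝ, EuclideanSpace ℝ (Fin n)) (𝓡 n) (extChartAt (𝓡 n) y₀).symm p :=
    ((contMDiffOn_extChartAt_symm (n := ∞) y₀ p hp).contMDiffAt
      ((isOpen_extChartAt_target y₀).mem_nhds hp)).mdifferentiableAt (by simp)
  refine (mvfderiv_comp_apply p hh hc W).symm.trans ?_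
  rw [← mfderiv_eq_fderiv]
  rfl

/-- The Leibniz rule in a chart: the covariant derivative of a field `Σ fᵢ ∂ᵢ`. -/
theorem covariantDerivative_eq_christoffel (y₀ : M) {p : EuclideanSpace ℝ (Fin n)}
    (hp : p ∈ (extChartAt (𝓡 n) y₀).target) (W : EuclideanSpace ℝ (Fin n))
    (Y : ∀ y : M, TangentSpace (𝓡 n) y) (a : EuclideanSpace ℝ (Fin n) → EuclideanSpace ℝ (Fin n))
    (ha : DifferentiableAt ℝ a p)
    (hY : ∀ᶠ q in 𝓝 p, Y ((extChartAt (𝓡 n) y₀).symm q) = chartFrame y₀ q (a q))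
    (hYd : MDifferentiableAt (𝓡 n) (𝓡 n).tangent (fun y => (⟨y, Y y⟩ : TangentBundle (𝓡 n) M))
      ((extChartAt (𝓡 n) y₀).symm p)) :
    nabla Y ((extChartAt (𝓡 n) y₀).symm p) (chartFrame y₀ p W) =
      chartFrame y₀ p (fderiv ℝ a p W + christoffel nabla y₀ p hp W (a p)) := by
  set x := (extChartAt (𝓡 n) y₀).symm p with hx
  have hs : x ∈ (extChartAt (𝓡 n) y₀).source := (extChartAt (𝓡 n) y₀).map_target hp
  have hcx : extChartAt (𝓡 n) y₀ x = p := (extChartAt (𝓡 n) y₀).right_inv hp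
  let e : Fin n → EuclideanSpace ℝ (Fin n) := fun i => EuclideanSpace.single i 1
  let f : Fin n → M → ℝ := fun i y => a (extChartAt (𝓡 n) y₀ y) i
  have hsum : ∀ v : EuclideanSpace ℝ (Fin n), v = ∑ i, v i • e i := fun v => by
    conv_lhs => rw [← (EuclideanSpace.basisFun (Fin n) ℝ).sum_repr v]
    simp [e]
  have hcd : MDifferentiableAt (𝓡 n) 𝓘(ℝ, EuclideanSpace ℝ (Fin n)) (extChartAt (𝓡 n) y₀) x :=
    (contMDiffAt_extChartAt' (n := ∞) (by simpa using hs)).mdifferentiableAt (by simp)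
  have hai : ∀ i, DifferentiableAt ℝ (fun q => a q i) p := fun i =>
    (EuclideanSpace.proj (𝕜 := ℝ) i).differentiableAt.comp p ha
  have hf : ∀ i, MDifferentiableAt (𝓡 n) 𝓘(ℝ, ℝ) (f i) x := fun i => by
    have h1 : MDifferentiableAt 𝓘(ℝ, EuclideanSpace ℝ (Fin n)) 𝓘(ℝ, ℝ) (fun q => a q i)
        (extChartAt (𝓡 n) y₀ x) := by rw [hcx]; exact (hai i).mdifferentiableAt
    exact h1.comp x hcd
  have hdf : ∀ i, mvfderiv (𝓡 n) (f i) x (chartFrame y₀ p W) = (fderiv ℝ a p W) i := fun i => by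
    rw [hx, mvfderiv_chartFrame y₀ hp (hf i)]
    have hev : f i ∘ (extChartAt (𝓡 n) y₀).symm =ᶠ[𝓝 p] fun q => a q i := by
      filter_upwards [(isOpen_extChartAt_target (I := 𝓡 n) y₀).mem_nhds hp] with q hq
      simp only [Function.comp, f]
      rw [(extChartAt (𝓡 n) y₀).right_inv hq]
    rw [hev.fderiv_eq]
    have := ((EuclideanSpace.proj (𝕜 := ℝ) i).hasFDerivAt.comp p ha.hasFDerivAt).fderiv
    exact congrArg (fun B => B W) this
  have hd : ∀ i, MDifferentiableAt (𝓡 n) (𝓡 n).tangent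
      (fun y => (⟨y, (f i • coordField y₀ (e i)) y⟩ : TangentBundle (𝓡 n) M)) x := fun i =>
    (hf i).smul_section (mdifferentiableAt_coordField y₀ (e i) hs)
  have hsums : ∀ s : Finset (Fin n),
      MDifferentiableAt (𝓡 n) (𝓡 n).tangent
        (fun y => (⟨y, (∑ i ∈ s, f i • coordField y₀ (e i)) y⟩ : TangentBundle (𝓡 n) M)) x ∧
      nabla (∑ i ∈ s, f i • coordField y₀ (e i)) x (chartFrame y₀ p W) =
        ∑ i ∈ s, (a p i • chartFrame y₀ p (christoffel nabla y₀ p hp W (e i)) +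
          (fderiv ℝ a p W) i • chartFrame y₀ p (e i)) := by
    intro s
    induction s using Finset.induction_on with
    | empty =>
      refine ⟨?_, ?_⟩
      · simp only [Finset.sum_empty]
        exact mdifferentiableAt_zeroSection ..
      · simp only [Finset.sum_empty, CovariantDerivative.zero]
        rfl
    | insert i s his ih =>
      rw [Finset.sum_insert his, Finset.sum_insert his]
      refine ⟨mdifferentiableAt_add_section (hd i) ih.1, ?_⟩
      rw [nabla.isCovariantDerivativeOnUniv.add (hd i) ih.1,
        nabla.isCovariantDerivativeOnUniv.leibniz (mdifferentiableAt_coordField y₀ (e i) hs) (hf i)]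
      rw [chartFrame_christoffel, ← ih.2]
      have h1 : f i x = a p i := by simp only [f]; rw [hcx]
      have h2 : coordField y₀ (e i) x = chartFrame y₀ p (e i) := coordField_chart y₀ hp _
      rw [← hdf i, ← h1, ← h2]
      rfl
  have hYe : ∀ᶠ y in 𝓝 x, Y y = (∑ i, f i • coordField y₀ (e i)) y := by
    have hc : Tendsto (extChartAt (𝓡 n) y₀) (𝓝 x) (𝓝 p) := by
      rw [← hcx]; exact hcd.continuousAt
    filter_upwards [hc.eventually hY, (isOpen_extChartAt_source (I := 𝓡 n) y₀).mem_nhds hs]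
      with y hy hys
    rw [← coordField_chart y₀ ((extChartAt (𝓡 n) y₀).map_source hys),
      (extChartAt (𝓡 n) y₀).left_inv hys] at hy
    rw [hy, Finset.sum_apply]
    have hlin := map_sum (mfderiv (𝓡 n) 𝓘(ℝ, EuclideanSpace ℝ (Fin n)) (extChartAt (𝓡 n) y₀) y).inverse
      (fun i => a (extChartAt (𝓡 n) y₀ y) i • e i) Finset.univ
    refine (congrArg (fun v => coordField y₀ v y) (hsum (a (extChartAt (𝓡 n) y₀ y)))).trans ?_
    refine hlin.trans (Finset.sum_congr rfl fun i _ => ?_)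
    exact map_smul (mfderiv (𝓡 n) 𝓘(ℝ, EuclideanSpace ℝ (Fin n)) (extChartAt (𝓡 n) y₀) y).inverse
      (a (extChartAt (𝓡 n) y₀ y) i) (e i)
  rw [nabla.isCovariantDerivativeOnUniv.congr_of_eventuallyEq hYd (hsums Finset.univ).1
    Filter.univ_mem hYe, (hsums Finset.univ).2, Finset.sum_add_distrib, map_add]
  conv_rhs => rw [hsum (fderiv ℝ a p W)]; arg 2; rw [hsum (a p)]
  simp only [map_sum, map_smul]
  rw [add_comm]

/-- The covariant derivative of `J` in a chart. -/
theorem covDerivJ_coordField (A : AlmostHermitianStructure n M) (y₀ : M)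
    {p : EuclideanSpace ℝ (Fin n)} (hp : p ∈ (extChartAt (𝓡 n) y₀).target)
    (W Y : EuclideanSpace ℝ (Fin n)) :
    covDerivJ nabla A ((extChartAt (𝓡 n) y₀).symm p) (chartFrame y₀ p W) (coordField y₀ Y) =
      chartFrame y₀ p (fderiv ℝ (chartJ A y₀) p W Y +
        christoffel nabla y₀ p hp W (chartJ A y₀ p Y) -
          chartJ A y₀ p (christoffel nabla y₀ p hp W Y)) := by
  have hs := (extChartAt (𝓡 n) y₀).map_target hp
  have hJ : DifferentiableAt ℝ (chartJ A y₀) p :=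
    ((contDiffOn_chartJ A y₀).contDiffAt
      ((isOpen_extChartAt_target y₀).mem_nhds hp)).differentiableAt (by simp)
  have hd := MDifferentiableAt.clm_bundle_apply (F₁ := EuclideanSpace ℝ (Fin n))
    (F₂ := EuclideanSpace ℝ (Fin n)) (E₁ := fun x : M => TangentSpace (𝓡 n) x)
    (E₂ := fun x : M => TangentSpace (𝓡 n) x)
    ((A.smooth.contMDiffAt (x := (extChartAt (𝓡 n) y₀).symm p)).mdifferentiableAt (by simp))
    (mdifferentiableAt_coordField y₀ Y hs)
  have h := covariantDerivative_eq_christoffel nabla y₀ hp W (fun y => A.J y (coordField y₀ Y y))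
    (fun q => chartJ A y₀ q Y) (hJ.clm_apply (differentiableAt_const _)) (by
      filter_upwards [(isOpen_extChartAt_target (I := 𝓡 n) y₀).mem_nhds hp] with q hq
      rw [coordField_chart y₀ hq, chartFrame_chartJ A y₀ hq]) hd
  have hfd : fderiv ℝ (fun q => chartJ A y₀ q Y) p W = fderiv ℝ (chartJ A y₀) p W Y := by
    rw [(hJ.hasFDerivAt.clm_apply (hasFDerivAt_const Y p)).fderiv]
    simp
  rw [covDerivJ, h, hfd, map_sub, chartFrame_chartJ A y₀ hp, chartFrame_christoffel]

/-- In a chart, a strict nearly Kähler manifold of constant type is a local nearly Kähler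
structure. -/
theorem isLocalNearlyKahler_chart (A : AlmostHermitianStructure n M) {lam : ℝ}
    (hA : IsStrictNearlyKahlerOfConstantType A lam) (y₀ : M) :
    IsLocalNearlyKahler (extChartAt (𝓡 n) y₀).target (chartMetric y₀) (chartJ A y₀) lam := by
  obtain ⟨nabla, ⟨hmet, htor⟩, hnk, -, hlam, htype⟩ := hA
  refine ⟨isOpen_extChartAt_target y₀, contDiffOn_chartMetric y₀, contDiffOn_chartJ A y₀,
    fun p hp => isHermitianPair_chart A y₀ hp, hlam, fun p hp =>
      ⟨christoffel nabla y₀ p hp, ?_, ?_, ?_, ?_⟩⟩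
  · intro W X
    have hs := (extChartAt (𝓡 n) y₀).map_target hp
    have h := (nabla.torsion_eq_zero_iff.1 htor) (mdifferentiableAt_coordField y₀ W hs)
      (mdifferentiableAt_coordField y₀ X hs)
    rw [mlieBracket_coordField y₀ W X hs, sub_eq_zero] at h
    rw [coordField_chart y₀ hp, coordField_chart y₀ hp] at h
    exact congrArg (chartCoframe y₀ p) h
  · intro W X Y
    have hs := (extChartAt (𝓡 n) y₀).map_target hp
    have hX := mdifferentiableAt_coordField y₀ X hs
    have hY := mdifferentiableAt_coordField y₀ Y hs
    have h := hmet.mvfderiv_inner_eq (X := coordField y₀ W) hX hY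
    rw [coordField_chart y₀ hp, mvfderiv_chartFrame y₀ hp (hX.inner_bundle hY)] at h
    have hev : (fun y => inner ℝ (coordField y₀ X y) (coordField y₀ Y y)) ∘
        (extChartAt (𝓡 n) y₀).symm =ᶠ[𝓝 p] fun q => chartMetric y₀ q X Y := by
      filter_upwards [(isOpen_extChartAt_target (I := 𝓡 n) y₀).mem_nhds hp] with q hq
      simp only [Function.comp]
      rw [coordField_chart y₀ hq, coordField_chart y₀ hq, chartMetric_apply]
    have hg : DifferentiableAt ℝ (chartMetric y₀) p :=
      ((contDiffOn_chartMetric y₀).contDiffAt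
        ((isOpen_extChartAt_target y₀).mem_nhds hp)).differentiableAt (by simp)
    have hfd : fderiv ℝ (fun q => chartMetric y₀ q X Y) p W = fderiv ℝ (chartMetric y₀) p W X Y := by
      have h1 := (hg.hasFDerivAt.clm_apply (hasFDerivAt_const X p)).clm_apply (hasFDerivAt_const Y p)
      rw [h1.fderiv]
      simp
    rw [hev.fderiv_eq, hfd] at h
    rw [h, chartMetric_apply, chartMetric_apply, chartFrame_christoffel, chartFrame_christoffel]
    beta_reduce
    rw [coordField_chart y₀ hp, coordField_chart y₀ hp, coordField_chart y₀ hp]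
  · intro X
    have hs := (extChartAt (𝓡 n) y₀).map_target hp
    have h := hnk _ _ (mdifferentiableAt_coordField y₀ X hs)
    rw [coordField_chart y₀ hp, covDerivJ_coordField nabla A y₀ hp] at h
    rw [← chartCoframe_chartFrame y₀ hp (_ - _), h, map_zero]
  · intro X Y
    have hs := (extChartAt (𝓡 n) y₀).map_target hp
    have h := htype _ (chartFrame y₀ p X) _ (mdifferentiableAt_coordField y₀ Y hs)
    rw [coordField_chart y₀ hp, covDerivJ_coordField nabla A y₀ hp, ← real_inner_self_eq_norm_sq,
      ← real_inner_self_eq_norm_sq, ← real_inner_self_eq_norm_sq, ← chartFrame_chartJ A y₀ hp] at h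
    exact h

end ChartStructure

/-! ### Exterior derivatives in charts -/

section FormsInCharts

/-- A family of alternating forms on a finite-dimensional space is smooth as soon as its values on
all vectors are: evaluation on a basis has a linear left inverse. -/
theorem contDiffOn_alternating {G E : Type*} [NormedAddCommGroup G] [NormedSpace ℝ G]
    [NormedAddCommGroup E] [NormedSpace ℝ E] [FiniteDimensional ℝ E] {k : ℕ} {s : Set G}
    {η : G → E [⋀^Fin k]→L[ℝ] ℝ} (h : ∀ v, ContDiffOn ℝ ∞ (fun q => η q v) s) :
    ContDiffOn ℝ ∞ η s := by
  let b := Module.finBasis ℝ E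
  let ev : (E [⋀^Fin k]→L[ℝ] ℝ) →ₗ[ℝ] ((Fin k → Fin (Module.finrank ℝ E)) → ℝ) :=
    { toFun := fun α i => α (fun j => b (i j))
      map_add' := fun _ _ => rfl
      map_smul' := fun _ _ => rfl }
  have hinj : Function.Injective ev := by
    intro α β hαβ
    have : α.toAlternatingMap.toMultilinearMap = β.toAlternatingMap.toMultilinearMap :=
      Module.Basis.ext_multilinear (fun _ => b) (fun i => congrFun hαβ i)
    ext v
    exact congrArg (fun m => m v) this
  obtain ⟨g, hg⟩ := LinearMap.exists_leftInverse_of_injective ev (LinearMap.ker_eq_bot.2 hinj)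
  have hη : η = fun q => LinearMap.toContinuousLinearMap g (ev (η q)) := by
    funext q
    exact (congrArg (fun A => A (η q)) hg).symm
  rw [hη]
  exact (LinearMap.toContinuousLinearMap g).contDiff.comp_contDiffOn
    (contDiffOn_pi.2 fun i => h _)

variable {n : ℕ} {M : Type*} [TopologicalSpace M] [ChartedSpace (EuclideanSpace ℝ (Fin n)) M]
  [IsManifold (𝓡 n) ∞ M]

/-- The exterior derivative does not depend on the chart in which it is computed. -/
theorem dForm_chart {k : ℕ} (η : ∀ y : M, TangentSpace (𝓡 n) y [⋀^Fin k]→L[ℝ] ℝ) (y₀ : M)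
    {p : EuclideanSpace ℝ (Fin n)} (hp : p ∈ (extChartAt (𝓡 n) y₀).target)
    (hη : DifferentiableAt ℝ (formInChart η y₀) p) (v : Fin (k + 1) → EuclideanSpace ℝ (Fin n)) :
    dForm η ((extChartAt (𝓡 n) y₀).symm p) (fun i => chartFrame y₀ p (v i)) =
      ∑ i : Fin (k + 1), (-1) ^ i.val * fderiv ℝ (fun q => η ((extChartAt (𝓡 n) y₀).symm q)
        (fun j => chartFrame y₀ q (i.removeNth v j))) p (v i) := by
  set y := (extChartAt (𝓡 n) y₀).symm p with hy
  have hys : y ∈ (extChartAt (𝓡 n) y₀).source := (extChartAt (𝓡 n) y₀).map_target hp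
  set c := extChartAt (𝓡 n) y with hc
  set c₀ := extChartAt (𝓡 n) y₀ with hc₀
  let τ : EuclideanSpace ℝ (Fin n) → EuclideanSpace ℝ (Fin n) := fun u => c₀ (c.symm u)
  have hcy : c.symm (c y) = y := extChartAt_to_inv y
  have hτp : τ (c y) = p := by
    simp only [τ]; rw [hcy, hy]; exact c₀.right_inv hp
  have hct : c y ∈ c.target := mem_extChartAt_target y
  -- the set on which the transition map is defined
  have hO : ∀ᶠ u in 𝓝 (c y), u ∈ c.target ∧ c.symm u ∈ c₀.source := by
    refine Filter.Eventually.and ((isOpen_extChartAt_target (I := 𝓡 n) y).mem_nhds hct) ?_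
    have := (continuousAt_extChartAt_symm (I := 𝓡 n) y).eventually
      ((isOpen_extChartAt_source (I := 𝓡 n) y₀).mem_nhds (by rw [← hc, hcy]; exact hys))
    exact this
  have hsm : ∀ u, u ∈ c.target → MDifferentiableAt 𝓘(ℝ, EuclideanSpace ℝ (Fin n)) (𝓡 n) c.symm u :=
    fun u hu => ((contMDiffOn_extChartAt_symm (n := ∞) y u hu).contMDiffAt
      ((isOpen_extChartAt_target y).mem_nhds hu)).mdifferentiableAt (by simp)
  have hcd : ∀ z ∈ c₀.source, ContMDiffAt (𝓡 n) 𝓘(ℝ, EuclideanSpace ℝ (Fin n)) ∞ c₀ z :=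
    fun z hz => contMDiffAt_extChartAt' (by rw [← extChartAt_source (𝓡 n)]; exact hz)
  have hτs : ContDiffAt ℝ ∞ τ (c y) := by
    have h1 := (contMDiffOn_extChartAt_symm (I := 𝓡 n) (n := ∞) y (c y) hct).contMDiffAt
      ((isOpen_extChartAt_target y).mem_nhds hct)
    have h2 := hcd (c.symm (c y)) (by rw [hcy]; exact hys)
    exact (h2.comp (c y) h1).contDiffAt
  have : IsManifold (𝓡 n) 1 M := IsManifold.of_le (n := ∞) (by simp)
  have hchain : ∀ u, u ∈ c.target → c.symm u ∈ c₀.source → ∀ w, fderiv ℝ τ u w =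
      mfderiv (𝓡 n) 𝓘(ℝ, EuclideanSpace ℝ (Fin n)) c₀ (c.symm u)
        (mfderiv 𝓘(ℝ, EuclideanSpace ℝ (Fin n)) (𝓡 n) c.symm u w) := by
    intro u hu hu' w
    rw [← mfderiv_eq_fderiv]
    exact mfderiv_comp_apply u ((hcd _ hu').mdifferentiableAt (by simp)) (hsm u hu) w
  have hτ : ∀ u, u ∈ c.target → c.symm u ∈ c₀.source → ∀ w,
      chartFrame y₀ (τ u) (fderiv ℝ τ u w) = chartFrame y u w := by
    intro u hu hu' w
    have h := mfderivWithin_extChartAt_symm_comp_mfderiv_extChartAt' (I := 𝓡 n) hu'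
    rw [ModelWithCorners.range_eq_univ, mfderivWithin_univ] at h
    rw [hchain u hu hu' w]
    exact congrArg (fun A => A (mfderiv 𝓘(ℝ, EuclideanSpace ℝ (Fin n)) (𝓡 n) c.symm u w)) h
  have hη' : ∀ z z' : M, z = z' → ∀ w : Fin k → EuclideanSpace ℝ (Fin n), η z w = η z' w := by
    rintro z _ rfl w
    rfl
  have hpull : formInChart η y =ᶠ[𝓝 (c y)] fun u =>
      (formInChart η y₀ (τ u)).compContinuousLinearMap (fderiv ℝ τ u) := by
    filter_upwards [hO] with u hu
    ext w
    have e : c₀.symm (τ u) = c.symm u := c₀.left_inv hu.2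
    refine (hη' _ _ e.symm _).trans ?_
    exact congrArg (fun W => η (c₀.symm (τ u)) W) (funext fun i => (hτ u hu.1 hu.2 (w i)).symm)
  have hd : extDeriv (formInChart η y) (c y) =
      (extDeriv (formInChart η y₀) p).compContinuousLinearMap (fderiv ℝ τ (c y)) := by
    rw [hpull.extDeriv_eq, ← hτp]
    exact extDeriv_pullback (by rw [hτp]; exact hη) hτs (by simp [minSmoothness_of_isRCLikeNormedField]; exact ENat.LEInfty.out)
  have hfin : ∀ w, fderiv ℝ τ (c y) (mfderiv (𝓡 n) 𝓘(ℝ, EuclideanSpace ℝ (Fin n)) c y (chartFrame y₀ p w)) = w := by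
    intro w
    refine (hchain (c y) hct (by rw [hcy]; exact hys) _).trans ?_
    have h := mfderivWithin_extChartAt_symm_comp_mfderiv_extChartAt' (I := 𝓡 n)
      (mem_extChartAt_source (I := 𝓡 n) y)
    rw [ModelWithCorners.range_eq_univ, mfderivWithin_univ] at h
    have h1 := congrArg (fun A => A (chartFrame y₀ p w)) h
    have h2 : ∀ z, z = y → ∀ V : EuclideanSpace ℝ (Fin n),
        mfderiv (𝓡 n) 𝓘(ℝ, EuclideanSpace ℝ (Fin n)) c₀ z V =
          mfderiv (𝓡 n) 𝓘(ℝ, EuclideanSpace ℝ (Fin n)) c₀ y V := by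
      rintro _ rfl V
      rfl
    refine (h2 _ hcy _).trans ?_
    refine (congrArg (mfderiv (𝓡 n) 𝓘(ℝ, EuclideanSpace ℝ (Fin n)) c₀ y) h1).trans ?_
    exact chartCoframe_chartFrame y₀ hp w
  have hL : dForm η y (fun i => chartFrame y₀ p (v i)) = extDeriv (formInChart η y₀) p v := by
    have e1 : dForm η y (fun i => chartFrame y₀ p (v i)) = extDeriv (formInChart η y) (c y)
      (fun i => mfderiv (𝓡 n) 𝓘(ℝ, EuclideanSpace ℝ (Fin n)) c y (chartFrame y₀ p (v i))) := rfl
    rw [e1, hd]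
    exact congrArg (fun W => extDeriv (formInChart η y₀) p W) (funext fun i => hfin (v i))
  rw [hL, extDeriv_apply hη]
  refine Finset.sum_congr rfl fun i _ => ?_
  rw [zsmul_eq_mul]
  push_cast
  rfl

variable [RiemannianBundle (fun x : M => TangentSpace (𝓡 n) x)]
  [IsContMDiffRiemannianBundle (𝓡 n) ∞ (EuclideanSpace ℝ (Fin n))
    (fun x : M => TangentSpace (𝓡 n) x)]

theorem omega_chart (A : AlmostHermitianStructure n M) (y₀ : M) {p : EuclideanSpace ℝ (Fin n)}
    (hp : p ∈ (extChartAt (𝓡 n) y₀).target) (v : Fin 2 → EuclideanSpace ℝ (Fin n)) :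
    A.omega ((extChartAt (𝓡 n) y₀).symm p) (fun i => chartFrame y₀ p (v i)) =
      kahlerForm (chartMetric y₀) (chartJ A y₀) p (v 0) (v 1) := by
  rw [kahlerForm_apply, chartMetric_apply, chartFrame_chartJ A y₀ hp]
  rfl

/-- `dω = 3 T`, in charts. -/
theorem dForm_omega_chart (A : AlmostHermitianStructure n M) (y₀ : M)
    {p : EuclideanSpace ℝ (Fin n)} (hp : p ∈ (extChartAt (𝓡 n) y₀).target)
    (v : Fin 3 → EuclideanSpace ℝ (Fin n)) :
    dForm A.omega ((extChartAt (𝓡 n) y₀).symm p) (fun i => chartFrame y₀ p (v i)) =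
      3 * torsionForm (chartMetric y₀) (chartJ A y₀) p (v 0) (v 1) (v 2) := by
  have hU := isOpen_extChartAt_target (I := 𝓡 n) y₀
  have hk : ContDiffOn ℝ ∞ (kahlerForm (chartMetric y₀) (chartJ A y₀)) (extChartAt (𝓡 n) y₀).target :=
    (contDiffOn_chartMetric y₀).clm_comp (contDiffOn_chartJ A y₀)
  have hkd : DifferentiableAt ℝ (kahlerForm (chartMetric y₀) (chartJ A y₀)) p :=
    (hk.contDiffAt (hU.mem_nhds hp)).differentiableAt (by simp)
  have hη : ContDiffOn ℝ ∞ (formInChart A.omega y₀) (extChartAt (𝓡 n) y₀).target := by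
    refine contDiffOn_alternating fun v => ?_
    refine ContDiffOn.congr ?_ fun q hq => omega_chart A y₀ hq v
    exact (hk.clm_apply contDiffOn_const).clm_apply contDiffOn_const
  have hfd : ∀ W X Y : EuclideanSpace ℝ (Fin n), ∀ w : Fin 2 → EuclideanSpace ℝ (Fin n), w 0 = X →
      w 1 = Y → fderiv ℝ (fun q => A.omega ((extChartAt (𝓡 n) y₀).symm q)
        (fun j => chartFrame y₀ q (w j))) p W =
      fderiv ℝ (kahlerForm (chartMetric y₀) (chartJ A y₀)) p W X Y := by
    rintro W X Y w rfl rfl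
    have hev : (fun q => A.omega ((extChartAt (𝓡 n) y₀).symm q)
        (fun j => chartFrame y₀ q (w j))) =ᶠ[𝓝 p]
        fun q => kahlerForm (chartMetric y₀) (chartJ A y₀) q (w 0) (w 1) := by
      filter_upwards [hU.mem_nhds hp] with q hq using omega_chart A y₀ hq w
    rw [hev.fderiv_eq, ((hkd.hasFDerivAt.clm_apply (hasFDerivAt_const (w 0) p)).clm_apply
      (hasFDerivAt_const (w 1) p)).fderiv]
    simp
  rw [dForm_chart A.omega y₀ hp ((hη.contDiffAt (hU.mem_nhds hp)).differentiableAt (by simp)),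
    torsionForm_apply]
  refine (Fin.sum_univ_three _).trans ?_
  rw [hfd (v 0) (v 1) (v 2) _ rfl rfl, hfd (v 1) (v 0) (v 2) _ rfl rfl, hfd (v 2) (v 0) (v 1) _ rfl rfl]
  norm_num
  ring

/-- The form `Im Φ` is `-λ⁻¹ T(·, ·, J ·)`. -/
theorem imPhi_chart (A : AlmostHermitianStructure n M) (lam : ℝ) (y₀ : M)
    {p : EuclideanSpace ℝ (Fin n)} (hp : p ∈ (extChartAt (𝓡 n) y₀).target)
    (X Y Z : EuclideanSpace ℝ (Fin n)) :
    imPhi A lam ((extChartAt (𝓡 n) y₀).symm p) (chartFrame y₀ p X) (chartFrame y₀ p Y)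
      (chartFrame y₀ p Z) =
      -(starTorsionForm (chartMetric y₀) (chartJ A y₀) p X Y Z / lam) := by
  have h := dForm_omega_chart A y₀ hp ![X, Y, chartJ A y₀ p Z]
  have hv : (fun i => chartFrame y₀ p ((![X, Y, chartJ A y₀ p Z] : Fin 3 → _) i)) =
      ![chartFrame y₀ p X, chartFrame y₀ p Y,
        A.J ((extChartAt (𝓡 n) y₀).symm p) (chartFrame y₀ p Z)] := by
    funext i
    fin_cases i
    · rfl
    · rfl
    · exact chartFrame_chartJ A y₀ hp Z
  rw [hv] at h
  rw [imPhi, h, starTorsionForm_apply]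
  change -(1 / (3 * lam)) * (3 * torsionForm (chartMetric y₀) (chartJ A y₀) p X Y
    (chartJ A y₀ p Z)) = _
  rcases eq_or_ne lam 0 with rfl | hl
  · simp
  · field_simp

end FormsInCharts

/-! ### Forms on oriented Euclidean spaces of dimension three -/

section OrientedThreeSpace

variable {E : Type*} [NormedAddCommGroup E] [InnerProductSpace ℝ E] [FiniteDimensional ℝ E]
  [hE : Fact (Module.finrank ℝ E = 3)] (o : Orientation ℝ E (Fin 3))

/-- A fixed orthonormal basis of a Euclidean space of dimension three. -/
noncomputable def threeBasis (E : Type*) [NormedAddCommGroup E] [InnerProductSpace ℝ E]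
    [FiniteDimensional ℝ E] [hE : Fact (Module.finrank ℝ E = 3)] : OrthonormalBasis (Fin 3) ℝ E :=
  (stdOrthonormalBasis ℝ E).reindex (finCongr hE.out)

theorem formInner_eq_threeBasis {k : ℕ} (α β : E [⋀^Fin k]→L[ℝ] ℝ) :
    formInner α β = (k.factorial : ℝ)⁻¹ * ∑ i : Fin k → Fin 3,
      α (fun j => threeBasis E (i j)) * β (fun j => threeBasis E (i j)) := by
  rw [formInner]
  congr 1
  refine Fintype.sum_equiv (Equiv.arrowCongr (Equiv.refl _) (finCongr hE.out)) _ _ fun i => ?_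
  simp [threeBasis, Equiv.arrowCongr]

/-- The determinant in coordinates of three vectors of a Euclidean space of dimension three. -/
theorem exists_volumeForm_eq : ∃ s : ℝ, s * s = 1 ∧ ∀ v : Fin 3 → E, o.volumeForm v =
    s * (Matrix.of fun i j : Fin 3 => (threeBasis E).repr (v j) i).det := by
  by_cases h : (threeBasis E).toBasis.orientation = o
  · refine ⟨1, by norm_num, fun v => ?_⟩
    rw [o.volumeForm_robust (threeBasis E) h, Module.Basis.det_apply, one_mul]
    congr 1
  · refine ⟨-1, by norm_num, fun v => ?_⟩
    rw [o.volumeForm_robust_neg (threeBasis E) h, AlternatingMap.neg_apply,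
      Module.Basis.det_apply, neg_one_mul]
    congr 2

/-- The square of the volume form is the Gram determinant. -/
theorem volumeForm_sq (v : Fin 3 → E) :
    o.volumeForm v ^ 2 = (Matrix.of fun i j : Fin 3 => (inner ℝ (v i) (v j) : ℝ)).det := by
  obtain ⟨s, hs, h⟩ := exists_volumeForm_eq o
  rw [h, mul_pow, sq s, hs, one_mul, sq]
  nth_rw 1 [← Matrix.det_transpose]
  rw [← Matrix.det_mul]
  congr 1
  ext i j
  rw [Matrix.mul_apply, Matrix.of_apply, ← (threeBasis E).repr.inner_map_map (v i) (v j)]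
  simp only [PiLp.inner_apply, Matrix.transpose_apply, Matrix.of_apply]
  refine Finset.sum_congr rfl fun k _ => ?_
  simp [mul_comm]

/-- A bilinear alternating form on an oriented Euclidean space of dimension three is the
contraction of the volume form with a vector. -/
theorem exists_dual_vector (B : E →ₗ[ℝ] E →ₗ[ℝ] ℝ) (hB : ∀ u, B u u = 0) :
    ∃ W : E, ∀ u v, B u v = o.volumeForm ![W, u, v] := by
  obtain ⟨s, hs, h⟩ := exists_volumeForm_eq o
  have hsw : ∀ u v, B u v = -B v u := fun u v => by
    have := hB (u + v)
    simp only [map_add, LinearMap.add_apply, hB] at this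
    linarith
  let b := threeBasis E
  refine ⟨s • (B (b 1) (b 2) • b 0 + B (b 2) (b 0) • b 1 + B (b 0) (b 1) • b 2), fun u v => ?_⟩
  rw [h]
  conv_lhs => rw [← b.sum_repr u, ← b.sum_repr v]
  simp only [Fin.sum_univ_three, map_add, map_smul, LinearMap.add_apply, LinearMap.smul_apply,
    smul_eq_mul, Matrix.det_fin_three, Matrix.of_apply, Matrix.cons_val, PiLp.add_apply,
    PiLp.smul_apply, OrthonormalBasis.repr_self, b]
  simp only [PiLp.single_apply, hB]
  rw [hsw (threeBasis E 1) (threeBasis E 0), hsw (threeBasis E 2) (threeBasis E 1),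
    hsw (threeBasis E 0) (threeBasis E 2)]
  simp
  set x := (threeBasis E).repr u
  set y := (threeBasis E).repr v
  linear_combination (-(B (threeBasis E 0) (threeBasis E 1) * (x 0 * y 1 - x 1 * y 0) +
    B (threeBasis E 2) (threeBasis E 0) * (x 2 * y 0 - x 0 * y 2) +
    B (threeBasis E 1) (threeBasis E 2) * (x 1 * y 2 - x 2 * y 1))) * hs

theorem alternating_two_swap (β : E [⋀^Fin 2]→L[ℝ] ℝ) (u v : E) : β ![u, v] = -β ![v, u] := by
  have h := β.map_swap ![v, u] (i := 0) (j := 1) (by decide)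
  have e : ![u, v] = ![v, u] ∘ Equiv.swap (0 : Fin 2) 1 := by
    ext i
    fin_cases i <;> rfl
  exact (congrArg β e).trans h

theorem exists_dual_vector_form (β : E [⋀^Fin 2]→L[ℝ] ℝ) :
    ∃ W : E, ∀ u v, β ![u, v] = o.volumeForm ![W, u, v] := by
  have hadd : ∀ u u' v, β ![u + u', v] = β ![u, v] + β ![u', v] := fun u u' v =>
    β.toAlternatingMap.map_vecCons_add ![v] u u'
  have hsmul : ∀ (c : ℝ) u v, β ![c • u, v] = c • β ![u, v] := fun c u v =>
    β.toAlternatingMap.map_vecCons_smul ![v] c u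
  refine exists_dual_vector o (LinearMap.mk₂ ℝ (fun u v => β ![u, v]) hadd hsmul
    (fun u v v' => ?_) (fun c u v => ?_)) fun u => ?_
  · rw [alternating_two_swap, hadd, alternating_two_swap β u v, alternating_two_swap β u v']
    ring
  · rw [alternating_two_swap, hsmul, alternating_two_swap β u v]
    simp
  · exact β.map_eq_zero_of_eq ![u, u] (i := 0) (j := 1) rfl (by decide)

/-- Cramer's rule in dimension three. -/
theorem sum_volumeForm_smul (v : Fin 3 → E) (W : E) :
    ∑ i, o.volumeForm ![W, v (i + 1), v (i + 2)] • v i = o.volumeForm v • W := by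
  obtain ⟨s, hs, h⟩ := exists_volumeForm_eq o
  apply (threeBasis E).repr.injective
  ext k
  simp only [h, map_add, map_smul, Fin.sum_univ_three, PiLp.add_apply, PiLp.smul_apply,
    smul_eq_mul, Matrix.det_fin_three, Matrix.of_apply, Matrix.cons_val, Fin.isValue, zero_add,
    Fin.reduceAdd]
  fin_cases k <;> (simp only [Fin.zero_eta, Fin.mk_one, Fin.reduceFinMk]; ring)

/-- Passing from `2`-forms to their dual vectors is an isometry. -/
theorem formInner_of_dual {β β' : E [⋀^Fin 2]→L[ℝ] ℝ} {W W' : E}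
    (h : ∀ u v, β ![u, v] = o.volumeForm ![W, u, v])
    (h' : ∀ u v, β' ![u, v] = o.volumeForm ![W', u, v]) : formInner β β' = inner ℝ W W' := by
  obtain ⟨s, hs, hv⟩ := exists_volumeForm_eq o
  rw [formInner_eq_threeBasis]
  have e : ∑ i : Fin 2 → Fin 3, β (fun j => threeBasis E (i j)) * β' (fun j => threeBasis E (i j)) =
      ∑ a : Fin 3, ∑ b : Fin 3, β ![threeBasis E a, threeBasis E b] *
        β' ![threeBasis E a, threeBasis E b] := by
    rw [← Fintype.sum_prod_type' (f := fun a b => β ![threeBasis E a, threeBasis E b] *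
        β' ![threeBasis E a, threeBasis E b])]
    refine Fintype.sum_equiv (finTwoArrowEquiv (Fin 3)) _ _ fun i => ?_
    have : (fun j => threeBasis E (i j)) = ![threeBasis E (i 0), threeBasis E (i 1)] := by
      ext j; fin_cases j <;> rfl
    rw [this]
    rfl
  rw [e, ← (threeBasis E).repr.inner_map_map W W']
  simp only [h, h', hv, Fin.sum_univ_three, PiLp.inner_apply, Matrix.det_fin_three, Matrix.of_apply,
    Matrix.cons_val, OrthonormalBasis.repr_self, PiLp.single_apply, Fin.isValue, Nat.factorial,
    Fin.reduceEq, if_true, if_false]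
  simp
  set x := (threeBasis E).repr W
  set y := (threeBasis E).repr W'
  linear_combination (x 0 * y 0 + x 1 * y 1 + x 2 * y 2) * hs

/-- The inner product of two `2`-forms on a Euclidean space of dimension three, computed on an
arbitrary frame. -/
theorem formInner_two_frame (v : Fin 3 → E) (hv : o.volumeForm v ≠ 0)
    (β β' : E [⋀^Fin 2]→L[ℝ] ℝ) :
    formInner β β' = (∑ i, ∑ j, β ![v (i + 1), v (i + 2)] * β' ![v (j + 1), v (j + 2)] *
      inner ℝ (v i) (v j)) / o.volumeForm v ^ 2 := by
  obtain ⟨W, h⟩ := exists_dual_vector_form o β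
  obtain ⟨W', h'⟩ := exists_dual_vector_form o β'
  have e : inner ℝ (o.volumeForm v • W) (o.volumeForm v • W') =
      ∑ i, ∑ j, β ![v (i + 1), v (i + 2)] * β' ![v (j + 1), v (j + 2)] *
        (inner ℝ (v i) (v j) : ℝ) := by
    rw [← sum_volumeForm_smul, ← sum_volumeForm_smul, sum_inner]
    refine Finset.sum_congr rfl fun i _ => ?_
    rw [inner_sum]
    refine Finset.sum_congr rfl fun j _ => ?_
    rw [real_inner_smul_left, real_inner_smul_right, h, h']
    ring
  rw [formInner_of_dual o h h', ← e, real_inner_smul_left, real_inner_smul_right]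
  field_simp

theorem hodgeStar_apply (θ : E →L[ℝ] ℝ) (u v : E) :
    hodgeStar o θ ![u, v] =
      o.volumeForm ![(InnerProductSpace.toDual ℝ E).symm θ, u, v] := rfl

/-- The inner product of a `2`-form `β` with `*θ`, from `⟨β, *θ⟩ vol = β ∧ θ` evaluated on an
arbitrary frame. -/
theorem formInner_hodgeStar_frame (v : Fin 3 → E) (hv : o.volumeForm v ≠ 0)
    (β : E [⋀^Fin 2]→L[ℝ] ℝ) (θ : E →L[ℝ] ℝ) :
    formInner β (hodgeStar o θ) = (∑ i, β ![v (i + 1), v (i + 2)] * θ (v i)) / o.volumeForm v := by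
  obtain ⟨W, h⟩ := exists_dual_vector_form o β
  have e : θ (o.volumeForm v • W) = ∑ i, β ![v (i + 1), v (i + 2)] * θ (v i) := by
    rw [← sum_volumeForm_smul, map_sum]
    refine Finset.sum_congr rfl fun i _ => ?_
    rw [map_smul, h, smul_eq_mul]
  rw [formInner_of_dual o h (hodgeStar_apply o θ), ← e, map_smul, real_inner_comm,
    InnerProductSpace.toDual_symm_apply, smul_eq_mul]
  field_simp

theorem alternating_three_eq (γ : E [⋀^Fin 3]→L[ℝ] ℝ) : ∃ c : ℝ, ∀ v, γ v = c * o.volumeForm v := by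
  obtain ⟨s, hs, hv⟩ := exists_volumeForm_eq o
  refine ⟨γ (threeBasis E) * s, fun v => ?_⟩
  have h := congrArg (fun f => f v) (γ.toAlternatingMap.eq_smul_basis_det (threeBasis E).toBasis)
  refine h.trans ?_
  rw [hv, AlternatingMap.smul_apply, Module.Basis.det_apply, smul_eq_mul, mul_assoc, ← mul_assoc s,
    hs, one_mul]
  rw [OrthonormalBasis.coe_toBasis]
  rfl

/-- The squared norm of a `3`-form on a Euclidean space of dimension three, on an arbitrary frame.
-/
theorem formInner_three_frame (v : Fin 3 → E) (hv : o.volumeForm v ≠ 0)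
    (γ : E [⋀^Fin 3]→L[ℝ] ℝ) : formInner γ γ = γ v ^ 2 / o.volumeForm v ^ 2 := by
  obtain ⟨s, hs, h⟩ := exists_volumeForm_eq o
  obtain ⟨c, hc⟩ := alternating_three_eq o γ
  rw [hc v, mul_pow, mul_div_assoc, div_self (pow_ne_zero 2 hv), mul_one, formInner_eq_threeBasis]
  -- Only the six permutations contribute, each with the square of a sign.
  have hsum : ∑ i : Fin 3 → Fin 3, (Matrix.of fun a j : Fin 3 =>
      ((threeBasis E).repr (threeBasis E (i j)) a)).det ^ 2 = 6 := by
    have hz : ∑ i : Fin 3 → Fin 3, (Matrix.of fun a j : Fin 3 =>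
      (if a = i j then 1 else 0 : ℤ)).det ^ 2 = 6 := by
      simp only [Matrix.det_fin_three, Matrix.of_apply]
      decide
    have hr := congrArg (Int.cast (R := ℝ)) hz
    push_cast at hr
    rw [← hr]
    refine Finset.sum_congr rfl fun i _ => ?_
    simp only [Matrix.det_fin_three, Matrix.of_apply, OrthonormalBasis.repr_self, PiLp.single_apply,
      Matrix.map_apply, Int.cast_ite, Int.cast_one, Int.cast_zero]
  have e : ∀ i : Fin 3 → Fin 3, γ (fun j => threeBasis E (i j)) * γ (fun j => threeBasis E (i j)) =
      c ^ 2 * (Matrix.of fun a j : Fin 3 =>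
      ((threeBasis E).repr (threeBasis E (i j)) a)).det ^ 2 := fun i => by
    rw [hc, h]
    linear_combination c ^ 2 * (Matrix.of fun a j : Fin 3 =>
      ((threeBasis E).repr (threeBasis E (i j)) a)).det ^ 2 * hs
  rw [Finset.sum_congr rfl fun i _ => e i, ← Finset.mul_sum, hsum]
  norm_num [Nat.factorial]
  ring

end OrientedThreeSpace

/-! ### Gluing of measures -/

section GluingMeasures

/-- Measures that are supported on the members of a countable cover and agree on the overlaps are
the restrictions of their supremum. -/
theorem iSup_restrict_eq_of_agree {α ι : Type*} [MeasurableSpace α] (μ : ι → Measure α)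
    (s : ι → Set α) (hs : ∀ i, MeasurableSet (s i)) (hsupp : ∀ i, μ i (s i)ᶜ = 0)
    (hag : ∀ i j A, MeasurableSet A → A ⊆ s i → A ⊆ s j → μ i A = μ j A)
    (t : ℕ → ι) (ht : ⋃ n, s (t n) = univ) (i : ι) : (⨆ j, μ j).restrict (s i) = μ i := by
  let A : ℕ → Set α := disjointed fun n => s (t n)
  have hAm : ∀ n, MeasurableSet (A n) := fun n => MeasurableSet.disjointed (fun n => hs _) n
  have hAs : ∀ n, A n ⊆ s (t n) := fun n => disjointed_subset _ n
  have hAd : Pairwise (Function.onFun Disjoint A) := disjoint_disjointed _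
  have hAu : ⋃ n, A n = univ := by rw [iUnion_disjointed, ht]
  let ν : Measure α := Measure.sum fun n => (μ (t n)).restrict (A n)
  have hinter : ∀ j B, μ j (B ∩ s j) = μ j B := fun j B => by
    exact measure_inter_conull (hsupp j)
  have hdecomp : ∀ j B, MeasurableSet B → μ j B = ∑' n, μ (t n) (B ∩ s j ∩ A n) := by
    intro j B hB
    rw [← hinter j B]
    have : B ∩ s j = ⋃ n, B ∩ s j ∩ A n := by rw [← inter_iUnion, hAu, inter_univ]
    conv_lhs => rw [this]
    rw [measure_iUnion]
    · refine tsum_congr fun n => ?_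
      exact hag _ _ _ ((hB.inter (hs j)).inter (hAm n)) (fun x hx => hx.1.2)
        fun x hx => hAs n hx.2
    · exact fun a b hab => (hAd hab).mono inter_subset_right inter_subset_right
    · exact fun n => (hB.inter (hs j)).inter (hAm n)
  have hν : ∀ B, MeasurableSet B → ν B = ∑' n, μ (t n) (B ∩ A n) := fun B hB => by
    rw [Measure.sum_apply _ hB]
    exact tsum_congr fun n => Measure.restrict_apply hB
  have hle : ⨆ j, μ j ≤ ν := by
    refine iSup_le fun j => Measure.le_iff.2 fun B hB => ?_
    rw [hdecomp j B hB, hν B hB]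
    exact ENNReal.tsum_le_tsum fun n => measure_mono (by
      intro x hx; exact ⟨hx.1.1, hx.2⟩)
  ext B hB
  rw [Measure.restrict_apply hB]
  refine le_antisymm ?_ ?_
  · refine (Measure.le_iff.1 hle _ (hB.inter (hs i))).trans ?_
    rw [hν _ (hB.inter (hs i)), hdecomp i B hB]
  · rw [← hinter i B]
    exact Measure.le_iff.1 (le_iSup μ i) _ (hB.inter (hs i))

end GluingMeasures

/-! ### The induced volume in charts -/

section InducedVolume

variable {m n : ℕ} {L M : Type*}
  [TopologicalSpace L] [ChartedSpace (EuclideanSpace ℝ (Fin m)) L] [IsManifold (𝓡 m) ∞ L]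
  [MeasurableSpace L] [BorelSpace L]
  [TopologicalSpace M] [ChartedSpace (EuclideanSpace ℝ (Fin n)) M] [IsManifold (𝓡 n) ∞ M]
  [RiemannianBundle (fun x : M => TangentSpace (𝓡 n) x)]

/-- The Gram determinant of the images of a basis under a linear map is multiplied by the square
of the determinant under a linear change of the basis. -/
theorem gram_det_comp {T : Type*} [NormedAddCommGroup T] [InnerProductSpace ℝ T]
    (P : EuclideanSpace ℝ (Fin m) →ₗ[ℝ] T)
    (B : EuclideanSpace ℝ (Fin m) →ₗ[ℝ] EuclideanSpace ℝ (Fin m)) :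
    (Matrix.of fun i j : Fin m => (inner ℝ (P (B (EuclideanSpace.single i 1)))
      (P (B (EuclideanSpace.single j 1))) : ℝ)).det =
    LinearMap.det B ^ 2 * (Matrix.of fun i j : Fin m => (inner ℝ (P (EuclideanSpace.single i 1))
      (P (EuclideanSpace.single j 1)) : ℝ)).det := by
  let b := (EuclideanSpace.basisFun (Fin m) ℝ).toBasis
  have hb : ∀ i, b i = EuclideanSpace.single i 1 := fun i => by simp [b]
  let N := LinearMap.toMatrix b b B
  have hN : ∀ i, B (EuclideanSpace.single i 1) = ∑ k, N k i • EuclideanSpace.single k 1 := fun i => by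
    rw [← hb, ← b.sum_repr (B (b i))]
    simp only [N, LinearMap.toMatrix_apply, hb]
  have : (Matrix.of fun i j : Fin m => (inner ℝ (P (B (EuclideanSpace.single i 1)))
      (P (B (EuclideanSpace.single j 1))) : ℝ)) = N.transpose *
      (Matrix.of fun i j : Fin m => (inner ℝ (P (EuclideanSpace.single i 1))
      (P (EuclideanSpace.single j 1)) : ℝ)) * N := by
    ext i j
    rw [Matrix.of_apply, hN, hN, map_sum, map_sum, inner_sum]
    simp only [Matrix.mul_apply, Matrix.transpose_apply, Matrix.of_apply, map_smul, sum_inner,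
      real_inner_smul_left, real_inner_smul_right, Finset.sum_mul]
    refine Finset.sum_congr rfl fun k _ => ?_
    exact Finset.sum_congr rfl fun l _ => by ring
  rw [this, Matrix.det_mul, Matrix.det_mul, Matrix.det_transpose, LinearMap.det_toMatrix]
  ring

/-- The volume of a chart is the integral of the density over the domain of the coordinates. -/
theorem chartVolume_apply (φ : L → M) (x : L) {A : Set L} (hA : MeasurableSet A) :
    chartVolume m n φ x A = ∫⁻ u in (extChartAt (𝓡 m) x).symm ⁻¹' A ∩ (extChartAt (𝓡 m) x).target,
      ENNReal.ofReal (chartDensity m n φ x u) := by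
  have hT := (isOpen_extChartAt_target (I := 𝓡 m) x).measurableSet
  have hmeas : AEMeasurable (extChartAt (𝓡 m) x).symm
      ((volume.restrict (extChartAt (𝓡 m) x).target).withDensity fun u =>
        ENNReal.ofReal (chartDensity m n φ x u)) :=
    ((continuousOn_extChartAt_symm x).aemeasurable hT).mono_ac (withDensity_absolutelyContinuous _ _)
  rw [chartVolume, Measure.map_apply_of_aemeasurable hmeas hA, withDensity_apply',
    Measure.restrict_restrict' hT]

theorem measurableSet_chart_preimage (x : L) {A : Set L} (hA : MeasurableSet A) :
    MeasurableSet ((extChartAt (𝓡 m) x).symm ⁻¹' A ∩ (extChartAt (𝓡 m) x).target) := by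
  have hT := (isOpen_extChartAt_target (I := 𝓡 m) x).measurableSet
  have h := (continuousOn_iff_continuous_domRestrict.1
    (continuousOn_extChartAt_symm (I := 𝓡 m) x)).measurable hA
  have h2 := hT.subtype_image h
  convert h2 using 1
  ext u
  simp only [mem_inter_iff, mem_preimage, mem_image, Subtype.exists, Set.domRestrict_apply,
    exists_and_right, exists_eq_right]
  exact ⟨fun h => ⟨h.2, h.1⟩, fun ⟨h1, h2⟩ => ⟨h2, h1⟩⟩

/-- The change of the density of a differentiable map under a change of charts. -/
theorem chartDensity_transition (φ : L → M) (x x' : L)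
    {u : EuclideanSpace ℝ (Fin m)} (hu : u ∈ (extChartAt (𝓡 m) x').target)
    (hu' : (extChartAt (𝓡 m) x').symm u ∈ (extChartAt (𝓡 m) x).source)
    (hφ : MDifferentiableAt (𝓡 m) (𝓡 n) φ ((extChartAt (𝓡 m) x').symm u)) :
    DifferentiableAt ℝ (fun w => extChartAt (𝓡 m) x ((extChartAt (𝓡 m) x').symm w)) u ∧
    chartDensity m n φ x' u =
      |(fderiv ℝ (fun w => extChartAt (𝓡 m) x ((extChartAt (𝓡 m) x').symm w)) u).det| *
        chartDensity m n φ x (extChartAt (𝓡 m) x ((extChartAt (𝓡 m) x').symm u)) := by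
  set c := extChartAt (𝓡 m) x with hc
  set c' := extChartAt (𝓡 m) x' with hc'
  set τ : EuclideanSpace ℝ (Fin m) → EuclideanSpace ℝ (Fin m) := fun w => c (c'.symm w) with hτ
  have hsm : MDifferentiableAt 𝓘(ℝ, EuclideanSpace ℝ (Fin m)) (𝓡 m) c'.symm u :=
    ((contMDiffOn_extChartAt_symm (n := ∞) x' u hu).contMDiffAt
      ((isOpen_extChartAt_target x').mem_nhds hu)).mdifferentiableAt (by simp)
  have hcd : MDifferentiableAt (𝓡 m) 𝓘(ℝ, EuclideanSpace ℝ (Fin m)) c (c'.symm u) :=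
    (contMDiffAt_extChartAt' (n := ∞)
      (by rw [← extChartAt_source (𝓡 m)]; exact hu')).mdifferentiableAt (by simp)
  have hτd : DifferentiableAt ℝ τ u := (hcd.comp u hsm).differentiableAt
  refine ⟨hτd, ?_⟩
  have hcτ : c.symm (τ u) = c'.symm u := c.left_inv hu'
  have hτt : τ u ∈ c.target := c.map_source hu'
  have hsm2 : MDifferentiableAt 𝓘(ℝ, EuclideanSpace ℝ (Fin m)) (𝓡 m) c.symm (τ u) :=
    ((contMDiffOn_extChartAt_symm (n := ∞) x (τ u) hτt).contMDiffAt
      ((isOpen_extChartAt_target x).mem_nhds hτt)).mdifferentiableAt (by simp)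
  have hφc : MDifferentiableAt 𝓘(ℝ, EuclideanSpace ℝ (Fin m)) (𝓡 n) (φ ∘ c.symm) (τ u) :=
    MDifferentiableAt.comp (τ u) (by rw [hcτ]; exact hφ) hsm2
  have hev : φ ∘ c'.symm =ᶠ[𝓝 u] (φ ∘ c.symm) ∘ τ := by
    have := hsm.continuousAt.eventually ((isOpen_extChartAt_source (I := 𝓡 m) x).mem_nhds hu')
    filter_upwards [this] with w hw
    simp only [Function.comp, τ]
    rw [c.left_inv hw]
  have hmf : ∀ w : EuclideanSpace ℝ (Fin m),
      (mfderiv 𝓘(ℝ, EuclideanSpace ℝ (Fin m)) (𝓡 n) (φ ∘ c'.symm) u w : EuclideanSpace ℝ (Fin n)) =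
      mfderiv 𝓘(ℝ, EuclideanSpace ℝ (Fin m)) (𝓡 n) (φ ∘ c.symm) (τ u) (fderiv ℝ τ u w) := by
    intro w
    rw [hev.mfderiv_eq, ← mfderiv_eq_fderiv]
    exact mfderiv_comp_apply u hφc hτd.mdifferentiableAt w
  let G : ∀ z : M, (Fin m → TangentSpace (𝓡 n) z) → ℝ := fun z v =>
    (Matrix.of fun i j : Fin m => (inner ℝ (v i) (v j) : ℝ)).det
  have hbase : ∀ z z' : M, z = z' → ∀ v : Fin m → EuclideanSpace ℝ (Fin n), G z v = G z' v := by
    rintro z _ rfl v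
    rfl
  have hdet := gram_det_comp (T := TangentSpace (𝓡 n) ((φ ∘ c.symm) (τ u)))
    (mfderiv 𝓘(ℝ, EuclideanSpace ℝ (Fin m)) (𝓡 n) (φ ∘ c.symm) (τ u)).toLinearMap
    (fderiv ℝ τ u).toLinearMap
  rw [chartDensity, chartDensity, ← Real.sqrt_sq_eq_abs, ← Real.sqrt_mul (sq_nonneg _)]
  congr 1
  refine Eq.trans ?_ hdet
  refine (hbase _ ((φ ∘ c.symm) (τ u)) hev.self_of_nhds
    (fun i => mfderiv 𝓘(ℝ, EuclideanSpace ℝ (Fin m)) (𝓡 n) (φ ∘ c'.symm) u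
      (EuclideanSpace.single i 1 : EuclideanSpace ℝ (Fin m)))).trans ?_
  exact congrArg (G ((φ ∘ c.symm) (τ u))) (funext fun i => hmf (EuclideanSpace.single i 1))

/-- The volumes defined by two charts agree on the common domain, by the change of variables
formula. -/
theorem chartVolume_eq_of_subset (φ : L → M) (hφ : MDifferentiable (𝓡 m) (𝓡 n) φ) (x x' : L)
    {A : Set L} (hA : MeasurableSet A) (hx : A ⊆ (extChartAt (𝓡 m) x).source)
    (hx' : A ⊆ (extChartAt (𝓡 m) x').source) :
    chartVolume m n φ x A = chartVolume m n φ x' A := by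
  rw [chartVolume_apply φ x hA, chartVolume_apply φ x' hA]
  set c := extChartAt (𝓡 m) x with hc
  set c' := extChartAt (𝓡 m) x' with hc'
  have himg : c.symm ⁻¹' A ∩ c.target = (fun w => c (c'.symm w)) '' (c'.symm ⁻¹' A ∩ c'.target) := by
    ext u
    constructor
    · rintro ⟨h1, h2⟩
      refine ⟨c' (c.symm u), ⟨?_, c'.map_source (hx' h1)⟩, ?_⟩
      · rw [mem_preimage, c'.left_inv (hx' h1)]; exact h1
      · simp only []
        rw [c'.left_inv (hx' h1), c.right_inv h2]
    · rintro ⟨w, ⟨h1, h2⟩, rfl⟩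
      refine ⟨?_, c.map_source (hx h1)⟩
      simp only [mem_preimage]
      rw [c.left_inv (hx h1)]; exact h1
  rw [himg, lintegral_image_eq_lintegral_abs_det_fderiv_mul volume
    (measurableSet_chart_preimage x' hA)
    (fun w hw => (chartDensity_transition (n := n) φ x x' hw.2 (hx hw.1)
      (hφ _)).1.hasFDerivAt.hasFDerivWithinAt)]
  · refine setLIntegral_congr_fun (measurableSet_chart_preimage x' hA) fun w hw => ?_
    rw [(chartDensity_transition (n := n) φ x x' hw.2 (hx hw.1) (hφ _)).2,
      ENNReal.ofReal_mul (abs_nonneg _)]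
  · intro w hw w' hw' h
    have h1 : c'.symm w = c'.symm w' := by
      rw [← c.left_inv (hx hw.1), ← c.left_inv (hx hw'.1)]
      exact congrArg c.symm h
    rw [← c'.right_inv hw.2, ← c'.right_inv hw'.2, h1]

/-- On the domain of a chart, the induced volume is given by the density in that chart. -/
theorem inducedVolume_restrict_source [SecondCountableTopology L] (φ : L → M)
    (hφ : MDifferentiable (𝓡 m) (𝓡 n) φ) (x : L) :
    (inducedVolume m n φ).restrict (extChartAt (𝓡 m) x).source = chartVolume m n φ x := by
  have hne : Nonempty L := ⟨x⟩
  obtain ⟨T, hT, hTu⟩ := TopologicalSpace.countable_cover_nhds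
    (fun x : L => extChartAt_source_mem_nhds (I := 𝓡 m) x)
  have hTne : T.Nonempty := by
    by_contra h
    rw [not_nonempty_iff_eq_empty] at h
    simp [h] at hTu
    exact (empty_ne_univ hTu).elim
  obtain ⟨t, ht⟩ := hT.exists_eq_range hTne
  refine iSup_restrict_eq_of_agree (fun x => chartVolume m n φ x)
    (fun x => (extChartAt (𝓡 m) x).source)
    (fun x => (isOpen_extChartAt_source x).measurableSet) (fun x => ?_)
    (fun x x' A hA h h' => chartVolume_eq_of_subset φ hφ x x' hA h h') t ?_ x
  · rw [chartVolume_apply φ x (isOpen_extChartAt_source x).measurableSet.compl]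
    have : (extChartAt (𝓡 m) x).symm ⁻¹' (extChartAt (𝓡 m) x).sourceᶜ ∩
        (extChartAt (𝓡 m) x).target = ∅ := by
      ext u
      simp only [mem_inter_iff, mem_preimage, mem_compl_iff, mem_empty_iff_false, iff_false, not_and]
      intro h1 h2
      exact h1 ((extChartAt (𝓡 m) x).map_target h2)
    rw [this]
    simp
  · rw [← hTu, ht]
    simp

end InducedVolume

/-! ### Integrals against the induced volume -/

section InducedVolumeIntegral

variable {m n : ℕ} {L M : Type*}
  [TopologicalSpace L] [ChartedSpace (EuclideanSpace ℝ (Fin m)) L] [IsManifold (𝓡 m) ∞ L]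
  [MeasurableSpace L] [BorelSpace L]
  [TopologicalSpace M] [ChartedSpace (EuclideanSpace ℝ (Fin n)) M] [IsManifold (𝓡 n) ∞ M]
  [RiemannianBundle (fun x : M => TangentSpace (𝓡 n) x)]
  [IsContMDiffRiemannianBundle (𝓡 n) ∞ (EuclideanSpace ℝ (Fin n))
    (fun x : M => TangentSpace (𝓡 n) x)]

theorem continuousOn_chartDensity (φ : L → M) (hφ : ContMDiff (𝓡 m) (𝓡 n) ∞ φ) (x : L) :
    ContinuousOn (chartDensity m n φ x) (extChartAt (𝓡 m) x).target := by
  have hc : ContMDiffOn 𝓘(ℝ, EuclideanSpace ℝ (Fin m)) (𝓡 n) ∞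
      (φ ∘ (extChartAt (𝓡 m) x).symm) (extChartAt (𝓡 m) x).target :=
    hφ.comp_contMDiffOn (contMDiffOn_extChartAt_symm x)
  have hs := fun i : Fin m => contMDiffOn_mfderiv_apply (isOpen_extChartAt_target x) hc
    (EuclideanSpace.single i 1)
  have hin := fun i j => ((hs i).inner_bundle (hs j)).continuousOn
  refine Real.continuous_sqrt.comp_continuousOn ?_
  exact (Continuous.matrix_det (continuous_id' (X := Matrix (Fin m) (Fin m) ℝ))).comp_continuousOn
    (continuousOn_pi.2 fun i => continuousOn_pi.2 fun j => hin i j)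

/-- The induced volume of a smooth map is finite on compact sets. -/
theorem isLocallyFiniteMeasure_inducedVolume [SecondCountableTopology L] (φ : L → M)
    (hφ : ContMDiff (𝓡 m) (𝓡 n) ∞ φ) : IsLocallyFiniteMeasure (inducedVolume m n φ) := by
  refine ⟨fun x => ?_⟩
  set c := extChartAt (𝓡 m) x with hc
  have hT : c.target ∈ 𝓝 (c x) := (isOpen_extChartAt_target x).mem_nhds (mem_extChartAt_target x)
  obtain ⟨r, hr, hrs⟩ := Metric.nhds_basis_closedBall.mem_iff.1 hT
  have hsrc : IsOpen c.source := isOpen_extChartAt_source x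
  have hN : IsOpen (c.source ∩ c ⁻¹' Metric.ball (c x) r) :=
    (continuousOn_extChartAt x).isOpen_inter_preimage hsrc Metric.isOpen_ball
  refine ⟨c.source ∩ c ⁻¹' Metric.ball (c x) r,
    hN.mem_nhds ⟨mem_extChartAt_source x, Metric.mem_ball_self hr⟩, ?_⟩
  have hφd : MDifferentiable (𝓡 m) (𝓡 n) φ := hφ.mdifferentiable (by simp)
  have e : inducedVolume m n φ (c.source ∩ c ⁻¹' Metric.ball (c x) r) =
      chartVolume m n φ x (c.source ∩ c ⁻¹' Metric.ball (c x) r) := by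
    rw [← inducedVolume_restrict_source φ hφd x, Measure.restrict_apply hN.measurableSet]
    congr 1
    exact (inter_eq_left.2 inter_subset_left).symm
  rw [e, chartVolume_apply φ x hN.measurableSet]
  have hint : IntegrableOn (chartDensity m n φ x) (Metric.closedBall (c x) r) volume :=
    ((continuousOn_chartDensity φ hφ x).mono hrs).integrableOn_compact (isCompact_closedBall _ _)
  refine lt_of_le_of_lt (lintegral_mono_set (t := Metric.closedBall (c x) r) ?_) ?_
  · rintro u ⟨⟨h1, h2⟩, h3⟩
    rw [mem_preimage, c.right_inv h3] at h2
    exact Metric.ball_subset_closedBall h2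
  · exact hint.lintegral_lt_top

/-- The integral, with respect to the induced volume, of a function that vanishes outside the
domain of a chart. -/
theorem integral_inducedVolume_eq [SecondCountableTopology L] (φ : L → M)
    (hφ : ContMDiff (𝓡 m) (𝓡 n) ∞ φ) (x : L) (h : L → ℝ) (hm : StronglyMeasurable h)
    (h0 : ∀ y ∉ (extChartAt (𝓡 m) x).source, h y = 0) :
    ∫ y, h y ∂(inducedVolume m n φ) = ∫ u in (extChartAt (𝓡 m) x).target,
      chartDensity m n φ x u * h ((extChartAt (𝓡 m) x).symm u) := by
  have hT := (isOpen_extChartAt_target (I := 𝓡 m) x).measurableSet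
  have hmeas : AEMeasurable (extChartAt (𝓡 m) x).symm
      ((volume.restrict (extChartAt (𝓡 m) x).target).withDensity fun u =>
        ENNReal.ofReal (chartDensity m n φ x u)) :=
    ((continuousOn_extChartAt_symm x).aemeasurable hT).mono_ac (withDensity_absolutelyContinuous _ _)
  rw [← setIntegral_eq_integral_of_forall_compl_eq_zero (s := (extChartAt (𝓡 m) x).source)
    (fun y hy => h0 y hy), inducedVolume_restrict_source φ (hφ.mdifferentiable (by simp)) x,
    chartVolume, integral_map hmeas hm.aestronglyMeasurable]
  rw [integral_withDensity_eq_integral_toReal_smul₀]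
  · refine integral_congr_ae (Filter.Eventually.of_forall fun u => ?_)
    simp only [smul_eq_mul]
    rw [ENNReal.toReal_ofReal (by exact Real.sqrt_nonneg _)]
  · exact ((continuousOn_chartDensity φ hφ x).aemeasurable hT).ennreal_ofReal
  · exact Filter.Eventually.of_forall fun u => ENNReal.ofReal_lt_top

end InducedVolumeIntegral

/-! ### Parametric integrals and integration by parts -/

section ParametricIntegrals

variable {G : Type*} [NormedAddCommGroup G] [NormedSpace ℝ G] [FiniteDimensional ℝ G]
  [MeasurableSpace G] [BorelSpace G] {μ : Measure G} [IsFiniteMeasureOnCompacts μ]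

theorem continuousOn_timeSlice {O : Set (ℝ × G)} {R : ℝ × G → ℝ} (hR : ContinuousOn R O)
    {C : Set G} {t : ℝ} (ht : ∀ u ∈ C, (t, u) ∈ O) : ContinuousOn (fun u => R (t, u)) C :=
  hR.comp (by fun_prop) ht

/-- Differentiation under the integral sign, against a bounded weight with compact support. -/
theorem hasDerivAt_integral_weight {O : Set (ℝ × G)} (hO : IsOpen O) {R : ℝ × G → ℝ}
    (hR : ContDiffOn ℝ 1 R O) {C : Set G} (hC : IsCompact C) {δ : ℝ}
    (hδ : Icc (-δ) δ ×ˢ C ⊆ O) {χ : G → ℝ} (hχm : Measurable χ) {B : ℝ} (hχb : ∀ u, |χ u| ≤ B)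
    (hχ0 : ∀ u ∉ C, χ u = 0) {t : ℝ} (ht : t ∈ Ioo (-δ) δ) :
    HasDerivAt (fun s => ∫ u, χ u * R (s, u) ∂μ)
      (∫ u, χ u * fderiv ℝ R (t, u) (1, 0) ∂μ) t := by
  have hd : ∀ z ∈ O, HasFDerivAt R (fderiv ℝ R z) z := fun z hz =>
    ((hR.contDiffAt (hO.mem_nhds hz)).differentiableAt (by simp)).hasFDerivAt
  have hR' : ContinuousOn (fun z => fderiv ℝ R z (1, 0)) O :=
    (hR.continuousOn_fderiv_of_isOpen hO le_rfl).clm_apply continuousOn_const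
  obtain ⟨D, hD⟩ := (isCompact_Icc.prod hC).exists_bound_of_continuousOn (hR'.mono hδ)
  have hB : 0 ≤ B := (abs_nonneg _).trans (hχb 0)
  have hmeas : ∀ (Q : ℝ × G → ℝ), ContinuousOn Q O → ∀ s ∈ Icc (-δ) δ,
      Integrable (fun u => χ u * Q (s, u)) μ := by
    intro Q hQ s hs
    have hc : IntegrableOn (fun u => Q (s, u)) C μ :=
      (continuousOn_timeSlice hQ fun u hu => hδ ⟨hs, hu⟩).integrableOn_compact hC
    have hi : IntegrableOn (fun u => χ u * Q (s, u)) C μ :=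
      hc.bdd_mul (c := B) hχm.aestronglyMeasurable
        (Filter.Eventually.of_forall fun u => by simpa using hχb u)
    refine (integrableOn_iff_integrable_of_support_subset ?_).1 hi
    intro u hu
    by_contra h
    exact hu (by simp [hχ0 u h])
  refine (hasDerivAt_integral_of_dominated_loc_of_deriv_le (μ := μ)
    (F := fun s u => χ u * R (s, u)) (F' := fun s u => χ u * fderiv ℝ R (s, u) (1, 0))
    (bound := C.indicator fun _ => B * D) (s := Ioo (-δ) δ) (Ioo_mem_nhds ht.1 ht.2) ?_ ?_ ?_ ?_ ?_ ?_).2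
  · filter_upwards [Ioo_mem_nhds ht.1 ht.2] with s hs
    exact (hmeas R hR.continuousOn s (Ioo_subset_Icc_self hs)).aestronglyMeasurable
  · exact hmeas R hR.continuousOn t (Ioo_subset_Icc_self ht)
  · exact (hmeas _ hR' t (Ioo_subset_Icc_self ht)).aestronglyMeasurable
  · refine Filter.Eventually.of_forall fun u s hs => ?_
    by_cases hu : u ∈ C
    · rw [indicator_of_mem hu, norm_mul]
      exact mul_le_mul (by simpa using hχb u) (hD _ ⟨Ioo_subset_Icc_self hs, hu⟩)
        (norm_nonneg _) hB
    · rw [indicator_of_notMem hu, hχ0 u hu]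
      simp
  · exact (integrable_indicator_iff hC.measurableSet).2
      (integrableOn_const hC.measure_lt_top.ne)
  · refine Filter.Eventually.of_forall fun u s hs => ?_
    by_cases hu : u ∈ C
    · have h1 := hd (s, u) (hδ ⟨Ioo_subset_Icc_self hs, hu⟩)
      have h2 : HasDerivAt (fun s : ℝ => (s, u)) ((1 : ℝ), (0 : G)) s :=
        (hasDerivAt_id s).prodMk (hasDerivAt_const s u)
      exact (h1.comp_hasDerivAt s h2).const_mul _
    · simp only [hχ0 u hu, zero_mul]
      exact hasDerivAt_const s 0

/-- Integration by parts: a function supported in a compact subset of the domain of a smooth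
function. -/
theorem integral_mul_fderiv_of_compact_support {μ : Measure G} [μ.IsAddHaarMeasure] {Ω : Set G} (hΩ : IsOpen Ω)
    {Y χ : G → ℝ} (hY : ContDiffOn ℝ 1 Y Ω) (hχ : ContDiffOn ℝ 1 χ Ω) {C : Set G}
    (hC : IsCompact C) (hCΩ : C ⊆ Ω) (hχ0 : ∀ u ∉ C, χ u = 0) (v : G) :
    ∫ u, χ u * fderiv ℝ Y u v ∂μ = -∫ u, fderiv ℝ χ u v * Y u ∂μ := by
  have hχe : ∀ u ∉ C, χ =ᶠ[𝓝 u] fun _ => 0 := fun u hu => by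
    filter_upwards [hC.isClosed.isOpen_compl.mem_nhds hu] with w hw using hχ0 w hw
  have hχd : Differentiable ℝ χ := fun u => by
    by_cases hu : u ∈ C
    · exact (hχ.contDiffAt (hΩ.mem_nhds (hCΩ hu))).differentiableAt (by simp)
    · exact (hχe u hu).differentiableAt_iff.2 (differentiableAt_const _)
  have hint : ∀ h : G → ℝ, ContinuousOn h Ω → (∀ u ∉ C, h u = 0) → Integrable h μ :=
    fun h hc h0 => (integrableOn_iff_integrable_of_support_subset fun u hu => by
      by_contra hn; exact hu (h0 u hn)).1 ((hc.mono hCΩ).integrableOn_compact hC)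
  have hts : tsupport χ ⊆ C := closure_minimal (fun u hu => by
    by_contra hn; exact hu (hχ0 u hn)) hC.isClosed
  have hY' : ContinuousOn (fun u => fderiv ℝ Y u v) Ω :=
    (hY.continuousOn_fderiv_of_isOpen hΩ le_rfl).clm_apply continuousOn_const
  have hχ' : ContinuousOn (fun u => fderiv ℝ χ u v) Ω :=
    (hχ.continuousOn_fderiv_of_isOpen hΩ le_rfl).clm_apply continuousOn_const
  refine integral_mul_fderiv_eq_neg_fderiv_mul_of_integrable
    (hint _ (hχ'.mul hY.continuousOn) fun u hu => ?_)
    (hint _ (hχ.continuousOn.mul hY') fun u hu => by simp [hχ0 u hu])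
    (hint _ (hχ.continuousOn.mul hY.continuousOn) fun u hu => by simp [hχ0 u hu])
    (fun u _ => hχd u)
    (fun u hu => (hY.contDiffAt (hΩ.mem_nhds (hCΩ (hts hu)))).differentiableAt (by simp))
  rw [(hχe u hu).fderiv_eq]
  simp

end ParametricIntegrals

/-! ### Variations in charts -/

section VariationInCharts

/-- A function on the fibres of the tangent bundle takes the same value over equal base points. As
all fibres are definitionally the model space, the vectors need no transport. -/
theorem base_congr {n : ℕ} {M : Type*} [TopologicalSpace M]
    [ChartedSpace (EuclideanSpace ℝ (Fin n)) M] {ι β : Type*}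
    (P : ∀ y : M, (ι → TangentSpace (𝓡 n) y) → β) {y y' : M} (h : y = y')
    (v : ι → EuclideanSpace ℝ (Fin n)) : P y v = P y' v := by
  subst h
  rfl

/-- The derivative of a map into a manifold, computed in the chart around `y₀`. -/
theorem mfderiv_eq_chartFrame {n : ℕ} {M : Type*} [TopologicalSpace M]
    [ChartedSpace (EuclideanSpace ℝ (Fin n)) M] [IsManifold (𝓡 n) ∞ M] {G : Type*}
    [NormedAddCommGroup G] [NormedSpace ℝ G] {ψ : G → M} {u : G} (y₀ : M)
    (hψ : MDifferentiableAt 𝓘(ℝ, G) (𝓡 n) ψ u) (hu : ψ u ∈ (extChartAt (𝓡 n) y₀).source) (w : G) :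
    DifferentiableAt ℝ (fun u => extChartAt (𝓡 n) y₀ (ψ u)) u ∧
    (mfderiv 𝓘(ℝ, G) (𝓡 n) ψ u w : EuclideanSpace ℝ (Fin n)) =
      chartFrame y₀ (extChartAt (𝓡 n) y₀ (ψ u))
        (fderiv ℝ (fun u => extChartAt (𝓡 n) y₀ (ψ u)) u w) := by
  have : IsManifold (𝓡 n) 1 M := IsManifold.of_le (n := ∞) (by simp)
  have hc : MDifferentiableAt (𝓡 n) 𝓘(ℝ, EuclideanSpace ℝ (Fin n)) (extChartAt (𝓡 n) y₀) (ψ u) :=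
    (contMDiffAt_extChartAt' (n := ∞)
      (by rw [← extChartAt_source (𝓡 n)]; exact hu)).mdifferentiableAt (by simp)
  refine ⟨(hc.comp u hψ).differentiableAt, ?_⟩
  have h := mfderivWithin_extChartAt_symm_comp_mfderiv_extChartAt' (I := 𝓡 n) hu
  rw [ModelWithCorners.range_eq_univ, mfderivWithin_univ] at h
  have h2 := mfderiv_comp_apply u hc hψ w
  rw [← mfderiv_eq_fderiv]
  refine (congrArg (fun B => B (mfderiv 𝓘(ℝ, G) (𝓡 n) ψ u w)) h).symm.trans ?_
  exact congrArg (chartFrame y₀ (extChartAt (𝓡 n) y₀ (ψ u))) h2.symm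

variable {m n : ℕ} {L M : Type*}
  [TopologicalSpace L] [ChartedSpace (EuclideanSpace ℝ (Fin m)) L] [IsManifold (𝓡 m) ∞ L]
  [TopologicalSpace M] [ChartedSpace (EuclideanSpace ℝ (Fin n)) M] [IsManifold (𝓡 n) ∞ M]

variable (m n) in
/-- The coordinate expression of a variation in the chart around `x` of the source and the chart
around `y₀` of the target, as a map on space-time. -/
noncomputable def variationInChart (φ : ℝ → L → M) (x : L) (y₀ : M)
    (z : ℝ × EuclideanSpace ℝ (Fin m)) : EuclideanSpace ℝ (Fin n) :=
  extChartAt (𝓡 n) y₀ (φ z.1 ((extChartAt (𝓡 m) x).symm z.2))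

variable (m n) in
/-- The set on which the coordinate expression of a variation is meaningful. -/
def variationDomain (ε : ℝ) (φ : ℝ → L → M) (x : L) (y₀ : M) :
    Set (ℝ × EuclideanSpace ℝ (Fin m)) :=
  {z | (z.1 ∈ Ioo (-ε) ε ∧ z.2 ∈ (extChartAt (𝓡 m) x).target) ∧
    φ z.1 ((extChartAt (𝓡 m) x).symm z.2) ∈ (extChartAt (𝓡 n) y₀).source}

variable {ε : ℝ} {φ : ℝ → L → M}
  (hφ : ContMDiffOn (𝓘(ℝ, ℝ).prod (𝓡 m)) (𝓡 n) ∞ (fun p : ℝ × L => φ p.1 p.2)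
    (Ioo (-ε) ε ×ˢ univ)) (x : L) (y₀ : M)
include hφ

theorem contMDiffOn_variation_chart : ContMDiffOn 𝓘(ℝ, ℝ × EuclideanSpace ℝ (Fin m)) (𝓡 n) ∞
    (fun z : ℝ × EuclideanSpace ℝ (Fin m) => φ z.1 ((extChartAt (𝓡 m) x).symm z.2))
    (Ioo (-ε) ε ×ˢ (extChartAt (𝓡 m) x).target) := by
  have h1 : ContMDiffOn 𝓘(ℝ, ℝ × EuclideanSpace ℝ (Fin m)) 𝓘(ℝ, ℝ) ∞
      (fun z : ℝ × EuclideanSpace ℝ (Fin m) => z.1) (Ioo (-ε) ε ×ˢ (extChartAt (𝓡 m) x).target) :=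
    contDiff_fst.contMDiff.contMDiffOn
  have h2 : ContMDiffOn 𝓘(ℝ, ℝ × EuclideanSpace ℝ (Fin m)) (𝓡 m) ∞
      (fun z : ℝ × EuclideanSpace ℝ (Fin m) => (extChartAt (𝓡 m) x).symm z.2)
      (Ioo (-ε) ε ×ˢ (extChartAt (𝓡 m) x).target) :=
    (contMDiffOn_extChartAt_symm x).comp contDiff_snd.contMDiff.contMDiffOn fun z hz => hz.2
  exact hφ.comp (h1.prodMk h2) fun z hz => ⟨hz.1, mem_univ _⟩

theorem isOpen_variationDomain : IsOpen (variationDomain m n ε φ x y₀) := by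
  have h := (contMDiffOn_variation_chart hφ x).continuousOn
  have := h.isOpen_inter_preimage (isOpen_Ioo.prod (isOpen_extChartAt_target (I := 𝓡 m) x))
    (isOpen_extChartAt_source (I := 𝓡 n) y₀)
  exact this

theorem contDiffOn_variationInChart :
    ContDiffOn ℝ ∞ (variationInChart m n φ x y₀) (variationDomain m n ε φ x y₀) := by
  have h := (contMDiffOn_variation_chart hφ x).mono
    (fun z (hz : z ∈ variationDomain m n ε φ x y₀) => hz.1)
  refine ContMDiffOn.contDiffOn ?_
  refine (contMDiffOn_extChartAt (I := 𝓡 n) (x := y₀) (n := ∞)).comp h fun z hz => ?_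
  rw [mem_preimage, ← extChartAt_source (𝓡 n)]
  exact hz.2

omit hφ in
omit [IsManifold (𝓡 m) ∞ L] [IsManifold (𝓡 n) ∞ M] in
theorem mapsTo_variationInChart : MapsTo (variationInChart m n φ x y₀) (variationDomain m n ε φ x y₀)
    (extChartAt (𝓡 n) y₀).target := fun _ hz => (extChartAt (𝓡 n) y₀).map_source hz.2

omit hφ in
omit [IsManifold (𝓡 m) ∞ L] [IsManifold (𝓡 n) ∞ M] in
theorem symm_variationInChart {z : ℝ × EuclideanSpace ℝ (Fin m)}
    (hz : z ∈ variationDomain m n ε φ x y₀) :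
    (extChartAt (𝓡 n) y₀).symm (variationInChart m n φ x y₀ z) =
      φ z.1 ((extChartAt (𝓡 m) x).symm z.2) := (extChartAt (𝓡 n) y₀).left_inv hz.2

theorem contMDiff_variation_slice {t : ℝ} (ht : t ∈ Ioo (-ε) ε) :
    ContMDiff (𝓡 m) (𝓡 n) ∞ (φ t) := by
  rw [← contMDiffOn_univ]
  exact hφ.comp (contMDiffOn_const.prodMk contMDiffOn_id) fun y _ => ⟨ht, mem_univ _⟩

/-- The spatial derivative of a variation in charts. -/
theorem mfderiv_slice_chart {t : ℝ} {u : EuclideanSpace ℝ (Fin m)}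
    (hz : (t, u) ∈ variationDomain m n ε φ x y₀) (w : EuclideanSpace ℝ (Fin m)) :
    (mfderiv 𝓘(ℝ, EuclideanSpace ℝ (Fin m)) (𝓡 n) (φ t ∘ (extChartAt (𝓡 m) x).symm) u w :
      EuclideanSpace ℝ (Fin n)) = chartFrame y₀ (variationInChart m n φ x y₀ (t, u))
        (fderiv ℝ (variationInChart m n φ x y₀) (t, u) (spaceDir w)) := by
  have hd : MDifferentiableAt 𝓘(ℝ, EuclideanSpace ℝ (Fin m)) (𝓡 n)
      (φ t ∘ (extChartAt (𝓡 m) x).symm) u :=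
    (((contMDiff_variation_slice hφ hz.1.1).comp_contMDiffOn
      (contMDiffOn_extChartAt_symm x)).contMDiffAt
        ((isOpen_extChartAt_target x).mem_nhds hz.1.2)).mdifferentiableAt (by simp)
  refine (mfderiv_eq_chartFrame y₀ hd hz.2 w).2.trans ?_
  have hF := (((contDiffOn_variationInChart hφ x y₀).contDiffAt
    ((isOpen_variationDomain hφ x y₀).mem_nhds hz)).differentiableAt (by simp)).hasFDerivAt
  have h1 : HasFDerivAt (fun y : EuclideanSpace ℝ (Fin m) => (t, y))
      (ContinuousLinearMap.inr ℝ ℝ (EuclideanSpace ℝ (Fin m))) u :=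
    (hasFDerivAt_const t u).prodMk (hasFDerivAt_id (𝕜 := ℝ) u)
  have h2 := (hF.comp u h1).fderiv
  exact congrArg (chartFrame y₀ (variationInChart m n φ x y₀ (t, u))) (congrArg (fun B => B w) h2)

/-- The differential of a slice on the coordinate frame of its source. -/
theorem mfderiv_slice_chartFrame {t : ℝ} {u : EuclideanSpace ℝ (Fin m)}
    (hz : (t, u) ∈ variationDomain m n ε φ x y₀) (w : EuclideanSpace ℝ (Fin m)) :
    (mfderiv (𝓡 m) (𝓡 n) (φ t) ((extChartAt (𝓡 m) x).symm u) (chartFrame x u w) :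
      EuclideanSpace ℝ (Fin n)) = chartFrame y₀ (variationInChart m n φ x y₀ (t, u))
        (fderiv ℝ (variationInChart m n φ x y₀) (t, u) (spaceDir w)) := by
  rw [← mfderiv_slice_chart hφ x y₀ hz w]
  have h1 : MDifferentiableAt 𝓘(ℝ, EuclideanSpace ℝ (Fin m)) (𝓡 m) (extChartAt (𝓡 m) x).symm u :=
    ((contMDiffOn_extChartAt_symm (n := ∞) x u hz.1.2).contMDiffAt
      ((isOpen_extChartAt_target x).mem_nhds hz.1.2)).mdifferentiableAt (by simp)
  exact (mfderiv_comp_apply u (((contMDiff_variation_slice hφ hz.1.1) _).mdifferentiableAt (by simp))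
    h1 w).symm

/-- The time derivative of a variation in charts. -/
theorem mfderiv_time_chart {t : ℝ} {u : EuclideanSpace ℝ (Fin m)}
    (hz : (t, u) ∈ variationDomain m n ε φ x y₀) :
    (mfderiv 𝓘(ℝ, ℝ) (𝓡 n) (fun s => φ s ((extChartAt (𝓡 m) x).symm u)) t (1 : ℝ) :
      EuclideanSpace ℝ (Fin n)) = chartFrame y₀ (variationInChart m n φ x y₀ (t, u))
        (fderiv ℝ (variationInChart m n φ x y₀) (t, u) timeDir) := by
  have hd : MDifferentiableAt 𝓘(ℝ, ℝ) (𝓡 n) (fun s => φ s ((extChartAt (𝓡 m) x).symm u)) t := by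
    have h : ContMDiffOn 𝓘(ℝ, ℝ) (𝓡 n) ∞ (fun s => φ s ((extChartAt (𝓡 m) x).symm u))
        (Ioo (-ε) ε) := hφ.comp (contMDiffOn_id.prodMk contMDiffOn_const) fun s hs => ⟨hs, mem_univ _⟩
    exact (h.contMDiffAt (Ioo_mem_nhds hz.1.1.1 hz.1.1.2)).mdifferentiableAt (by simp)
  refine (mfderiv_eq_chartFrame y₀ hd hz.2 1).2.trans ?_
  have hF := (((contDiffOn_variationInChart hφ x y₀).contDiffAt
    ((isOpen_variationDomain hφ x y₀).mem_nhds hz)).differentiableAt (by simp)).hasFDerivAt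
  have h1 : HasFDerivAt (fun s : ℝ => (s, u))
      (ContinuousLinearMap.inl ℝ ℝ (EuclideanSpace ℝ (Fin m))) t :=
    (hasFDerivAt_id (𝕜 := ℝ) t).prodMk (hasFDerivAt_const u t)
  have h2 := (hF.comp t h1).fderiv
  exact congrArg (chartFrame y₀ (variationInChart m n φ x y₀ (t, u))) (congrArg (fun B => B (1 : ℝ)) h2)

end VariationInCharts

/-! ### The volume density in charts -/

section DensityInCharts

variable {n : ℕ} {L M : Type*}
  [TopologicalSpace L] [ChartedSpace (EuclideanSpace ℝ (Fin 3)) L] [IsManifold (𝓡 3) ∞ L]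
  [MeasurableSpace L] [BorelSpace L]
  [TopologicalSpace M] [ChartedSpace (EuclideanSpace ℝ (Fin n)) M] [IsManifold (𝓡 n) ∞ M]
  [RiemannianBundle (fun x : M => TangentSpace (𝓡 n) x)]

/-- The standard frame of the model space of dimension three. -/
noncomputable def stdFrame (i : Fin 3) : EuclideanSpace ℝ (Fin 3) := EuclideanSpace.single i 1

/-- The density of a variation is the square root of the Gram determinant in charts. -/
theorem chartDensity_eq_gramDet {ε : ℝ} {φ : ℝ → L → M}
    (hφ : ContMDiffOn (𝓘(ℝ, ℝ).prod (𝓡 3)) (𝓡 n) ∞ (fun p : ℝ × L => φ p.1 p.2)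
      (Ioo (-ε) ε ×ˢ univ)) (x : L) (y₀ : M) {t : ℝ} {u : EuclideanSpace ℝ (Fin 3)}
    (hz : (t, u) ∈ variationDomain 3 n ε φ x y₀) :
    chartDensity 3 n (φ t) x u =
      Real.sqrt (gramDet (chartMetric y₀) (variationInChart 3 n φ x y₀) stdFrame (t, u)) := by
  rw [chartDensity]
  congr 1
  let P : ∀ y : M, (Fin 3 → TangentSpace (𝓡 n) y) → ℝ := fun y v =>
    (Matrix.of fun i j : Fin 3 => (inner ℝ (v i) (v j) : ℝ)).det
  refine (base_congr P (symm_variationInChart x y₀ hz).symm (fun i =>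
    mfderiv 𝓘(ℝ, EuclideanSpace ℝ (Fin 3)) (𝓡 n) (φ t ∘ (extChartAt (𝓡 3) x).symm) u
      (stdFrame i))).trans ?_
  exact congrArg (P _) (funext fun i => mfderiv_slice_chart hφ x y₀ hz (stdFrame i))

end DensityInCharts

/-! ### Lagrangian subspaces -/

section LagrangianPlane

variable {E : Type*} [NormedAddCommGroup E] [InnerProductSpace ℝ E] [FiniteDimensional ℝ E]
  [hE : Fact (Module.finrank ℝ E = 3)] (o : Orientation ℝ E (Fin 3))
  {W : Type*} [NormedAddCommGroup W] [NormedSpace ℝ W] {g : W →L[ℝ] W →L[ℝ] ℝ} {J : W →L[ℝ] W}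
  {T : W → W → W → ℝ} {lam : ℝ} (h : IsNearlyKahlerAlgebra g J T lam)
  (hW : Module.finrank ℝ W = 6) (P : E →ₗ[ℝ] W) (hP : ∀ u v, g (P u) (P v) = inner ℝ u v)
  (hω : ∀ u v, g (J (P u)) (P v) = 0) (hT : ∀ u v w, T (P u) (P v) (P w) = 0)
  (hpos : ∀ b : Module.Basis (Fin 3) ℝ E, b.orientation = o →
    0 < T (P (b 0)) (P (b 1)) (J (P (b 2))))
include h hW hP hω hT hpos

/-- For a Lagrangian subspace of canonical orientation, the contraction of `T` with a vector `x`
restricts to a multiple of the Hodge dual of the restriction of `x ⌟ ω`. -/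
theorem torsion_contraction_eq_hodgeStar {x : W} {θ : E →L[ℝ] ℝ} (hθ : ∀ u, θ u = g (J x) (P u))
    (u v : E) : T x (P u) (P v) = -lam * hodgeStar o θ ![u, v] := by
  have hQ := h.toIsTypeThreeZero
  let B : E →ₗ[ℝ] E →ₗ[ℝ] ℝ := LinearMap.mk₂ ℝ (fun u v => T x (P u) (P v))
    (fun u u' v => by rw [map_add, (hQ.linear₂ x (P v)).map_add])
    (fun c u v => by rw [map_smul, (hQ.linear₂ x (P v)).map_smul])
    (fun u v v' => by rw [map_add, (hQ.linear x (P u)).map_add])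
    (fun c u v => by rw [map_smul, (hQ.linear x (P u)).map_smul])
  obtain ⟨W', hW'⟩ := exists_dual_vector o B fun u => hQ.self₂₃ x (P u)
  have hB : ∀ u v, T x (P u) (P v) = o.volumeForm ![W', u, v] := hW'
  let e := o.finOrthonormalBasis (by norm_num) hE.out
  have he : e.toBasis.orientation = o := o.finOrthonormalBasis_orientation _ _
  have he1 : o.volumeForm e = 1 := by
    rw [o.volumeForm_robust e he, ← OrthonormalBasis.coe_toBasis, Module.Basis.det_self]
  have hin : ∀ i j, g (P (e i)) (P (e j)) = if i = j then 1 else 0 := fun i j => by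
    rw [hP, orthonormal_iff_ite.1 e.orthonormal]
  have hp := hpos e.toBasis he
  simp only [OrthonormalBasis.coe_toBasis] at hp
  have hrot : ∀ a b c : E, T (P a) (P b) (J (P c)) = T (P b) (P c) (J (P a)) := fun a b c => by
    rw [hQ.rotate, hQ.move_J]
  have hc : ∀ i : Fin 3, T x (P (e (i + 1))) (P (e (i + 2))) = -lam * θ (e i) := by
    intro i
    rw [hθ]
    have hinj : ∀ a b : Fin 3, (a + (i + 1) = b + (i + 1)) ↔ a = b := fun a b => add_left_inj _
    have key := h.cross_of_lagrangian hW (u := fun k => P (e (k + (i + 1))))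
      (fun a b => by simp only [hin, hinj]) (fun a b => hω _ _) (hT _ _ _) (by
        fin_cases i
        · simpa using hp.trans_eq (hrot (e 0) (e 1) (e 2))
        · simpa using hp.trans_eq ((hrot (e 0) (e 1) (e 2)).trans (hrot (e 1) (e 2) (e 0)))
        · simpa using hp) x
    have e0 : (0 : Fin 3) + (i + 1) = i + 1 := zero_add _
    have e1 : (1 : Fin 3) + (i + 1) = i + 2 := by fin_cases i <;> rfl
    have e2 : (2 : Fin 3) + (i + 1) = i := by fin_cases i <;> rfl
    simp only [e0, e1, e2] at key
    exact key
  -- By Cramer's rule `W'` has the components `-λ θ(eᵢ)` in the orthonormal basis `e`, and `w` has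
  -- the components `θ(eᵢ)`.
  set w := (InnerProductSpace.toDual ℝ E).symm θ with hw
  have hWw : W' = -lam • w := by
    have h1 := sum_volumeForm_smul o e W'
    rw [he1, one_smul] at h1
    have h2 : w = ∑ i, θ (e i) • e i := by
      conv_lhs => rw [← e.sum_repr w]
      refine Finset.sum_congr rfl fun i _ => ?_
      rw [e.repr_apply_apply, real_inner_comm, hw, InnerProductSpace.toDual_symm_apply]
    rw [← h1, h2, Finset.smul_sum]
    refine Finset.sum_congr rfl fun i _ => ?_
    rw [← hB, hc, smul_smul]
  rw [hB, hodgeStar_apply, hWw]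
  exact o.volumeForm.map_vecCons_smul ![u, v] (-lam) w

/-- The form `T(·, ·, J ·)` restricts to a multiple of the volume form on a Lagrangian subspace of
canonical orientation. -/
theorem starTorsion_eq_volumeForm (v : Fin 3 → E) :
    T (P (v 0)) (P (v 1)) (J (P (v 2))) = lam * o.volumeForm v := by
  have hQ := h.toIsTypeThreeZero
  -- For `x = J (P (v 2))` the restriction of `x ⌟ ω` is the dual of `-v 2`.
  have key := torsion_contraction_eq_hodgeStar o h hW P hP hω hT hpos (x := J (P (v 2)))
    (θ := -innerSL ℝ (v 2)) (fun u => by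
      rw [h.J_J]
      simp [hP]) (v 0) (v 1)
  rw [hQ.rotate, hQ.rotate, key, hodgeStar_apply, map_neg]
  have e1 : (InnerProductSpace.toDual ℝ E).symm (innerSL ℝ (v 2)) = v 2 :=
    (InnerProductSpace.toDual ℝ E).symm_apply_apply (v 2)
  rw [e1]
  have e2 := o.volumeForm.map_vecCons_smul ![v 0, v 1] (-1) (v 2)
  rw [neg_one_smul] at e2
  rw [e2]
  have e3 : ![v 2, v 0, v 1] = v ∘ (finRotate 3).symm := by
    ext i
    fin_cases i <;> rfl
  have e4 := o.volumeForm.map_perm v (finRotate 3).symm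
  rw [e3, e4, Equiv.Perm.sign_symm, sign_finRotate]
  simp

end LagrangianPlane

/-! ### Tangent vectors and velocity of a variation in charts -/

section SliceGeometry

variable {M : Type*} [TopologicalSpace M] [ChartedSpace (EuclideanSpace ℝ (Fin 6)) M]
  [IsManifold (𝓡 6) ∞ M] [RiemannianBundle (fun x : M => TangentSpace (𝓡 6) x)]
  [IsContMDiffRiemannianBundle (𝓡 6) ∞ (EuclideanSpace ℝ (Fin 6))
    (fun x : M => TangentSpace (𝓡 6) x)]
  {A : AlmostHermitianStructure 6 M} {lam : ℝ}
  {L : Type*} [TopologicalSpace L] [ChartedSpace (EuclideanSpace ℝ (Fin 3)) L]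
  [IsManifold (𝓡 3) ∞ L]
  {ε : ℝ} {φ : ℝ → L → M}
  (hφ : ContMDiffOn (𝓘(ℝ, ℝ).prod (𝓡 3)) (𝓡 6) ∞ (fun p : ℝ × L => φ p.1 p.2)
    (Ioo (-ε) ε ×ˢ univ))
  (x : L) (y₀ : M)

section AllTimes

variable {t : ℝ} {u : EuclideanSpace ℝ (Fin 3)} (hz : (t, u) ∈ variationDomain 3 6 ε φ x y₀)
include hφ hz

/-- The form `-Im Φ`, evaluated on the velocity and on two tangent vectors of a slice. -/
theorem imPhi_slice_chart (w w' : EuclideanSpace ℝ (Fin 3)) :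
    -imPhi A lam (φ t ((extChartAt (𝓡 3) x).symm u))
      (mfderiv 𝓘(ℝ, ℝ) (𝓡 6) (fun s => φ s ((extChartAt (𝓡 3) x).symm u)) t (1 : ℝ))
      (mfderiv (𝓡 3) (𝓡 6) (φ t) ((extChartAt (𝓡 3) x).symm u) (chartFrame x u w))
      (mfderiv (𝓡 3) (𝓡 6) (φ t) ((extChartAt (𝓡 3) x).symm u) (chartFrame x u w')) =
    lam⁻¹ * pullThree (starTorsionForm (chartMetric y₀) (chartJ A y₀)) (variationInChart 3 6 φ x y₀)
      timeDir (spaceDir w) (spaceDir w') (t, u) := by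
  have h1 := mfderiv_time_chart hφ x y₀ hz
  have h2 := mfderiv_slice_chartFrame hφ x y₀ hz w
  have h3 := mfderiv_slice_chartFrame hφ x y₀ hz w'
  let P : ∀ y : M, (Fin 3 → TangentSpace (𝓡 6) y) → ℝ := fun y v =>
    imPhi A lam y (v 0) (v 1) (v 2)
  have key := imPhi_chart A lam y₀ (mapsTo_variationInChart x y₀ hz)
    (fderiv ℝ (variationInChart 3 6 φ x y₀) (t, u) timeDir)
    (fderiv ℝ (variationInChart 3 6 φ x y₀) (t, u) (spaceDir w))
    (fderiv ℝ (variationInChart 3 6 φ x y₀) (t, u) (spaceDir w'))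
  have e := base_congr P (symm_variationInChart x y₀ hz) ![
    chartFrame y₀ (variationInChart 3 6 φ x y₀ (t, u))
      (fderiv ℝ (variationInChart 3 6 φ x y₀) (t, u) timeDir),
    chartFrame y₀ (variationInChart 3 6 φ x y₀ (t, u))
      (fderiv ℝ (variationInChart 3 6 φ x y₀) (t, u) (spaceDir w)),
    chartFrame y₀ (variationInChart 3 6 φ x y₀ (t, u))
      (fderiv ℝ (variationInChart 3 6 φ x y₀) (t, u) (spaceDir w'))]
  have e2 := congrArg (P (φ t ((extChartAt (𝓡 3) x).symm u)))
    (show (![mfderiv 𝓘(ℝ, ℝ) (𝓡 6) (fun s => φ s ((extChartAt (𝓡 3) x).symm u)) t (1 : ℝ),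
      mfderiv (𝓡 3) (𝓡 6) (φ t) ((extChartAt (𝓡 3) x).symm u) (chartFrame x u w),
      mfderiv (𝓡 3) (𝓡 6) (φ t) ((extChartAt (𝓡 3) x).symm u) (chartFrame x u w')] :
        Fin 3 → EuclideanSpace ℝ (Fin 6)) = _ by rw [h1, h2, h3])
  have e3 := (e2.trans e.symm).trans key
  have e4 := congrArg (fun r : ℝ => -r) e3
  refine e4.trans ?_
  rw [pullThree, neg_neg, div_eq_inv_mul]

end AllTimes

variable {u : EuclideanSpace ℝ (Fin 3)} (hz : (0, u) ∈ variationDomain 3 6 ε φ x y₀)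
include hφ hz

/-- `-Im Φ` on three tangent vectors of the initial slice. -/
theorem imPhi_initial_chart (w : Fin 3 → EuclideanSpace ℝ (Fin 3)) :
    -imPhi A lam (φ 0 ((extChartAt (𝓡 3) x).symm u))
      (mfderiv (𝓡 3) (𝓡 6) (φ 0) ((extChartAt (𝓡 3) x).symm u) (chartFrame x u (w 0)))
      (mfderiv (𝓡 3) (𝓡 6) (φ 0) ((extChartAt (𝓡 3) x).symm u) (chartFrame x u (w 1)))
      (mfderiv (𝓡 3) (𝓡 6) (φ 0) ((extChartAt (𝓡 3) x).symm u) (chartFrame x u (w 2))) =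
    lam⁻¹ * sliceTop (starTorsionForm (chartMetric y₀) (chartJ A y₀))
      (variationInChart 3 6 φ x y₀) w (0, u) := by
  have h1 := fun i => mfderiv_slice_chartFrame hφ x y₀ hz (w i)
  let P : ∀ y : M, (Fin 3 → TangentSpace (𝓡 6) y) → ℝ := fun y v =>
    imPhi A lam y (v 0) (v 1) (v 2)
  have key := imPhi_chart A lam y₀ (mapsTo_variationInChart x y₀ hz)
    (fderiv ℝ (variationInChart 3 6 φ x y₀) (0, u) (spaceDir (w 0)))
    (fderiv ℝ (variationInChart 3 6 φ x y₀) (0, u) (spaceDir (w 1)))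
    (fderiv ℝ (variationInChart 3 6 φ x y₀) (0, u) (spaceDir (w 2)))
  have e := base_congr P (symm_variationInChart x y₀ hz) fun i =>
    chartFrame y₀ (variationInChart 3 6 φ x y₀ (0, u))
      (fderiv ℝ (variationInChart 3 6 φ x y₀) (0, u) (spaceDir (w i)))
  have e2 := congrArg (P (φ 0 ((extChartAt (𝓡 3) x).symm u))) (funext h1)
  have e4 := congrArg (fun r : ℝ => -r) ((e2.trans e.symm).trans key)
  refine e4.trans ?_
  rw [sliceTop, pullThree, neg_neg, div_eq_inv_mul]

/-- The pairing of the velocity with a tangent vector of the initial slice. -/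
theorem lOmega_chart {V : ∀ y : L, TangentSpace (𝓡 6) (φ 0 y)}
    (hV : ∀ y, V y = mfderiv 𝓘(ℝ, ℝ) (𝓡 6) (fun t => φ t y) 0 (1 : ℝ))
    (w : EuclideanSpace ℝ (Fin 3)) :
    lOmega A (φ 0) V ((extChartAt (𝓡 3) x).symm u) (chartFrame x u w) =
      pullTwo (kahlerForm (chartMetric y₀) (chartJ A y₀)) (variationInChart 3 6 φ x y₀) timeDir
        (spaceDir w) (0, u) := by
  have h1 := (hV _).trans (mfderiv_time_chart hφ x y₀ hz)
  have h2 := mfderiv_slice_chartFrame hφ x y₀ hz w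
  let P : ∀ y : M, (Fin 2 → TangentSpace (𝓡 6) y) → ℝ := fun y v => A.omega y v
  have key := omega_chart A y₀ (mapsTo_variationInChart x y₀ hz)
    ![fderiv ℝ (variationInChart 3 6 φ x y₀) (0, u) timeDir,
      fderiv ℝ (variationInChart 3 6 φ x y₀) (0, u) (spaceDir w)]
  have e := base_congr P (symm_variationInChart x y₀ hz) fun i =>
    chartFrame y₀ (variationInChart 3 6 φ x y₀ (0, u))
      (![fderiv ℝ (variationInChart 3 6 φ x y₀) (0, u) timeDir,
      fderiv ℝ (variationInChart 3 6 φ x y₀) (0, u) (spaceDir w)] i)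
  have e2 := congrArg (P (φ 0 ((extChartAt (𝓡 3) x).symm u)))
    (show (![V ((extChartAt (𝓡 3) x).symm u),
      mfderiv (𝓡 3) (𝓡 6) (φ 0) ((extChartAt (𝓡 3) x).symm u) (chartFrame x u w)] :
        Fin 2 → EuclideanSpace ℝ (Fin 6)) = fun i =>
      chartFrame y₀ (variationInChart 3 6 φ x y₀ (0, u))
      (![fderiv ℝ (variationInChart 3 6 φ x y₀) (0, u) timeDir,
      fderiv ℝ (variationInChart 3 6 φ x y₀) (0, u) (spaceDir w)] i) by
        funext i
        fin_cases i
        · exact h1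
        · exact h2)
  exact (e2.trans e.symm).trans key

variable [RiemannianBundle (fun x : L => TangentSpace (𝓡 3) x)] (hL : IsLagrangian A (φ 0))
include hL

/-- The initial slice is isometric, in charts. -/
theorem inner_initial_chart (w w' : EuclideanSpace ℝ (Fin 3)) :
    pullTwo (chartMetric y₀) (variationInChart 3 6 φ x y₀) (spaceDir w) (spaceDir w') (0, u) =
      inner ℝ (chartFrame x u w) (chartFrame x u w') := by
  let P : ∀ y : M, (Fin 2 → TangentSpace (𝓡 6) y) → ℝ := fun y v => inner ℝ (v 0) (v 1)
  have e := base_congr P (symm_variationInChart x y₀ hz) fun i =>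
    chartFrame y₀ (variationInChart 3 6 φ x y₀ (0, u))
      (fderiv ℝ (variationInChart 3 6 φ x y₀) (0, u) (spaceDir (![w, w'] i)))
  have e2 := congrArg (P (φ 0 ((extChartAt (𝓡 3) x).symm u)))
    (funext fun i => mfderiv_slice_chartFrame hφ x y₀ hz (![w, w'] i))
  exact (e.trans e2.symm).trans (hL.isometric _ _ _)

/-- The initial slice is Lagrangian, in charts. -/
theorem kahlerForm_initial_chart (w w' : EuclideanSpace ℝ (Fin 3)) :
    pullTwo (kahlerForm (chartMetric y₀) (chartJ A y₀)) (variationInChart 3 6 φ x y₀)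
      (spaceDir w) (spaceDir w') (0, u) = 0 := by
  let P : ∀ y : M, (Fin 2 → TangentSpace (𝓡 6) y) → ℝ := fun y v => A.omega y v
  have key := omega_chart A y₀ (mapsTo_variationInChart x y₀ hz)
    fun i => fderiv ℝ (variationInChart 3 6 φ x y₀) (0, u) (spaceDir (![w, w'] i))
  have e := base_congr P (symm_variationInChart x y₀ hz) fun i =>
    chartFrame y₀ (variationInChart 3 6 φ x y₀ (0, u))
      (fderiv ℝ (variationInChart 3 6 φ x y₀) (0, u) (spaceDir (![w, w'] i)))
  have e2 := congrArg (P (φ 0 ((extChartAt (𝓡 3) x).symm u)))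
    (funext fun i => mfderiv_slice_chartFrame hφ x y₀ hz (![w, w'] i))
  refine ((key.symm.trans e).trans e2.symm).trans ?_
  refine Eq.trans ?_ (hL.lagrangian ((extChartAt (𝓡 3) x).symm u) (chartFrame x u w)
    (chartFrame x u w'))
  refine congrArg (A.omega (φ 0 ((extChartAt (𝓡 3) x).symm u))) (funext fun i => ?_)
  fin_cases i <;> rfl

end SliceGeometry

/-! ### The torsion form on the initial slice -/

section SliceTorsion

variable {M : Type*} [TopologicalSpace M] [ChartedSpace (EuclideanSpace ℝ (Fin 6)) M]
  [IsManifold (𝓡 6) ∞ M] [RiemannianBundle (fun x : M => TangentSpace (𝓡 6) x)]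
  [IsContMDiffRiemannianBundle (𝓡 6) ∞ (EuclideanSpace ℝ (Fin 6))
    (fun x : M => TangentSpace (𝓡 6) x)]
  {A : AlmostHermitianStructure 6 M} {lam : ℝ} (hA : IsStrictNearlyKahlerOfConstantType A lam)
  {L : Type*} [TopologicalSpace L] [ChartedSpace (EuclideanSpace ℝ (Fin 3)) L]
  [IsManifold (𝓡 3) ∞ L] [RiemannianBundle (fun x : L => TangentSpace (𝓡 3) x)]
  {ε : ℝ} {φ : ℝ → L → M}
  (hφ : ContMDiffOn (𝓘(ℝ, ℝ).prod (𝓡 3)) (𝓡 6) ∞ (fun p : ℝ × L => φ p.1 p.2)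
    (Ioo (-ε) ε ×ˢ univ))
  (hL : IsLagrangian A (φ 0)) {o : ∀ x : L, Orientation ℝ (TangentSpace (𝓡 3) x) (Fin 3)}
  (ho : IsCanonicalOrientation A lam (φ 0) o)
  (x : L) (y₀ : M) {u : EuclideanSpace ℝ (Fin 3)} (hz : (0, u) ∈ variationDomain 3 6 ε φ x y₀)

/-- The derivative of the initial immersion, in the chart of the target only. -/
noncomputable def initialDifferential (φ : ℝ → L → M) (x : L) (y₀ : M)
    (u : EuclideanSpace ℝ (Fin 3)) :
    TangentSpace (𝓡 3) ((extChartAt (𝓡 3) x).symm u) →ₗ[ℝ] EuclideanSpace ℝ (Fin 6) :=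
  ((fderiv ℝ (variationInChart 3 6 φ x y₀) (0, u)).comp
    ((ContinuousLinearMap.inr ℝ ℝ (EuclideanSpace ℝ (Fin 3))).comp
      (chartCoframe x u))).toLinearMap

theorem initialDifferential_chartFrame (hu : u ∈ (extChartAt (𝓡 3) x).target)
    (w : EuclideanSpace ℝ (Fin 3)) : initialDifferential φ x y₀ u (chartFrame x u w) =
      fderiv ℝ (variationInChart 3 6 φ x y₀) (0, u) (spaceDir w) := by
  have := chartCoframe_chartFrame x hu w
  exact congrArg (fun w => fderiv ℝ (variationInChart 3 6 φ x y₀) (0, u) (spaceDir w)) this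

include hφ hz hL

theorem sliceForm_initial_eq_zero (b : Fin 3 → EuclideanSpace ℝ (Fin 3))
    (w : EuclideanSpace ℝ (Fin 3)) (hw : (0, w) ∈ variationDomain 3 6 ε φ x y₀) (i : Fin 3) :
    sliceForm (kahlerForm (chartMetric y₀) (chartJ A y₀)) (variationInChart 3 6 φ x y₀) b i (0, w)
      = 0 := kahlerForm_initial_chart hφ x y₀ hw hL _ _

theorem inner_initialDifferential (v v' : TangentSpace (𝓡 3) ((extChartAt (𝓡 3) x).symm u)) :
    chartMetric y₀ (variationInChart 3 6 φ x y₀ (0, u)) (initialDifferential φ x y₀ u v)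
      (initialDifferential φ x y₀ u v') = inner ℝ v v' := by
  have h := inner_initial_chart hφ x y₀ hz hL (chartCoframe x u v) (chartCoframe x u v')
  rw [chartFrame_chartCoframe x (p := u) hz.1.2, chartFrame_chartCoframe x (p := u) hz.1.2] at h
  exact h

include hA

/-- `T = dω / 3` vanishes on the initial slice. -/
theorem torsionForm_initial_eq_zero (v₀ v₁ v₂ : EuclideanSpace ℝ (Fin 3)) :
    torsionForm (chartMetric y₀) (chartJ A y₀) (variationInChart 3 6 φ x y₀ (0, u))
      (fderiv ℝ (variationInChart 3 6 φ x y₀) (0, u) (spaceDir v₀))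
      (fderiv ℝ (variationInChart 3 6 φ x y₀) (0, u) (spaceDir v₁))
      (fderiv ℝ (variationInChart 3 6 φ x y₀) (0, u) (spaceDir v₂)) = 0 :=
  sliceTop_torsionForm_eq_zero (isOpen_variationDomain hφ x y₀)
    (contDiffOn_variationInChart hφ x y₀) (mapsTo_variationInChart x y₀)
    (isLocalNearlyKahler_chart A hA y₀) ![v₀, v₁, v₂] hz
    fun w hw i => sliceForm_initial_eq_zero hφ hL x y₀ hw _ w hw i

include ho

/-- The canonical orientation, in charts. -/
theorem starTorsionForm_pos
    (b : Module.Basis (Fin 3) ℝ (TangentSpace (𝓡 3) ((extChartAt (𝓡 3) x).symm u)))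
    (hb : b.orientation = o ((extChartAt (𝓡 3) x).symm u)) :
    0 < torsionForm (chartMetric y₀) (chartJ A y₀) (variationInChart 3 6 φ x y₀ (0, u))
      (initialDifferential φ x y₀ u (b 0)) (initialDifferential φ x y₀ u (b 1))
      (chartJ A y₀ (variationInChart 3 6 φ x y₀ (0, u)) (initialDifferential φ x y₀ u (b 2))) := by
  have h1 := ho _ b hb
  have h2 := imPhi_initial_chart (A := A) (lam := lam) hφ x y₀ hz
    fun i => chartCoframe x u (b i)
  simp only [chartFrame_chartCoframe x hz.1.2] at h2
  rw [h2] at h1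
  have hl := (isLocalNearlyKahler_chart A hA y₀).lam_pos
  exact (mul_pos_iff_of_pos_left (inv_pos.2 hl)).1 h1

/-- The contraction of `T` with the velocity restricts to a multiple of `*θ`. -/
theorem torsion_contraction_initial {V : ∀ y : L, TangentSpace (𝓡 6) (φ 0 y)}
    (hV : ∀ y, V y = mfderiv 𝓘(ℝ, ℝ) (𝓡 6) (fun t => φ t y) 0 (1 : ℝ))
    (w w' : EuclideanSpace ℝ (Fin 3)) :
    pullThree (torsionForm (chartMetric y₀) (chartJ A y₀)) (variationInChart 3 6 φ x y₀) timeDir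
      (spaceDir w) (spaceDir w') (0, u) =
    -lam * starLOmega A (φ 0) o V ((extChartAt (𝓡 3) x).symm u)
      ![chartFrame x u w, chartFrame x u w'] := by
  have key := torsion_contraction_eq_hodgeStar (o ((extChartAt (𝓡 3) x).symm u))
    ((isLocalNearlyKahler_chart A hA y₀).algebra (mapsTo_variationInChart x y₀ hz))
    finrank_euclideanSpace_fin (initialDifferential φ x y₀ u)
    (fun v v' => inner_initialDifferential hφ hL x y₀ hz v v')
    (fun v v' => kahlerForm_initial_chart hφ x y₀ hz hL _ _)
    (fun v v' v'' => torsionForm_initial_eq_zero hA hφ hL x y₀ hz _ _ _)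
    (starTorsionForm_pos hA hφ hL ho x y₀ hz)
    (x := fderiv ℝ (variationInChart 3 6 φ x y₀) (0, u) timeDir)
    (θ := lOmega A (φ 0) V ((extChartAt (𝓡 3) x).symm u))
    (fun v => by
      have := lOmega_chart (A := A) hφ x y₀ hz hV (chartCoframe x u v)
      rw [chartFrame_chartCoframe x hz.1.2] at this
      exact this) (chartFrame x u w) (chartFrame x u w')
  rw [initialDifferential_chartFrame x y₀ hz.1.2, initialDifferential_chartFrame x y₀ hz.1.2] at key
  exact key

/-- The initial slice is calibrated: `S = T(·, ·, J ·)` restricts to `λ` times its volume form. -/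
theorem sliceTop_starTorsionForm_initial (w : Fin 3 → EuclideanSpace ℝ (Fin 3)) :
    sliceTop (starTorsionForm (chartMetric y₀) (chartJ A y₀)) (variationInChart 3 6 φ x y₀) w (0, u) =
      lam * (o ((extChartAt (𝓡 3) x).symm u)).volumeForm fun i => chartFrame x u (w i) := by
  have key := starTorsion_eq_volumeForm (o ((extChartAt (𝓡 3) x).symm u))
    ((isLocalNearlyKahler_chart A hA y₀).algebra (mapsTo_variationInChart x y₀ hz))
    finrank_euclideanSpace_fin (initialDifferential φ x y₀ u)
    (fun v v' => inner_initialDifferential hφ hL x y₀ hz v v')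
    (fun v v' => kahlerForm_initial_chart hφ x y₀ hz hL _ _)
    (fun v v' v'' => torsionForm_initial_eq_zero hA hφ hL x y₀ hz _ _ _)
    (starTorsionForm_pos hA hφ hL ho x y₀ hz) fun i => chartFrame x u (w i)
  rw [initialDifferential_chartFrame x y₀ hz.1.2, initialDifferential_chartFrame x y₀ hz.1.2,
    initialDifferential_chartFrame x y₀ hz.1.2] at key
  exact key

end SliceTorsion

/-! ### Exterior derivatives on the initial slice -/

section SliceExteriorDerivatives

variable {M : Type*} [TopologicalSpace M] [ChartedSpace (EuclideanSpace ℝ (Fin 6)) M]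
  [IsManifold (𝓡 6) ∞ M] [RiemannianBundle (fun x : M => TangentSpace (𝓡 6) x)]
  [IsContMDiffRiemannianBundle (𝓡 6) ∞ (EuclideanSpace ℝ (Fin 6))
    (fun x : M => TangentSpace (𝓡 6) x)]
  {A : AlmostHermitianStructure 6 M} {lam : ℝ} (hA : IsStrictNearlyKahlerOfConstantType A lam)
  {L : Type*} [TopologicalSpace L] [ChartedSpace (EuclideanSpace ℝ (Fin 3)) L]
  [IsManifold (𝓡 3) ∞ L] [RiemannianBundle (fun x : L => TangentSpace (𝓡 3) x)]
  {ε : ℝ} {φ : ℝ → L → M}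
  (hφ : ContMDiffOn (𝓘(ℝ, ℝ).prod (𝓡 3)) (𝓡 6) ∞ (fun p : ℝ × L => φ p.1 p.2)
    (Ioo (-ε) ε ×ˢ univ))
  (hL : IsLagrangian A (φ 0)) {o : ∀ x : L, Orientation ℝ (TangentSpace (𝓡 3) x) (Fin 3)}
  (ho : IsCanonicalOrientation A lam (φ 0) o)
  {V : ∀ y : L, TangentSpace (𝓡 6) (φ 0 y)}
  (hV : ∀ y, V y = mfderiv 𝓘(ℝ, ℝ) (𝓡 6) (fun t => φ t y) 0 (1 : ℝ))
  (x : L) (y₀ : M) {u : EuclideanSpace ℝ (Fin 3)} (hz : (0, u) ∈ variationDomain 3 6 ε φ x y₀)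

/-- A function on space-time that is smooth near the initial slice, restricted to that slice. -/
theorem contDiffOn_initialSlice {Y : Type*} [NormedAddCommGroup Y] [NormedSpace ℝ Y]
    {O : Set (ℝ × Y)} {h : ℝ × Y → ℝ} (hh : ContDiffOn ℝ ∞ h O) :
    ContDiffOn ℝ ∞ (fun q => h (0, q)) {q | (0, q) ∈ O} :=
  hh.comp (contDiff_const.prodMk contDiff_id).contDiffOn fun _ hq => hq

theorem isOpen_initialSlice {Y : Type*} [NormedAddCommGroup Y] [NormedSpace ℝ Y]
    {O : Set (ℝ × Y)} (hO : IsOpen O) : IsOpen {q : Y | ((0 : ℝ), q) ∈ O} :=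
  hO.preimage (by fun_prop)

include hA hφ hz

/-- The exterior derivative of `θ = L_ω(V)`, the restriction of the contraction of `ω` with the
velocity. -/
theorem dOne_lOmega_chart (hV : ∀ y, V y = mfderiv 𝓘(ℝ, ℝ) (𝓡 6) (fun t => φ t y) 0 (1 : ℝ))
    (w w' : EuclideanSpace ℝ (Fin 3)) :
    dOne (lOmega A (φ 0) V) ((extChartAt (𝓡 3) x).symm u) ![chartFrame x u w, chartFrame x u w'] =
      fderiv ℝ (pullTwo (kahlerForm (chartMetric y₀) (chartJ A y₀)) (variationInChart 3 6 φ x y₀)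
        timeDir (spaceDir w')) (0, u) (spaceDir w) -
      fderiv ℝ (pullTwo (kahlerForm (chartMetric y₀) (chartJ A y₀)) (variationInChart 3 6 φ x y₀)
        timeDir (spaceDir w)) (0, u) (spaceDir w') := by
  have hO := isOpen_variationDomain hφ x y₀
  have hθ := fun w : EuclideanSpace ℝ (Fin 3) => contDiffOn_pullTwo hO
    (contDiffOn_variationInChart hφ x y₀) (mapsTo_variationInChart x y₀)
    (isLocalNearlyKahler_chart A hA y₀).smooth_kahlerForm timeDir (spaceDir w)
  have hΩ := isOpen_initialSlice hO
  have hev : ∀ᶠ q in 𝓝 u, (0, q) ∈ variationDomain 3 6 ε φ x y₀ := hΩ.mem_nhds hz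
  let η : ∀ y : L, TangentSpace (𝓡 3) y [⋀^Fin 1]→L[ℝ] ℝ := fun y =>
    ContinuousAlternatingMap.ofSubsingleton ℝ _ _ (0 : Fin 1) (lOmega A (φ 0) V y)
  have hη : DifferentiableAt ℝ (formInChart η x) u := by
    have h : ContDiffOn ℝ ∞ (formInChart η x) {q | (0, q) ∈ variationDomain 3 6 ε φ x y₀} :=
      contDiffOn_alternating fun v => (contDiffOn_initialSlice (hθ (v 0))).congr fun q hq =>
        lOmega_chart hφ x y₀ hq hV (v 0)
    exact (h.contDiffAt (hΩ.mem_nhds hz)).differentiableAt (by simp)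
  have key := dForm_chart η x hz.1.2 hη ![w, w']
  have hd : ∀ a b : EuclideanSpace ℝ (Fin 3), fderiv ℝ (fun q => lOmega A (φ 0) V
      ((extChartAt (𝓡 3) x).symm q) (chartFrame x q a)) u b =
      fderiv ℝ (pullTwo (kahlerForm (chartMetric y₀) (chartJ A y₀)) (variationInChart 3 6 φ x y₀)
        timeDir (spaceDir a)) (0, u) (spaceDir b) := by
    intro a b
    rw [fderiv_spaceDir (((hθ a).contDiffAt (hO.mem_nhds hz)).differentiableAt (by simp))]
    have e : (fun q => lOmega A (φ 0) V ((extChartAt (𝓡 3) x).symm q) (chartFrame x q a)) =ᶠ[𝓝 u]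
        fun q => pullTwo (kahlerForm (chartMetric y₀) (chartJ A y₀)) (variationInChart 3 6 φ x y₀)
        timeDir (spaceDir a) (0, q) := by
      filter_upwards [hev] with q hq using lOmega_chart hφ x y₀ hq hV a
    rw [e.fderiv_eq]
  rw [← hd, ← hd]
  rw [Fin.sum_univ_two] at key
  refine Eq.trans ?_ (key.trans ?_)
  · refine congrArg (dForm η ((extChartAt (𝓡 3) x).symm u)) (funext fun i => ?_)
    fin_cases i <;> rfl
  · simp only [Fin.val_zero, pow_zero, one_mul, Fin.val_one, pow_one, neg_one_mul]
    exact sub_eq_add_neg _ _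

include hL ho

/-- `*θ` as the restriction of `-λ⁻¹` times the contraction of `T` with the velocity. -/
theorem starLOmega_chart (hV : ∀ y, V y = mfderiv 𝓘(ℝ, ℝ) (𝓡 6) (fun t => φ t y) 0 (1 : ℝ))
    (w w' : EuclideanSpace ℝ (Fin 3)) :
    starLOmega A (φ 0) o V ((extChartAt (𝓡 3) x).symm u) ![chartFrame x u w, chartFrame x u w'] =
      -lam⁻¹ * pullThree (torsionForm (chartMetric y₀) (chartJ A y₀)) (variationInChart 3 6 φ x y₀)
        timeDir (spaceDir w) (spaceDir w') (0, u) := by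
  have hl := (isLocalNearlyKahler_chart A hA y₀).lam_pos.ne'
  rw [torsion_contraction_initial hA hφ hL ho x y₀ hz hV]
  field_simp

/-- The form `d*θ` as the divergence of the contraction of `T` with the velocity, whose components
are numbered by the complementary index. -/
theorem dForm_starLOmega_chart
    (hV : ∀ y, V y = mfderiv 𝓘(ℝ, ℝ) (𝓡 6) (fun t => φ t y) 0 (1 : ℝ))
    (w : Fin 3 → EuclideanSpace ℝ (Fin 3)) :
    dForm (starLOmega A (φ 0) o V) ((extChartAt (𝓡 3) x).symm u) (fun i => chartFrame x u (w i)) =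
      -lam⁻¹ * ∑ i, fderiv ℝ (sliceContractionThree (torsionForm (chartMetric y₀) (chartJ A y₀))
        (variationInChart 3 6 φ x y₀) w i) (0, u) (spaceDir (w i)) := by
  have hO := isOpen_variationDomain hφ x y₀
  have hT := fun w w' : EuclideanSpace ℝ (Fin 3) => contDiffOn_pullThree hO
    (contDiffOn_variationInChart hφ x y₀) (mapsTo_variationInChart x y₀)
    (isLocalNearlyKahler_chart A hA y₀).smooth_torsionForm timeDir (spaceDir w) (spaceDir w')
  have hΩ := isOpen_initialSlice hO
  have hev : ∀ᶠ q in 𝓝 u, (0, q) ∈ variationDomain 3 6 ε φ x y₀ := hΩ.mem_nhds hz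
  have hη : DifferentiableAt ℝ (formInChart (starLOmega A (φ 0) o V) x) u := by
    have h : ContDiffOn ℝ ∞ (formInChart (starLOmega A (φ 0) o V) x)
        {q | (0, q) ∈ variationDomain 3 6 ε φ x y₀} :=
      contDiffOn_alternating fun v => ((contDiffOn_const (c := -lam⁻¹)).mul
        (contDiffOn_initialSlice (hT (v 0) (v 1)))).congr fun q hq => by
          refine Eq.trans ?_ (starLOmega_chart hA hφ hL ho x y₀ hq hV (v 0) (v 1))
          refine congrArg (starLOmega A (φ 0) o V ((extChartAt (𝓡 3) x).symm q))
            (funext fun i => ?_)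
          fin_cases i <;> rfl
    exact (h.contDiffAt (hΩ.mem_nhds hz)).differentiableAt (by simp)
  have key := dForm_chart (starLOmega A (φ 0) o V) x hz.1.2 hη w
  have hd : ∀ a b c : EuclideanSpace ℝ (Fin 3), fderiv ℝ (fun q => starLOmega A (φ 0) o V
      ((extChartAt (𝓡 3) x).symm q) ![chartFrame x q a, chartFrame x q b]) u c =
      -lam⁻¹ * fderiv ℝ (pullThree (torsionForm (chartMetric y₀) (chartJ A y₀))
        (variationInChart 3 6 φ x y₀) timeDir (spaceDir a) (spaceDir b)) (0, u) (spaceDir c) := by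
    intro a b c
    have hda : DifferentiableAt ℝ (pullThree (torsionForm (chartMetric y₀) (chartJ A y₀))
        (variationInChart 3 6 φ x y₀) timeDir (spaceDir a) (spaceDir b)) (0, u) :=
      ((hT a b).contDiffAt (hO.mem_nhds hz)).differentiableAt (by simp)
    have e : (fun q => starLOmega A (φ 0) o V ((extChartAt (𝓡 3) x).symm q)
        ![chartFrame x q a, chartFrame x q b]) =ᶠ[𝓝 u] fun q =>
        -lam⁻¹ * pullThree (torsionForm (chartMetric y₀) (chartJ A y₀))
        (variationInChart 3 6 φ x y₀) timeDir (spaceDir a) (spaceDir b) (0, q) := by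
      filter_upwards [hev] with q hq using starLOmega_chart hA hφ hL ho x y₀ hq hV a b
    rw [e.fderiv_eq, ← fderiv_spaceDir (f := fun z => -lam⁻¹ * pullThree
      (torsionForm (chartMetric y₀) (chartJ A y₀)) (variationInChart 3 6 φ x y₀) timeDir
        (spaceDir a) (spaceDir b) z) (hda.const_mul _), fderiv_const_mul hda]
    rfl
  have hsw : ∀ a b c : EuclideanSpace ℝ (Fin 3), fderiv ℝ (fun q => starLOmega A (φ 0) o V
      ((extChartAt (𝓡 3) x).symm q) ![chartFrame x q a, chartFrame x q b]) u c =
      -fderiv ℝ (fun q => starLOmega A (φ 0) o V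
      ((extChartAt (𝓡 3) x).symm q) ![chartFrame x q b, chartFrame x q a]) u c := by
    intro a b c
    rw [← neg_apply, ← fderiv_fun_neg]
    exact congrArg (fun h : EuclideanSpace ℝ (Fin 3) → ℝ => fderiv ℝ h u c)
      (funext fun q => alternating_two_swap _ _ _)
  have hrem : ∀ i : Fin 3, (fun q => starLOmega A (φ 0) o V ((extChartAt (𝓡 3) x).symm q)
      (fun j => chartFrame x q (i.removeNth w j))) = fun q => starLOmega A (φ 0) o V
      ((extChartAt (𝓡 3) x).symm q) ![chartFrame x q (i.removeNth w 0),
        chartFrame x q (i.removeNth w 1)] := by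
    intro i
    funext q
    refine congrArg (starLOmega A (φ 0) o V ((extChartAt (𝓡 3) x).symm q)) (funext fun j => ?_)
    fin_cases j <;> rfl
  rw [key, Fin.sum_univ_three, hrem, hrem, hrem, Fin.sum_univ_three, mul_add, mul_add]
  have r1 := hd (w 1) (w 2) (w 0)
  have r2 := (hsw (w 0) (w 2) (w 1)).trans (congrArg (fun r : ℝ => -r) (hd (w 2) (w 0) (w 1)))
  have r3 := hd (w 0) (w 1) (w 2)
  have e : ∀ a b c a' b' c' : ℝ, a = a' → b = -b' → c = c' →
      (-1) ^ (0 : Fin 3).val * a + (-1) ^ (1 : Fin 3).val * b + (-1) ^ (2 : Fin 3).val * c =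
        a' + b' + c' := by
    rintro a b c a' b' c' rfl rfl rfl
    simp
  exact e _ _ _ _ _ _ r1 r2 r3

end SliceExteriorDerivatives

/-! ### The divergence of the velocity of the fundamental form -/

section SliceDivergence

variable {E : Type*} [NormedAddCommGroup E] [NormedSpace ℝ E]
  {Y : Type*} [NormedAddCommGroup Y] [NormedSpace ℝ Y]
  {U : Set E} {O : Set (ℝ × Y)} {F : ℝ × Y → E} (hO : IsOpen O)
  (hF : ContDiffOn ℝ ∞ F O) (hFU : MapsTo F O U)
  {g : E → E →L[ℝ] E →L[ℝ] ℝ} {J : E → E →L[ℝ] E} {lam : ℝ}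
  (h : IsLocalNearlyKahler U g J lam) (b : Fin 3 → Y)
include h hO hF hFU

/-- The divergence of the velocity of the restriction of `ω`: the exact part drops out. -/
theorem sum_fderiv_fderiv_sliceForm {z : ℝ × Y} (hz : z ∈ O) :
    ∑ i, fderiv ℝ (fun y => fderiv ℝ (sliceForm (kahlerForm g J) F b i) y timeDir) z
      (spaceDir (b i)) =
    3 * ∑ i, fderiv ℝ (sliceContractionThree (torsionForm g J) F b i) z (spaceDir (b i)) := by
  have hθ : ∀ i, ContDiffAt ℝ ∞ (sliceContraction (kahlerForm g J) F b i) z := fun i =>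
    (contDiffOn_pullTwo hO hF hFU h.smooth_kahlerForm _ _).contDiffAt (hO.mem_nhds hz)
  have hT : ∀ i, ContDiffAt ℝ ∞ (sliceContractionThree (torsionForm g J) F b i) z := fun i =>
    (contDiffOn_pullThree hO hF hFU h.smooth_torsionForm _ _ _).contDiffAt (hO.mem_nhds hz)
  have key : ∀ i, fderiv ℝ (fun y => fderiv ℝ (sliceForm (kahlerForm g J) F b i) y timeDir) z
      (spaceDir (b i)) =
      3 * fderiv ℝ (sliceContractionThree (torsionForm g J) F b i) z (spaceDir (b i)) +
      fderiv ℝ (fun y => fderiv ℝ (sliceContraction (kahlerForm g J) F b (i + 2)) y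
        (spaceDir (b (i + 1)))) z (spaceDir (b i)) -
      fderiv ℝ (fun y => fderiv ℝ (sliceContraction (kahlerForm g J) F b (i + 1)) y
        (spaceDir (b (i + 2)))) z (spaceDir (b i)) := by
    intro i
    have e : (fun y => fderiv ℝ (sliceForm (kahlerForm g J) F b i) y timeDir) =ᶠ[𝓝 z] fun y =>
        3 * sliceContractionThree (torsionForm g J) F b i y +
        fderiv ℝ (sliceContraction (kahlerForm g J) F b (i + 2)) y (spaceDir (b (i + 1))) -
        fderiv ℝ (sliceContraction (kahlerForm g J) F b (i + 1)) y (spaceDir (b (i + 2))) := by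
      filter_upwards [hO.mem_nhds hz] with y hy using fderiv_sliceForm_timeDir hO hF hFU h b hy i
    have hd := (((((hT i).differentiableAt (by simp)).hasFDerivAt.const_mul 3).add
      ((contDiffAt_fderiv_apply (hθ (i + 2)) (spaceDir (b (i + 1)))).differentiableAt
        (by simp)).hasFDerivAt).sub
      ((contDiffAt_fderiv_apply (hθ (i + 1)) (spaceDir (b (i + 2)))).differentiableAt
        (by simp)).hasFDerivAt)
    rw [e.fderiv_eq]
    exact congrArg (fun B => B (spaceDir (b i))) hd.fderiv
  have hc := fun i j k => fderiv_fderiv_comm (hθ i) (spaceDir (b j)) (spaceDir (b k))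
  simp only [key, Fin.sum_univ_three, Fin.isValue, zero_add, Fin.reduceAdd]
  rw [hc 2 1 0, hc 0 2 1, hc 1 0 2]
  ring

end SliceDivergence

/-! ### The integrands in charts -/

section PointwiseSecondVariation

variable {M : Type*} [TopologicalSpace M] [ChartedSpace (EuclideanSpace ℝ (Fin 6)) M]
  [IsManifold (𝓡 6) ∞ M] [RiemannianBundle (fun x : M => TangentSpace (𝓡 6) x)]
  [IsContMDiffRiemannianBundle (𝓡 6) ∞ (EuclideanSpace ℝ (Fin 6))
    (fun x : M => TangentSpace (𝓡 6) x)]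
  {A : AlmostHermitianStructure 6 M} {lam : ℝ} (hA : IsStrictNearlyKahlerOfConstantType A lam)
  {L : Type*} [TopologicalSpace L] [ChartedSpace (EuclideanSpace ℝ (Fin 3)) L]
  [IsManifold (𝓡 3) ∞ L] [RiemannianBundle (fun x : L => TangentSpace (𝓡 3) x)]

/-- The coordinate frame of a chart is a basis of the tangent space. -/
theorem volumeForm_chartFrame_ne_zero (x : L) {u : EuclideanSpace ℝ (Fin 3)}
    (hu : u ∈ (extChartAt (𝓡 3) x).target)
    (o : Orientation ℝ (TangentSpace (𝓡 3) ((extChartAt (𝓡 3) x).symm u)) (Fin 3)) :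
    o.volumeForm (fun i => chartFrame x u (stdFrame i)) ≠ 0 := by
  let e : EuclideanSpace ℝ (Fin 3) ≃ₗ[ℝ] TangentSpace (𝓡 3) ((extChartAt (𝓡 3) x).symm u) :=
    { (chartFrame x u).toLinearMap with
      invFun := chartCoframe x u
      left_inv := chartCoframe_chartFrame x hu
      right_inv := chartFrame_chartCoframe x hu }
  let b := (EuclideanSpace.basisFun (Fin 3) ℝ).toBasis.map e
  have hb : (b : Fin 3 → TangentSpace (𝓡 3) ((extChartAt (𝓡 3) x).symm u)) =
      fun i => chartFrame x u (stdFrame i) := by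
    funext i
    simp only [b, Module.Basis.map_apply, OrthonormalBasis.coe_toBasis,
      EuclideanSpace.basisFun_apply]
    rfl
  rw [← hb]
  refine (AlternatingMap.map_basis_ne_zero_iff b _).2 fun h0 => ?_
  have h1 := o.abs_volumeForm_apply_of_orthonormal
    (threeBasis (TangentSpace (𝓡 3) ((extChartAt (𝓡 3) x).symm u)))
  rw [h0] at h1
  exact absurd (show |(0 : ℝ)| = 1 from h1) (by simp)

variable {ε : ℝ} {φ : ℝ → L → M}
  (hφ : ContMDiffOn (𝓘(ℝ, ℝ).prod (𝓡 3)) (𝓡 6) ∞ (fun p : ℝ × L => φ p.1 p.2)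
    (Ioo (-ε) ε ×ˢ univ))
  (hL : IsLagrangian A (φ 0)) {o : ∀ x : L, Orientation ℝ (TangentSpace (𝓡 3) x) (Fin 3)}
  (ho : IsCanonicalOrientation A lam (φ 0) o)
  {V : ∀ y : L, TangentSpace (𝓡 6) (φ 0 y)}
  (x : L) (y₀ : M) {u : EuclideanSpace ℝ (Fin 3)} (hz : (0, u) ∈ variationDomain 3 6 ε φ x y₀)
include hφ hz hL

/-- The squared volume density of the isometric initial slice, from the volume form of its source.
-/
theorem gramDet_initial (o : Orientation ℝ (TangentSpace (𝓡 3) ((extChartAt (𝓡 3) x).symm u))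
    (Fin 3)) : gramDet (chartMetric y₀) (variationInChart 3 6 φ x y₀) stdFrame (0, u) =
      o.volumeForm (fun i => chartFrame x u (stdFrame i)) ^ 2 := by
  rw [volumeForm_sq, gramDet]
  congr 1
  ext i j
  exact inner_initial_chart hφ x y₀ hz hL _ _

theorem gramDet_initial_pos :
    0 < gramDet (chartMetric y₀) (variationInChart 3 6 φ x y₀) stdFrame (0, u) := by
  have hb := (threeBasis (TangentSpace (𝓡 3) ((extChartAt (𝓡 3) x).symm u))).toBasis.orientation
  rw [gramDet_initial hφ hL x y₀ hz hb]
  have := volumeForm_chartFrame_ne_zero x hz.1.2 hb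
  positivity

include hA ho

/-- The velocity of the restriction of `ω` to the slices is `dθ - 3λ *θ`. -/
theorem dOne_sub_starLOmega_chart
    (hV : ∀ y, V y = mfderiv 𝓘(ℝ, ℝ) (𝓡 6) (fun t => φ t y) 0 (1 : ℝ))
    (b : Fin 3 → EuclideanSpace ℝ (Fin 3)) (i : Fin 3) :
    (dOne (lOmega A (φ 0) V) ((extChartAt (𝓡 3) x).symm u) -
      (3 * lam) • starLOmega A (φ 0) o V ((extChartAt (𝓡 3) x).symm u))
        ![chartFrame x u (b (i + 1)), chartFrame x u (b (i + 2))] =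
      fderiv ℝ (sliceForm (kahlerForm (chartMetric y₀) (chartJ A y₀))
        (variationInChart 3 6 φ x y₀) b i) (0, u) timeDir := by
  have h1 := dOne_lOmega_chart hA hφ x y₀ hz hV (b (i + 1)) (b (i + 2))
  have h2 := starLOmega_chart hA hφ hL ho x y₀ hz hV (b (i + 1)) (b (i + 2))
  have h3 := fderiv_sliceForm_timeDir (isOpen_variationDomain hφ x y₀)
    (contDiffOn_variationInChart hφ x y₀) (mapsTo_variationInChart x y₀)
    (isLocalNearlyKahler_chart A hA y₀) b hz i
  have hl := (isLocalNearlyKahler_chart A hA y₀).lam_pos.ne'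
  rw [h3, ContinuousAlternatingMap.sub_apply, ContinuousAlternatingMap.smul_apply, h1, h2,
    smul_eq_mul]
  have h4 : 3 * lam * (-lam⁻¹ * pullThree (torsionForm (chartMetric y₀) (chartJ A y₀))
      (variationInChart 3 6 φ x y₀) timeDir (spaceDir (b (i + 1))) (spaceDir (b (i + 2))) (0, u)) =
      -3 * pullThree (torsionForm (chartMetric y₀) (chartJ A y₀))
      (variationInChart 3 6 φ x y₀) timeDir (spaceDir (b (i + 1))) (spaceDir (b (i + 2))) (0, u) := by
    field_simp
  rw [h4, sliceContraction, sliceContraction, sliceContractionThree]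
  ring

/-- The first integrand of the second variation, in charts. -/
theorem formInner_two_chart
    (hV : ∀ y, V y = mfderiv 𝓘(ℝ, ℝ) (𝓡 6) (fun t => φ t y) 0 (1 : ℝ)) :
    formInner (dOne (lOmega A (φ 0) V) ((extChartAt (𝓡 3) x).symm u) -
        (3 * lam) • starLOmega A (φ 0) o V ((extChartAt (𝓡 3) x).symm u))
      (dOne (lOmega A (φ 0) V) ((extChartAt (𝓡 3) x).symm u) +
        lam • starLOmega A (φ 0) o V ((extChartAt (𝓡 3) x).symm u)) =
    ((∑ i, ∑ j, fderiv ℝ (sliceForm (kahlerForm (chartMetric y₀) (chartJ A y₀))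
        (variationInChart 3 6 φ x y₀) stdFrame i) (0, u) timeDir *
      fderiv ℝ (sliceForm (kahlerForm (chartMetric y₀) (chartJ A y₀))
        (variationInChart 3 6 φ x y₀) stdFrame j) (0, u) timeDir *
      pullTwo (chartMetric y₀) (variationInChart 3 6 φ x y₀) (spaceDir (stdFrame i))
        (spaceDir (stdFrame j)) (0, u)) +
      4 * sliceTop (starTorsionForm (chartMetric y₀) (chartJ A y₀))
        (variationInChart 3 6 φ x y₀) stdFrame (0, u) *
      ∑ i, sliceContraction (kahlerForm (chartMetric y₀) (chartJ A y₀))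
        (variationInChart 3 6 φ x y₀) stdFrame i (0, u) *
        fderiv ℝ (sliceForm (kahlerForm (chartMetric y₀) (chartJ A y₀))
        (variationInChart 3 6 φ x y₀) stdFrame i) (0, u) timeDir) /
      gramDet (chartMetric y₀) (variationInChart 3 6 φ x y₀) stdFrame (0, u) := by
  set β := dOne (lOmega A (φ 0) V) ((extChartAt (𝓡 3) x).symm u) - (3 * lam) • starLOmega A (φ 0) o V ((extChartAt (𝓡 3) x).symm u) with hβ
  have hν := volumeForm_chartFrame_ne_zero x hz.1.2 (o ((extChartAt (𝓡 3) x).symm u))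
  have e : dOne (lOmega A (φ 0) V) ((extChartAt (𝓡 3) x).symm u) + lam • starLOmega A (φ 0) o V ((extChartAt (𝓡 3) x).symm u) =
      β + (4 * lam) • starLOmega A (φ 0) o V ((extChartAt (𝓡 3) x).symm u) := by
    rw [hβ]
    module
  have e2 : formInner β (β + (4 * lam) • starLOmega A (φ 0) o V ((extChartAt (𝓡 3) x).symm u)) =
      formInner β β + 4 * lam * formInner β (starLOmega A (φ 0) o V ((extChartAt (𝓡 3) x).symm u)) := by
    simp only [formInner, ContinuousAlternatingMap.add_apply, ContinuousAlternatingMap.smul_apply,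
      smul_eq_mul, mul_add, Finset.sum_add_distrib]
    congr 1
    rw [Finset.mul_sum, Finset.mul_sum, Finset.mul_sum]
    exact Finset.sum_congr rfl fun i _ => by ring
  have h1 := formInner_two_frame (o ((extChartAt (𝓡 3) x).symm u)) (fun i => chartFrame x u (stdFrame i)) hν β β
  have h2 := formInner_hodgeStar_frame (o ((extChartAt (𝓡 3) x).symm u)) (fun i => chartFrame x u (stdFrame i)) hν β
    (lOmega A (φ 0) V ((extChartAt (𝓡 3) x).symm u))
  have h3 : ∀ i, β ![chartFrame x u (stdFrame (i + 1)), chartFrame x u (stdFrame (i + 2))] = _ :=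
    fun i => dOne_sub_starLOmega_chart hA hφ hL ho x y₀ hz hV stdFrame i
  have h4 := fun i j => inner_initial_chart hφ x y₀ hz hL (stdFrame i) (stdFrame j)
  have h5 := fun i => lOmega_chart (A := A) hφ x y₀ hz hV (stdFrame i)
  simp only [h3, ← h4] at h1
  simp only [h3, h5] at h2
  rw [e, e2, h1]
  refine (congrArg (fun r : ℝ => _ + 4 * lam * r) h2).trans ?_
  rw [sliceTop_starTorsionForm_initial hA hφ hL ho x y₀ hz, gramDet_initial hφ hL x y₀ hz (o ((extChartAt (𝓡 3) x).symm u))]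
  simp only [sliceContraction]
  rw [add_div]
  congr 1
  rw [← mul_div_assoc]
  rw [div_eq_div_iff hν (pow_ne_zero 2 hν)]
  rw [Finset.sum_congr rfl fun i _ => mul_comm (fderiv ℝ (sliceForm (kahlerForm (chartMetric y₀)
    (chartJ A y₀)) (variationInChart 3 6 φ x y₀) stdFrame i) (0, u) timeDir) _]
  ring

/-- The second integrand of the second variation, in charts. -/
theorem formInner_three_chart
    (hV : ∀ y, V y = mfderiv 𝓘(ℝ, ℝ) (𝓡 6) (fun t => φ t y) 0 (1 : ℝ)) :
    formInner (dForm (starLOmega A (φ 0) o V) ((extChartAt (𝓡 3) x).symm u))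
      (dForm (starLOmega A (φ 0) o V) ((extChartAt (𝓡 3) x).symm u)) =
    (lam⁻¹ * ∑ i, fderiv ℝ (sliceContractionThree (torsionForm (chartMetric y₀) (chartJ A y₀))
        (variationInChart 3 6 φ x y₀) stdFrame i) (0, u) (spaceDir (stdFrame i))) ^ 2 /
      gramDet (chartMetric y₀) (variationInChart 3 6 φ x y₀) stdFrame (0, u) := by
  have hν := volumeForm_chartFrame_ne_zero x hz.1.2 (o ((extChartAt (𝓡 3) x).symm u))
  rw [formInner_three_frame _ _ hν, dForm_starLOmega_chart hA hφ hL ho x y₀ hz hV,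
    gramDet_initial hφ hL x y₀ hz (o ((extChartAt (𝓡 3) x).symm u))]
  ring

end PointwiseSecondVariation

/-! ### The flux of a variation -/

section Flux

variable {M : Type*} [TopologicalSpace M] [ChartedSpace (EuclideanSpace ℝ (Fin 6)) M]
  [IsManifold (𝓡 6) ∞ M] [RiemannianBundle (fun x : M => TangentSpace (𝓡 6) x)]
  [IsContMDiffRiemannianBundle (𝓡 6) ∞ (EuclideanSpace ℝ (Fin 6))
    (fun x : M => TangentSpace (𝓡 6) x)]
  {A : AlmostHermitianStructure 6 M} {lam : ℝ} (hA : IsStrictNearlyKahlerOfConstantType A lam)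
  {L : Type*} [TopologicalSpace L] [ChartedSpace (EuclideanSpace ℝ (Fin 3)) L]
  [IsManifold (𝓡 3) ∞ L] [RiemannianBundle (fun x : L => TangentSpace (𝓡 3) x)]
  {ε : ℝ} {φ : ℝ → L → M}
  (hφ : ContMDiffOn (𝓘(ℝ, ℝ).prod (𝓡 3)) (𝓡 6) ∞ (fun p : ℝ × L => φ p.1 p.2)
    (Ioo (-ε) ε ×ˢ univ))
  (hL : IsLagrangian A (φ 0)) {o : ∀ x : L, Orientation ℝ (TangentSpace (𝓡 3) x) (Fin 3)}
  (ho : IsCanonicalOrientation A lam (φ 0) o)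
  {V : ∀ y : L, TangentSpace (𝓡 6) (φ 0 y)}
  (x : L) (y₀ : M) {u : EuclideanSpace ℝ (Fin 3)} (hz : (0, u) ∈ variationDomain 3 6 ε φ x y₀)

/-- The time derivative, at time zero, of the contraction of `-Im Φ` with the velocity of the
variation, as a form on `L`. Its exterior derivative is the divergence term of the second
variation. -/
noncomputable def fluxForm (A : AlmostHermitianStructure 6 M) (lam : ℝ) (φ : ℝ → L → M) (y : L)
    (a b : TangentSpace (𝓡 3) y) : ℝ :=
  deriv (fun t => -imPhi A lam (φ t y) (mfderiv 𝓘(ℝ, ℝ) (𝓡 6) (fun s => φ s y) t (1 : ℝ))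
    (mfderiv (𝓡 3) (𝓡 6) (φ t) y a) (mfderiv (𝓡 3) (𝓡 6) (φ t) y b)) 0

include hA hφ hz

/-- In charts the flux form is the time derivative of a contraction with the form `T(·, ·, J ·)`. -/
theorem fluxForm_chart (w w' : EuclideanSpace ℝ (Fin 3)) :
    fluxForm A lam φ ((extChartAt (𝓡 3) x).symm u) (chartFrame x u w) (chartFrame x u w') =
      lam⁻¹ * fderiv ℝ (pullThree (starTorsionForm (chartMetric y₀) (chartJ A y₀))
        (variationInChart 3 6 φ x y₀) timeDir (spaceDir w) (spaceDir w')) (0, u) timeDir := by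
  have hO := isOpen_variationDomain hφ x y₀
  have hS := (contDiffOn_pullThree hO (contDiffOn_variationInChart hφ x y₀)
    (mapsTo_variationInChart x y₀) (isLocalNearlyKahler_chart A hA y₀).smooth_starTorsionForm
    timeDir (spaceDir w) (spaceDir w')).contDiffAt (hO.mem_nhds hz)
  have hline : HasDerivAt (fun t : ℝ => ((t, u) : ℝ × EuclideanSpace ℝ (Fin 3))) timeDir 0 :=
    (hasDerivAt_id 0).prodMk (hasDerivAt_const 0 u)
  have hev : ∀ᶠ t in 𝓝 (0 : ℝ), (t, u) ∈ variationDomain 3 6 ε φ x y₀ :=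
    hline.continuousAt.eventually (hO.mem_nhds hz)
  have hd := ((hS.differentiableAt (by simp)).hasFDerivAt.comp_hasDerivAt (0 : ℝ) hline).const_mul
    lam⁻¹
  refine (hd.congr_of_eventuallyEq ?_).deriv
  filter_upwards [hev] with t ht using imPhi_slice_chart hφ x y₀ ht w w'

/-- The flux form is bilinear and alternating, hence dual to a vector. As it is defined by a time
derivative, linearity has to be checked in a chart of the target. -/
theorem exists_fluxVector_chart
    (o : Orientation ℝ (TangentSpace (𝓡 3) ((extChartAt (𝓡 3) x).symm u)) (Fin 3)) :
    ∃ W : TangentSpace (𝓡 3) ((extChartAt (𝓡 3) x).symm u), ∀ a b,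
      fluxForm A lam φ ((extChartAt (𝓡 3) x).symm u) a b = o.volumeForm ![W, a, b] := by
  have hO := isOpen_variationDomain hφ x y₀
  set S := starTorsionForm (chartMetric y₀) (chartJ A y₀) with hSdef
  set F := variationInChart 3 6 φ x y₀ with hF
  have hS := fun w w' : EuclideanSpace ℝ (Fin 3) =>
    ((contDiffOn_pullThree hO (contDiffOn_variationInChart hφ x y₀)
    (mapsTo_variationInChart x y₀) (isLocalNearlyKahler_chart A hA y₀).smooth_starTorsionForm
    timeDir (spaceDir w) (spaceDir w')).contDiffAt (hO.mem_nhds hz)).differentiableAt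
      (by simp : (∞ : WithTop ℕ∞) ≠ 0)
  simp only [← hSdef, ← hF] at hS
  have hsd : ∀ w w' : EuclideanSpace ℝ (Fin 3), spaceDir (w + w') = spaceDir w + spaceDir w' :=
    fun w w' => by simp [spaceDir]
  have hsm : ∀ (c : ℝ) (w : EuclideanSpace ℝ (Fin 3)), spaceDir (c • w) = c • spaceDir w :=
    fun c w => by simp [spaceDir]
  let P : EuclideanSpace ℝ (Fin 3) → EuclideanSpace ℝ (Fin 3) → ℝ := fun w w' =>
    lam⁻¹ * fderiv ℝ (pullThree S F timeDir (spaceDir w) (spaceDir w')) (0, u) timeDir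
  have hadd₁ : ∀ w w' v, P (w + w') v = P w v + P w' v := by
    intro w w' v
    have e : pullThree S F timeDir (spaceDir (w + w')) (spaceDir v) = fun z =>
        pullThree S F timeDir (spaceDir w) (spaceDir v) z +
          pullThree S F timeDir (spaceDir w') (spaceDir v) z := by
      funext z
      simp only [pullThree, hsd, map_add, add_apply]
    simp only [P]
    rw [e, fderiv_fun_add (hS _ _) (hS _ _), add_apply, mul_add]
  have hadd₂ : ∀ v w w', P v (w + w') = P v w + P v w' := by
    intro v w w'
    have e : pullThree S F timeDir (spaceDir v) (spaceDir (w + w')) = fun z =>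
        pullThree S F timeDir (spaceDir v) (spaceDir w) z +
          pullThree S F timeDir (spaceDir v) (spaceDir w') z := by
      funext z
      simp only [pullThree, hsd, map_add]
    simp only [P]
    rw [e, fderiv_fun_add (hS _ _) (hS _ _), add_apply, mul_add]
  have hsmul₁ : ∀ (c : ℝ) w v, P (c • w) v = c * P w v := by
    intro c w v
    have e : pullThree S F timeDir (spaceDir (c • w)) (spaceDir v) = fun z =>
        c * pullThree S F timeDir (spaceDir w) (spaceDir v) z := by
      funext z
      simp only [pullThree, hsm, map_smul, smul_apply, smul_eq_mul]
    simp only [P]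
    rw [e, fderiv_const_mul (hS _ _), smul_apply, smul_eq_mul]
    ring
  have hsmul₂ : ∀ (c : ℝ) v w, P v (c • w) = c * P v w := by
    intro c v w
    have e : pullThree S F timeDir (spaceDir v) (spaceDir (c • w)) = fun z =>
        c * pullThree S F timeDir (spaceDir v) (spaceDir w) z := by
      funext z
      simp only [pullThree, hsm, map_smul, smul_eq_mul]
    simp only [P]
    rw [e, fderiv_const_mul (hS _ _), smul_apply, smul_eq_mul]
    ring
  -- `S` is alternating in its last two arguments, because `J` may be moved from one to the other.
  have hself : ∀ w, P w w = 0 := by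
    intro w
    have e : pullThree S F timeDir (spaceDir w) (spaceDir w) =ᶠ[𝓝 (0, u)] fun _ => 0 := by
      filter_upwards [hO.mem_nhds hz] with z hzO
      have hQ := ((isLocalNearlyKahler_chart A hA y₀).algebra
        (mapsTo_variationInChart x y₀ hzO)).toIsTypeThreeZero
      have h1 := hQ.move_J (fderiv ℝ F z timeDir) (fderiv ℝ F z (spaceDir w))
        (fderiv ℝ F z (spaceDir w))
      have h2 := hQ.swap₂₃ (fderiv ℝ F z timeDir) (fderiv ℝ F z (spaceDir w))
        (chartJ A y₀ (F z) (fderiv ℝ F z (spaceDir w)))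
      simp only [pullThree, hSdef, starTorsionForm_apply]
      linarith
    simp only [P]
    rw [e.fderiv_eq]
    simp
  have hP : ∀ a b, fluxForm A lam φ ((extChartAt (𝓡 3) x).symm u) a b =
      P (chartCoframe x u a) (chartCoframe x u b) := by
    intro a b
    have h := fluxForm_chart hA hφ x y₀ hz (chartCoframe x u a) (chartCoframe x u b)
    rw [chartFrame_chartCoframe x (p := u) hz.1.2, chartFrame_chartCoframe x (p := u) hz.1.2] at h
    exact h
  obtain ⟨W, hW⟩ := exists_dual_vector o (LinearMap.mk₂ ℝ
    (fun a b => P (chartCoframe x u a) (chartCoframe x u b))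
    (fun a b c => by rw [map_add]; exact hadd₁ _ _ _)
    (fun r a b => by rw [map_smul]; exact hsmul₁ _ _ _)
    (fun a b c => by rw [map_add]; exact hadd₂ _ _ _)
    (fun r a b => by rw [map_smul]; exact hsmul₂ _ _ _)) fun a => hself _
  exact ⟨W, fun a b => (hP a b).trans (hW a b)⟩

omit hz in
/-- The vector dual to the flux form. It does not depend on a choice of charts. -/
theorem exists_fluxVector (hε : 0 < ε) (y : L) : ∃ W : TangentSpace (𝓡 3) y, ∀ a b,
    fluxForm A lam φ y a b = (o y).volumeForm ![W, a, b] := by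
  have hz : (0, extChartAt (𝓡 3) y y) ∈ variationDomain 3 6 ε φ y (φ 0 y) := by
    refine ⟨⟨⟨by simpa, hε⟩, mem_extChartAt_target y⟩, ?_⟩
    simp only [extChartAt_to_inv]
    exact mem_extChartAt_source _
  have h : ∀ o' : Orientation ℝ (TangentSpace (𝓡 3) ((extChartAt (𝓡 3) y).symm
      (extChartAt (𝓡 3) y y))) (Fin 3), _ := exists_fluxVector_chart hA hφ y (φ 0 y) hz
  rw [extChartAt_to_inv] at h
  exact h (o y)

end Flux

/-! ### The pointwise second variation formula -/

section PointwiseFormula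

variable {M : Type*} [TopologicalSpace M] [ChartedSpace (EuclideanSpace ℝ (Fin 6)) M]
  [IsManifold (𝓡 6) ∞ M] [RiemannianBundle (fun x : M => TangentSpace (𝓡 6) x)]
  [IsContMDiffRiemannianBundle (𝓡 6) ∞ (EuclideanSpace ℝ (Fin 6))
    (fun x : M => TangentSpace (𝓡 6) x)]
  {A : AlmostHermitianStructure 6 M} {lam : ℝ} (hA : IsStrictNearlyKahlerOfConstantType A lam)
  {L : Type*} [TopologicalSpace L] [ChartedSpace (EuclideanSpace ℝ (Fin 3)) L]
  [IsManifold (𝓡 3) ∞ L] [RiemannianBundle (fun x : L => TangentSpace (𝓡 3) x)]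
  {ε : ℝ} {φ : ℝ → L → M}
  (hφ : ContMDiffOn (𝓘(ℝ, ℝ).prod (𝓡 3)) (𝓡 6) ∞ (fun p : ℝ × L => φ p.1 p.2)
    (Ioo (-ε) ε ×ˢ univ))
  (hL : IsLagrangian A (φ 0)) {o : ∀ x : L, Orientation ℝ (TangentSpace (𝓡 3) x) (Fin 3)}
  (ho : IsCanonicalOrientation A lam (φ 0) o)
  {V : ∀ y : L, TangentSpace (𝓡 6) (φ 0 y)}
  (x : L) (y₀ : M)

/-- The volume density of a variation in charts, as a function on space-time. -/
noncomputable def densityInChart (φ : ℝ → L → M) (x : L) (y₀ : M)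
    (z : ℝ × EuclideanSpace ℝ (Fin 3)) : ℝ :=
  Real.sqrt (gramDet (chartMetric y₀) (variationInChart 3 6 φ x y₀) stdFrame z)

/-- The components of the vector density on the chart around `x` whose divergence occurs in the
second variation of the density. -/
noncomputable def fluxField (A : AlmostHermitianStructure 6 M) (lam : ℝ) (φ : ℝ → L → M) (x : L)
    (y₀ : M) (i : Fin 3) (q : EuclideanSpace ℝ (Fin 3)) : ℝ :=
  sliceTop (starTorsionForm (chartMetric y₀) (chartJ A y₀)) (variationInChart 3 6 φ x y₀) stdFrame
    (0, q) / (lam ^ 2 * densityInChart φ x y₀ (0, q)) *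
  fderiv ℝ (sliceContractionThree (starTorsionForm (chartMetric y₀) (chartJ A y₀))
    (variationInChart 3 6 φ x y₀) stdFrame i) (0, q) timeDir

/-- The part of the domain of a variation in charts on which it is an immersion. -/
def immersionDomain (ε : ℝ) (φ : ℝ → L → M) (x : L) (y₀ : M) :
    Set (ℝ × EuclideanSpace ℝ (Fin 3)) :=
  variationDomain 3 6 ε φ x y₀ ∩
    {z | 0 < gramDet (chartMetric y₀) (variationInChart 3 6 φ x y₀) stdFrame z}

include hA hφ

theorem isOpen_immersionDomain : IsOpen (immersionDomain ε φ x y₀) :=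
  ((contDiffOn_gramDet (isOpen_variationDomain hφ x y₀) (contDiffOn_variationInChart hφ x y₀)
    (mapsTo_variationInChart x y₀) (isLocalNearlyKahler_chart A hA y₀)
    stdFrame).continuousOn).isOpen_inter_preimage (isOpen_variationDomain hφ x y₀) isOpen_Ioi

theorem contDiffOn_densityInChart :
    ContDiffOn ℝ ∞ (densityInChart φ x y₀) (immersionDomain ε φ x y₀) := by
  have h : ContDiffOn ℝ ∞ (gramDet (chartMetric y₀) (variationInChart 3 6 φ x y₀) stdFrame)
      (immersionDomain ε φ x y₀) :=
    (contDiffOn_gramDet (isOpen_variationDomain hφ x y₀) (contDiffOn_variationInChart hφ x y₀)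
      (mapsTo_variationInChart x y₀) (isLocalNearlyKahler_chart A hA y₀) stdFrame).mono
      inter_subset_left
  exact h.sqrt fun z hz => ne_of_gt hz.2

include hL

omit hA in
theorem mem_immersionDomain {u : EuclideanSpace ℝ (Fin 3)}
    (hz : (0, u) ∈ variationDomain 3 6 ε φ x y₀) : (0, u) ∈ immersionDomain ε φ x y₀ :=
  ⟨hz, gramDet_initial_pos hφ hL x y₀ hz⟩

/-- The coefficient `S / (λ² R)` of the flux field is smooth. Its values are `± λ⁻¹`. -/
theorem contDiffOn_fluxCoefficient : ContDiffOn ℝ ∞ (fun q =>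
    sliceTop (starTorsionForm (chartMetric y₀) (chartJ A y₀)) (variationInChart 3 6 φ x y₀)
      stdFrame (0, q) / (lam ^ 2 * densityInChart φ x y₀ (0, q)))
    {q | (0, q) ∈ variationDomain 3 6 ε φ x y₀} := by
  have hO := isOpen_variationDomain hφ x y₀
  have hl := (isLocalNearlyKahler_chart A hA y₀).lam_pos
  have h1 := contDiffOn_initialSlice (contDiffOn_pullThree hO (contDiffOn_variationInChart hφ x y₀)
    (mapsTo_variationInChart x y₀) (isLocalNearlyKahler_chart A hA y₀).smooth_starTorsionForm
    (spaceDir (stdFrame 0)) (spaceDir (stdFrame 1)) (spaceDir (stdFrame 2)))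
  have h2 := (contDiffOn_initialSlice (contDiffOn_densityInChart hA hφ x y₀)).mono
    (s := {q | (0, q) ∈ immersionDomain ε φ x y₀})
    (t := {q | (0, q) ∈ variationDomain 3 6 ε φ x y₀})
    fun q hq => mem_immersionDomain hφ hL x y₀ hq
  refine h1.div (contDiffOn_const.mul h2) fun q hq => ?_
  have : 0 < densityInChart φ x y₀ (0, q) := Real.sqrt_pos.2 (gramDet_initial_pos hφ hL x y₀ hq)
  positivity

theorem contDiffOn_fluxField (i : Fin 3) : ContDiffOn ℝ ∞ (fluxField A lam φ x y₀ i)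
    {q | (0, q) ∈ variationDomain 3 6 ε φ x y₀} := by
  have hO := isOpen_variationDomain hφ x y₀
  have h1 := contDiffOn_pullThree hO (contDiffOn_variationInChart hφ x y₀)
    (mapsTo_variationInChart x y₀) (isLocalNearlyKahler_chart A hA y₀).smooth_starTorsionForm
    timeDir (spaceDir (stdFrame (i + 1))) (spaceDir (stdFrame (i + 2)))
  have h2 : ContDiffOn ℝ ∞ (fun z => fderiv ℝ (sliceContractionThree
      (starTorsionForm (chartMetric y₀) (chartJ A y₀)) (variationInChart 3 6 φ x y₀) stdFrame i) z
      timeDir) (variationDomain 3 6 ε φ x y₀) :=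
    (h1.fderiv_of_isOpen hO (m := ∞) (by simp)).clm_apply contDiffOn_const
  exact (contDiffOn_fluxCoefficient hA hφ hL x y₀).mul (contDiffOn_initialSlice h2)

include ho

variable {u : EuclideanSpace ℝ (Fin 3)} (hz : (0, u) ∈ variationDomain 3 6 ε φ x y₀)
include hz

/-- The pairing of the flux field with a covector is the density times the pairing with the flux
vector. So the terms that integration by parts leaves in the various charts are the values of one
vector field on `L`. -/
theorem sum_mul_fluxField {W : TangentSpace (𝓡 3) ((extChartAt (𝓡 3) x).symm u)}
    (hW : ∀ a b, fluxForm A lam φ ((extChartAt (𝓡 3) x).symm u) a b =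
      (o ((extChartAt (𝓡 3) x).symm u)).volumeForm ![W, a, b])
    (κ : TangentSpace (𝓡 3) ((extChartAt (𝓡 3) x).symm u) →ₗ[ℝ] ℝ) :
    ∑ i, κ (chartFrame x u (stdFrame i)) * fluxField A lam φ x y₀ i u =
      densityInChart φ x y₀ (0, u) * κ W := by
  have hl := (isLocalNearlyKahler_chart A hA y₀).lam_pos
  have hν := gramDet_initial hφ hL x y₀ hz (o ((extChartAt (𝓡 3) x).symm u))
  have hR : 0 < densityInChart φ x y₀ (0, u) :=
    Real.sqrt_pos.2 (gramDet_initial_pos hφ hL x y₀ hz)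
  have hR2 : densityInChart φ x y₀ (0, u) ^ 2 =
      gramDet (chartMetric y₀) (variationInChart 3 6 φ x y₀) stdFrame (0, u) :=
    Real.sq_sqrt (gramDet_initial_pos hφ hL x y₀ hz).le
  have h1 := congrArg κ (sum_volumeForm_smul (o ((extChartAt (𝓡 3) x).symm u))
    (fun i => chartFrame x u (stdFrame i)) W)
  simp only [map_sum, map_smul, smul_eq_mul, ← hW] at h1
  set ν := (o ((extChartAt (𝓡 3) x).symm u)).volumeForm fun i => chartFrame x u (stdFrame i)
  have h2 : ∀ i, fluxField A lam φ x y₀ i u = ν / densityInChart φ x y₀ (0, u) *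
      fluxForm A lam φ ((extChartAt (𝓡 3) x).symm u) (chartFrame x u (stdFrame (i + 1)))
        (chartFrame x u (stdFrame (i + 2))) := by
    intro i
    rw [fluxForm_chart hA hφ x y₀ hz, fluxField,
      sliceTop_starTorsionForm_initial hA hφ hL ho x y₀ hz, sliceContractionThree]
    field_simp
    exact mul_comm _ _
  have h3 : ∑ i, κ (chartFrame x u (stdFrame i)) * fluxField A lam φ x y₀ i u =
      ν / densityInChart φ x y₀ (0, u) * (ν * κ W) := by
    rw [← h1, Finset.mul_sum]
    refine Finset.sum_congr rfl fun i _ => ?_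
    rw [h2]
    ring
  rw [h3]
  field_simp
  rw [hR2, hν]

/-- The pointwise second variation formula: up to the divergence of the flux field, the second time
derivative of the density is the density times the integrand. -/
theorem fderiv_fderiv_densityInChart
    (hV : ∀ y, V y = mfderiv 𝓘(ℝ, ℝ) (𝓡 6) (fun t => φ t y) 0 (1 : ℝ)) :
    fderiv ℝ (fun z => fderiv ℝ (densityInChart φ x y₀) z timeDir) (0, u) timeDir =
      densityInChart φ x y₀ (0, u) *
        (formInner (dOne (lOmega A (φ 0) V) ((extChartAt (𝓡 3) x).symm u) -
          (3 * lam) • starLOmega A (φ 0) o V ((extChartAt (𝓡 3) x).symm u))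
        (dOne (lOmega A (φ 0) V) ((extChartAt (𝓡 3) x).symm u) +
          lam • starLOmega A (φ 0) o V ((extChartAt (𝓡 3) x).symm u)) +
        formInner (dForm (starLOmega A (φ 0) o V) ((extChartAt (𝓡 3) x).symm u))
          (dForm (starLOmega A (φ 0) o V) ((extChartAt (𝓡 3) x).symm u))) +
      ∑ i, fderiv ℝ (fluxField A lam φ x y₀ i) u (stdFrame i) := by
  have hO := isOpen_variationDomain hφ x y₀
  have hF := contDiffOn_variationInChart hφ x y₀
  have hFU := mapsTo_variationInChart (m := 3) (n := 6) (ε := ε) (φ := φ) x y₀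
  have hNK := isLocalNearlyKahler_chart A hA y₀
  have hl := hNK.lam_pos
  have hΩ := isOpen_initialSlice hO
  have hpos := gramDet_initial_pos hφ hL x y₀ hz
  have key := second_variation_density hO hF hFU hNK stdFrame finrank_euclideanSpace_fin hz
    (fun w hw i => sliceForm_initial_eq_zero hφ hL x y₀ hw stdFrame w hw i) hpos
  have hsq : ∀ q, (0, q) ∈ variationDomain 3 6 ε φ x y₀ →
      sliceTop (starTorsionForm (chartMetric y₀) (chartJ A y₀)) (variationInChart 3 6 φ x y₀)
        stdFrame (0, q) ^ 2 = lam ^ 2 * densityInChart φ x y₀ (0, q) ^ 2 := fun q hq => by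
    have hq' := gramDet_initial_pos hφ hL x y₀ hq
    rw [densityInChart, Real.sq_sqrt hq'.le]
    exact (second_variation_density hO hF hFU hNK stdFrame finrank_euclideanSpace_fin hq
      (fun w hw i => sliceForm_initial_eq_zero hφ hL x y₀ hw stdFrame w hw i) hq').1
  -- The coefficient of the flux field has constant square, so that its derivative vanishes.
  set σ : EuclideanSpace ℝ (Fin 3) → ℝ := fun q =>
    sliceTop (starTorsionForm (chartMetric y₀) (chartJ A y₀)) (variationInChart 3 6 φ x y₀)
      stdFrame (0, q) / (lam ^ 2 * densityInChart φ x y₀ (0, q)) with hσ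
  have hσd : DifferentiableAt ℝ σ u :=
    ((contDiffOn_fluxCoefficient hA hφ hL x y₀).contDiffAt (hΩ.mem_nhds hz)).differentiableAt
      (by simp)
  have hσ2 : ∀ q, (0, q) ∈ variationDomain 3 6 ε φ x y₀ → σ q * σ q = (lam ^ 2)⁻¹ := fun q hq => by
    have hR : 0 < densityInChart φ x y₀ (0, q) :=
      Real.sqrt_pos.2 (gramDet_initial_pos hφ hL x y₀ hq)
    have := hsq q hq
    simp only [hσ]
    rw [div_mul_div_comm, ← sq, this]
    field_simp
  have hσ0 : fderiv ℝ σ u = 0 := by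
    have e : (fun q => σ q * σ q) =ᶠ[𝓝 u] fun _ => (lam ^ 2)⁻¹ := by
      filter_upwards [hΩ.mem_nhds hz] with q hq using hσ2 q hq
    have e1 := e.fderiv_eq (𝕜 := ℝ)
    rw [fderiv_fun_mul hσd hσd, fderiv_fun_const, Pi.zero_apply] at e1
    have e2 : (2 * σ u) • fderiv ℝ σ u = 0 := by rw [two_mul, add_smul]; exact e1
    refine (smul_eq_zero.1 e2).resolve_left fun h0 => ?_
    have := hσ2 u hz
    have hne : σ u ≠ 0 := fun h => by
      rw [h, mul_zero] at this
      exact (inv_pos.2 (pow_pos hl 2)).ne this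
    exact mul_ne_zero two_ne_zero hne h0
  have hY := fun i : Fin 3 => contDiffAt_fderiv_apply ((contDiffOn_pullThree hO hF hFU
    hNK.smooth_starTorsionForm timeDir (spaceDir (stdFrame (i + 1)))
    (spaceDir (stdFrame (i + 2)))).contDiffAt (hO.mem_nhds hz)) timeDir
  have hdiv : ∀ i, fderiv ℝ (fluxField A lam φ x y₀ i) u (stdFrame i) = σ u *
      fderiv ℝ (fun y => fderiv ℝ (sliceContractionThree
        (starTorsionForm (chartMetric y₀) (chartJ A y₀)) (variationInChart 3 6 φ x y₀)
        stdFrame i) y timeDir) (0, u) (spaceDir (stdFrame i)) := by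
    intro i
    have hYd := (hY i).differentiableAt (by simp : (∞ : WithTop ℕ∞) ≠ 0)
    have hYs : DifferentiableAt ℝ (fun q => fderiv ℝ (pullThree
        (starTorsionForm (chartMetric y₀) (chartJ A y₀)) (variationInChart 3 6 φ x y₀) timeDir
        (spaceDir (stdFrame (i + 1))) (spaceDir (stdFrame (i + 2)))) (0, q) timeDir) u :=
      hYd.comp u ((differentiableAt_const _).prodMk differentiableAt_id)
    have e : fluxField A lam φ x y₀ i = fun q => σ q * fderiv ℝ (pullThree
        (starTorsionForm (chartMetric y₀) (chartJ A y₀)) (variationInChart 3 6 φ x y₀) timeDir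
        (spaceDir (stdFrame (i + 1))) (spaceDir (stdFrame (i + 2)))) (0, q) timeDir := rfl
    rw [e, fderiv_fun_mul hσd hYs, hσ0, smul_zero, add_zero]
    exact congrArg (fun r => σ u * r) (fderiv_spaceDir hYd (stdFrame i)).symm
  have hR : 0 < densityInChart φ x y₀ (0, u) := Real.sqrt_pos.2 hpos
  have hR2 : densityInChart φ x y₀ (0, u) ^ 2 =
      gramDet (chartMetric y₀) (variationInChart 3 6 φ x y₀) stdFrame (0, u) :=
    Real.sq_sqrt hpos.le
  rw [formInner_two_chart hA hφ hL ho x y₀ hz hV, formInner_three_chart hA hφ hL ho x y₀ hz hV,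
    Finset.sum_congr rfl fun i _ => hdiv i, ← Finset.mul_sum, ← hR2]
  have key2 := key.2
  rw [sum_fderiv_fderiv_sliceForm hO hF hFU hNK stdFrame hz] at key2
  have hσu : σ u = sliceTop (starTorsionForm (chartMetric y₀) (chartJ A y₀))
    (variationInChart 3 6 φ x y₀) stdFrame (0, u) / (lam ^ 2 * densityInChart φ x y₀ (0, u)) := rfl
  rw [hσu]
  change lam ^ 2 * (densityInChart φ x y₀ (0, u) *
    fderiv ℝ (fun z => fderiv ℝ (densityInChart φ x y₀) z timeDir) (0, u) timeDir) = _ at key2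
  have hne : lam ^ 2 * densityInChart φ x y₀ (0, u) ≠ 0 := by positivity
  apply mul_left_cancel₀ hne
  rw [mul_assoc, key2]
  field_simp
  ring

end PointwiseFormula

/-! ### Support and continuity of the integrands -/

section LocalityOfIntegrands

/-- A function is continuous if each point has a chart around it in which it is continuous there. -/
theorem continuous_of_chart {m : ℕ} {L : Type*} [TopologicalSpace L]
    [ChartedSpace (EuclideanSpace ℝ (Fin m)) L] {h : L → ℝ}
    (H : ∀ x : L, ContinuousAt (fun u => h ((extChartAt (𝓡 m) x).symm u)) (extChartAt (𝓡 m) x x)) :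
    Continuous h := by
  refine continuous_iff_continuousAt.2 fun x => ?_
  have h1 := (H x).comp (continuousAt_extChartAt (I := 𝓡 m) x)
  refine h1.congr ?_
  filter_upwards [extChartAt_source_mem_nhds (I := 𝓡 m) x] with y hy
  simp only [Function.comp_apply, (extChartAt (𝓡 m) x).left_inv hy]

/-- The exterior derivative is a local operator. -/
theorem dForm_eq_zero_of_eventually {n : ℕ} {M : Type*} [TopologicalSpace M]
    [ChartedSpace (EuclideanSpace ℝ (Fin n)) M] {k : ℕ}
    {η : ∀ y : M, TangentSpace (𝓡 n) y [⋀^Fin k]→L[ℝ] ℝ} {x : M} (h : ∀ᶠ y in 𝓝 x, η y = 0) :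
    dForm η x = 0 := by
  have hc : Tendsto (extChartAt (𝓡 n) x).symm (𝓝 (extChartAt (𝓡 n) x x)) (𝓝 x) := by
    have := continuousAt_extChartAt_symm (I := 𝓡 n) x
    rwa [ContinuousAt, extChartAt_to_inv] at this
  have h0 : formInChart η x =ᶠ[𝓝 (extChartAt (𝓡 n) x x)] fun _ => 0 := by
    filter_upwards [hc.eventually h] with u hu
    rw [formInChart, hu]
    rfl
  have h1 : extDeriv (formInChart η x) (extChartAt (𝓡 n) x x) = 0 := by
    rw [extDeriv, h0.fderiv_eq, fderiv_fun_const]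
    ext v
    simp [ContinuousAlternatingMap.alternatizeUncurryFin_apply]
  rw [dForm, h1]
  rfl

variable {M : Type*} [TopologicalSpace M] [ChartedSpace (EuclideanSpace ℝ (Fin 6)) M]
  [IsManifold (𝓡 6) ∞ M] [RiemannianBundle (fun x : M => TangentSpace (𝓡 6) x)]
  [IsContMDiffRiemannianBundle (𝓡 6) ∞ (EuclideanSpace ℝ (Fin 6))
    (fun x : M => TangentSpace (𝓡 6) x)]
  {A : AlmostHermitianStructure 6 M} {lam : ℝ} (hA : IsStrictNearlyKahlerOfConstantType A lam)
  {L : Type*} [TopologicalSpace L] [ChartedSpace (EuclideanSpace ℝ (Fin 3)) L]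
  [IsManifold (𝓡 3) ∞ L] [RiemannianBundle (fun x : L => TangentSpace (𝓡 3) x)]
  {ε : ℝ} {φ : ℝ → L → M}
  (hφ : ContMDiffOn (𝓘(ℝ, ℝ).prod (𝓡 3)) (𝓡 6) ∞ (fun p : ℝ × L => φ p.1 p.2)
    (Ioo (-ε) ε ×ˢ univ))
  (hε : 0 < ε)
  (hL : IsLagrangian A (φ 0)) {o : ∀ x : L, Orientation ℝ (TangentSpace (𝓡 3) x) (Fin 3)}
  (ho : IsCanonicalOrientation A lam (φ 0) o)
  {V : ∀ y : L, TangentSpace (𝓡 6) (φ 0 y)}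
  (hV : ∀ y, V y = mfderiv 𝓘(ℝ, ℝ) (𝓡 6) (fun t => φ t y) 0 (1 : ℝ))
  {K : Set L} (hK : IsClosed K) (hsupp : ∀ t ∈ Ioo (-ε) ε, ∀ y ∉ K, φ t y = φ 0 y)

section
include hsupp

omit [IsManifold (𝓡 6) ∞ M] [RiemannianBundle (fun x : M => TangentSpace (𝓡 6) x)]
  [IsContMDiffRiemannianBundle (𝓡 6) ∞ (EuclideanSpace ℝ (Fin 6))
    (fun x : M => TangentSpace (𝓡 6) x)] in
theorem mfderiv_time_eq_zero {t : ℝ} (ht : t ∈ Ioo (-ε) ε) {y : L} (hy : y ∉ K) :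
    mfderiv 𝓘(ℝ, ℝ) (𝓡 6) (fun s => φ s y) t (1 : ℝ) = 0 := by
  have e : (fun s => φ s y) =ᶠ[𝓝 t] fun _ => φ 0 y := by
    filter_upwards [Ioo_mem_nhds ht.1 ht.2] with s hs using hsupp s hs y hy
  have h : HasMFDerivAt 𝓘(ℝ, ℝ) (𝓡 6) (fun s => φ s y) t _ :=
    (hasMFDerivAt_const (I := 𝓘(ℝ, ℝ)) (I' := 𝓡 6) (φ 0 y) t).congr_of_eventuallyEq e
  rw [h.mfderiv]
  rfl

include hε

/-- The flux form vanishes where the variation is constant in time. -/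
theorem fluxForm_eq_zero {y : L} (hy : y ∉ K) (a b : TangentSpace (𝓡 3) y) :
    fluxForm A lam φ y a b = 0 := by
  have e : (fun t => -imPhi A lam (φ t y) (mfderiv 𝓘(ℝ, ℝ) (𝓡 6) (fun s => φ s y) t (1 : ℝ))
      (mfderiv (𝓡 3) (𝓡 6) (φ t) y a) (mfderiv (𝓡 3) (𝓡 6) (φ t) y b)) =ᶠ[𝓝 0] fun _ => 0 := by
    filter_upwards [Ioo_mem_nhds (neg_neg_iff_pos.2 hε) hε] with t ht
    rw [mfderiv_time_eq_zero hsupp ht hy, imPhi]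
    rw [(dForm A.omega (φ t y)).map_coord_zero 0 rfl, mul_zero, neg_zero]
  rw [fluxForm, e.deriv_eq, deriv_const]

theorem fluxVector_eq_zero {y : L} (hy : y ∉ K) {W : TangentSpace (𝓡 3) y}
    (hW : ∀ a b, fluxForm A lam φ y a b = (o y).volumeForm ![W, a, b]) : W = 0 := by
  have h := sum_volumeForm_smul (o y) (threeBasis (TangentSpace (𝓡 3) y)) W
  simp only [← hW, fluxForm_eq_zero hε hsupp hy, zero_smul, Finset.sum_const_zero] at h
  refine (smul_eq_zero.1 h.symm).resolve_left fun h0 => ?_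
  have h1 := (o y).abs_volumeForm_apply_of_orthonormal (threeBasis (TangentSpace (𝓡 3) y))
  rw [h0] at h1
  simp at h1

include hV

theorem lOmega_eq_zero {y : L} (hy : y ∉ K) : lOmega A (φ 0) V y = 0 := by
  rw [lOmega, hV, mfderiv_time_eq_zero hsupp ⟨neg_neg_iff_pos.2 hε, hε⟩ hy, map_zero, map_zero]
  rfl

theorem starLOmega_eq_zero {y : L} (hy : y ∉ K) : starLOmega A (φ 0) o V y = 0 := by
  rw [starLOmega, lOmega_eq_zero hε hV hsupp hy]
  ext v
  have h : hodgeStar (o y) 0 ![v 0, v 1] = 0 := by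
    rw [hodgeStar_apply, map_zero]
    exact (o y).volumeForm.map_coord_zero 0 rfl
  refine Eq.trans (congrArg (hodgeStar (o y) 0) (funext fun i => ?_)) h
  fin_cases i <;> rfl

include hK

theorem dOne_lOmega_eq_zero {y : L} (hy : y ∉ K) : dOne (lOmega A (φ 0) V) y = 0 := by
  refine dForm_eq_zero_of_eventually ?_
  filter_upwards [hK.isOpen_compl.mem_nhds hy] with z hz
  rw [lOmega_eq_zero hε hV hsupp hz]
  ext v
  rfl

theorem dForm_starLOmega_eq_zero {y : L} (hy : y ∉ K) : dForm (starLOmega A (φ 0) o V) y = 0 := by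
  refine dForm_eq_zero_of_eventually ?_
  filter_upwards [hK.isOpen_compl.mem_nhds hy] with z hz
  exact starLOmega_eq_zero hε hV hsupp hz

end

include hε in
omit [IsManifold (𝓡 6) ∞ M] [RiemannianBundle (fun x : M => TangentSpace (𝓡 6) x)]
  [IsContMDiffRiemannianBundle (𝓡 6) ∞ (EuclideanSpace ℝ (Fin 6))
    (fun x : M => TangentSpace (𝓡 6) x)] in
theorem mem_variationDomain_self (x : L) :
    (0, extChartAt (𝓡 3) x x) ∈ variationDomain 3 6 ε φ x (φ 0 x) := by
  refine ⟨⟨⟨by simpa, hε⟩, mem_extChartAt_target x⟩, ?_⟩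
  simp only [extChartAt_to_inv]
  exact mem_extChartAt_source _

include hA hφ hε hL

theorem continuous_formInner_two (ho : IsCanonicalOrientation A lam (φ 0) o)
    (hV : ∀ y, V y = mfderiv 𝓘(ℝ, ℝ) (𝓡 6) (fun t => φ t y) 0 (1 : ℝ)) :
    Continuous fun y => formInner (dOne (lOmega A (φ 0) V) y -
        (3 * lam) • starLOmega A (φ 0) o V y)
      (dOne (lOmega A (φ 0) V) y + lam • starLOmega A (φ 0) o V y) := by
  refine continuous_of_chart (m := 3) fun x => ?_
  have hz := mem_variationDomain_self (φ := φ) hε x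
  have hO := isOpen_variationDomain hφ x (φ 0 x)
  have hF := contDiffOn_variationInChart hφ x (φ 0 x)
  have hFU := mapsTo_variationInChart (m := 3) (n := 6) (ε := ε) (φ := φ) x (φ 0 x)
  have hNK := isLocalNearlyKahler_chart A hA (φ 0 x)
  have hΩ := isOpen_initialSlice hO
  have hw : ∀ i, ContDiffOn ℝ ∞ (fun z => fderiv ℝ (sliceForm (kahlerForm (chartMetric (φ 0 x))
      (chartJ A (φ 0 x))) (variationInChart 3 6 φ x (φ 0 x)) stdFrame i) z timeDir)
      (variationDomain 3 6 ε φ x (φ 0 x)) := fun i =>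
    ((contDiffOn_pullTwo hO hF hFU hNK.smooth_kahlerForm _ _).fderiv_of_isOpen hO (m := ∞)
      (by simp)).clm_apply contDiffOn_const
  have hθ : ∀ i, ContDiffOn ℝ ∞ (sliceContraction (kahlerForm (chartMetric (φ 0 x))
      (chartJ A (φ 0 x))) (variationInChart 3 6 φ x (φ 0 x)) stdFrame i)
      (variationDomain 3 6 ε φ x (φ 0 x)) := fun i =>
    contDiffOn_pullTwo hO hF hFU hNK.smooth_kahlerForm _ _
  have hG := fun i j => contDiffOn_pullTwo hO hF hFU hNK.smooth_g (spaceDir (stdFrame i))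
    (spaceDir (stdFrame j))
  have hS : ContDiffOn ℝ ∞ (sliceTop (starTorsionForm (chartMetric (φ 0 x)) (chartJ A (φ 0 x)))
      (variationInChart 3 6 φ x (φ 0 x)) stdFrame) (variationDomain 3 6 ε φ x (φ 0 x)) :=
    contDiffOn_pullThree hO hF hFU hNK.smooth_starTorsionForm _ _ _
  have hD := contDiffOn_gramDet hO hF hFU hNK stdFrame
  have hnum := (ContDiffOn.sum (s := Finset.univ) fun i _ => ContDiffOn.sum (s := Finset.univ)
    fun j _ => ((hw i).mul (hw j)).mul (hG i j)).add (((contDiffOn_const (c := (4 : ℝ))).mul hS).mul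
      (ContDiffOn.sum (s := Finset.univ) fun i _ => (hθ i).mul (hw i)))
  have hq := ((contDiffOn_initialSlice hnum).continuousOn.div (contDiffOn_initialSlice hD).continuousOn
    fun q hq => (gramDet_initial_pos hφ hL x (φ 0 x) hq).ne').continuousAt (hΩ.mem_nhds hz)
  refine hq.congr ?_
  filter_upwards [hΩ.mem_nhds hz] with q hq
  exact (formInner_two_chart hA hφ hL ho x (φ 0 x) hq hV).symm

theorem continuous_formInner_three (ho : IsCanonicalOrientation A lam (φ 0) o)
    (hV : ∀ y, V y = mfderiv 𝓘(ℝ, ℝ) (𝓡 6) (fun t => φ t y) 0 (1 : ℝ)) :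
    Continuous fun y => formInner (dForm (starLOmega A (φ 0) o V) y)
      (dForm (starLOmega A (φ 0) o V) y) := by
  refine continuous_of_chart (m := 3) fun x => ?_
  have hz := mem_variationDomain_self (φ := φ) hε x
  have hO := isOpen_variationDomain hφ x (φ 0 x)
  have hF := contDiffOn_variationInChart hφ x (φ 0 x)
  have hFU := mapsTo_variationInChart (m := 3) (n := 6) (ε := ε) (φ := φ) x (φ 0 x)
  have hNK := isLocalNearlyKahler_chart A hA (φ 0 x)
  have hΩ := isOpen_initialSlice hO
  have hT : ∀ i, ContDiffOn ℝ ∞ (fun z => fderiv ℝ (sliceContractionThree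
      (torsionForm (chartMetric (φ 0 x)) (chartJ A (φ 0 x))) (variationInChart 3 6 φ x (φ 0 x))
      stdFrame i) z (spaceDir (stdFrame i))) (variationDomain 3 6 ε φ x (φ 0 x)) := fun i =>
    ((contDiffOn_pullThree hO hF hFU hNK.smooth_torsionForm _ _ _).fderiv_of_isOpen hO (m := ∞)
      (by simp)).clm_apply contDiffOn_const
  have hD := contDiffOn_gramDet hO hF hFU hNK stdFrame
  have hnum := ((contDiffOn_const (c := lam⁻¹)).mul
    (ContDiffOn.sum (s := Finset.univ) fun i _ => hT i)).pow 2
  have hq := ((contDiffOn_initialSlice hnum).continuousOn.div (contDiffOn_initialSlice hD).continuousOn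
    fun q hq => (gramDet_initial_pos hφ hL x (φ 0 x) hq).ne').continuousAt (hΩ.mem_nhds hz)
  refine hq.congr ?_
  filter_upwards [hΩ.mem_nhds hz] with q hq
  exact (formInner_three_chart hA hφ hL ho x (φ 0 x) hq hV).symm

theorem continuous_mvfderiv_fluxVector (ho : IsCanonicalOrientation A lam (φ 0) o)
    {W : ∀ y : L, TangentSpace (𝓡 3) y}
    (hW : ∀ y a b, fluxForm A lam φ y a b = (o y).volumeForm ![W y, a, b]) {ρ : L → ℝ}
    (hρ : ContMDiff (𝓡 3) 𝓘(ℝ, ℝ) ∞ ρ) : Continuous fun y => mvfderiv (𝓡 3) ρ y (W y) := by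
  refine continuous_of_chart (m := 3) fun x => ?_
  have hz := mem_variationDomain_self (φ := φ) hε x
  have hO := isOpen_variationDomain hφ x (φ 0 x)
  have hΩ := isOpen_initialSlice hO
  have hR := (contDiffOn_initialSlice (contDiffOn_densityInChart hA hφ x (φ 0 x))).mono
    (s := {q | (0, q) ∈ immersionDomain ε φ x (φ 0 x)})
    (t := {q | (0, q) ∈ variationDomain 3 6 ε φ x (φ 0 x)})
    fun q hq => mem_immersionDomain hφ hL x (φ 0 x) hq
  have hpos : ∀ q, (0, q) ∈ variationDomain 3 6 ε φ x (φ 0 x) →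
      0 < densityInChart φ x (φ 0 x) (0, q) := fun q hq =>
    Real.sqrt_pos.2 (gramDet_initial_pos hφ hL x (φ 0 x) hq)
  have hρc : ContDiffOn ℝ ∞ (ρ ∘ (extChartAt (𝓡 3) x).symm)
      {q | (0, q) ∈ variationDomain 3 6 ε φ x (φ 0 x)} :=
    (hρ.comp_contMDiffOn ((contMDiffOn_extChartAt_symm x).mono fun q hq => hq.1.2)).contDiffOn
  have hsum := ContDiffOn.sum (s := Finset.univ) fun i (_ : i ∈ Finset.univ) =>
    ((hρc.fderiv_of_isOpen hΩ (m := ∞) (by simp)).clm_apply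
      (contDiffOn_const (c := stdFrame i))).mul (contDiffOn_fluxField hA hφ hL x (φ 0 x) i)
  have hq := (hsum.continuousOn.div hR.continuousOn fun q hq => (hpos q hq).ne').continuousAt
    (hΩ.mem_nhds hz)
  refine hq.congr ?_
  filter_upwards [hΩ.mem_nhds hz] with q hq
  have h1 := sum_mul_fluxField hA hφ hL ho x (φ 0 x) hq (hW _)
    (mvfderiv (𝓡 3) ρ ((extChartAt (𝓡 3) x).symm q)).toLinearMap
  have h2 : ∀ i, mvfderiv (𝓡 3) ρ ((extChartAt (𝓡 3) x).symm q) (chartFrame x q (stdFrame i)) =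
      fderiv ℝ (ρ ∘ (extChartAt (𝓡 3) x).symm) q (stdFrame i) := fun i =>
    mvfderiv_chartFrame x hq.1.2 ((hρ _).mdifferentiableAt (by simp)) _
  refine (div_eq_iff (hpos q hq).ne').2 (Eq.trans ?_ (h1.trans (mul_comm _ _)))
  exact Finset.sum_congr rfl fun i _ => congrArg (fun r : ℝ => r * _) (h2 i).symm

end LocalityOfIntegrands

/-! ### The second variation localized in a chart -/

section LocalizedVariation

theorem mvfderiv_eq_zero_of_eventually_const {m : ℕ} {L : Type*} [TopologicalSpace L]
    [ChartedSpace (EuclideanSpace ℝ (Fin m)) L] {ρ : L → ℝ} {y : L} {c : ℝ}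
    (h : ρ =ᶠ[𝓝 y] fun _ => c) (v : TangentSpace (𝓡 m) y) : mvfderiv (𝓡 m) ρ y v = 0 := by
  have h1 : HasMFDerivAt (𝓡 m) 𝓘(ℝ, ℝ) ρ y 0 :=
    (hasMFDerivAt_const (I := 𝓡 m) (I' := 𝓘(ℝ, ℝ)) c y).congr_of_eventuallyEq h
  exact congrArg (fun B : TangentSpace (𝓡 m) y →L[ℝ] ℝ => B v) h1.mfderiv

theorem mvfderiv_sum {m : ℕ} {L : Type*} [TopologicalSpace L]
    [ChartedSpace (EuclideanSpace ℝ (Fin m)) L] {ι : Type*} (s : Finset ι) {ρ : ι → L → ℝ} {y : L}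
    (h : ∀ i ∈ s, MDifferentiableAt (𝓡 m) 𝓘(ℝ, ℝ) (ρ i) y) (v : TangentSpace (𝓡 m) y) :
    MDifferentiableAt (𝓡 m) 𝓘(ℝ, ℝ) (∑ i ∈ s, ρ i) y ∧
    mvfderiv (𝓡 m) (∑ i ∈ s, ρ i) y v = ∑ i ∈ s, mvfderiv (𝓡 m) (ρ i) y v := by
  classical
  induction s using Finset.induction_on with
  | empty =>
    rw [Finset.sum_empty, Finset.sum_empty, mvfderiv_zero]
    exact ⟨mdifferentiableAt_const (c := (0 : ℝ)), rfl⟩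
  | insert i s hi ih =>
    obtain ⟨h1, h2⟩ := ih fun j hj => h j (Finset.mem_insert_of_mem hj)
    have h3 := h i (Finset.mem_insert_self i s)
    rw [Finset.sum_insert hi, Finset.sum_insert hi, mvfderiv_add h3 h1, ← h2]
    exact ⟨h3.add h1, rfl⟩

/-- A measurable function in coordinates, cut off by a closed subset of the domain of the
coordinates; outside of this domain the inverse of the chart need not be measurable. -/
theorem measurable_indicator_comp_symm {m : ℕ} {L : Type*} [TopologicalSpace L]
    [ChartedSpace (EuclideanSpace ℝ (Fin m)) L] [MeasurableSpace L] [BorelSpace L] (x : L)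
    {C : Set (EuclideanSpace ℝ (Fin m))} (hC : IsClosed C) (hCt : C ⊆ (extChartAt (𝓡 m) x).target)
    {h : L → ℝ} (hm : Measurable h) :
    Measurable (C.indicator fun u => h ((extChartAt (𝓡 m) x).symm u)) := by
  refine measurable_of_restrict_of_restrict_compl hC.measurableSet ?_ ?_
  · have e : C.domRestrict (C.indicator fun u => h ((extChartAt (𝓡 m) x).symm u)) =
        h ∘ C.domRestrict (extChartAt (𝓡 m) x).symm := by
      funext u
      simp
    rw [e]
    exact hm.comp (continuousOn_iff_continuous_domRestrict.1
      ((continuousOn_extChartAt_symm x).mono hCt)).measurable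
  · have e : Cᶜ.domRestrict (C.indicator fun u => h ((extChartAt (𝓡 m) x).symm u)) =
        fun _ => 0 := by
      funext u
      simpa using fun hu => absurd hu u.2
    rw [e]
    exact measurable_const

variable {M : Type*} [TopologicalSpace M] [ChartedSpace (EuclideanSpace ℝ (Fin 6)) M]
  [IsManifold (𝓡 6) ∞ M] [RiemannianBundle (fun x : M => TangentSpace (𝓡 6) x)]
  [IsContMDiffRiemannianBundle (𝓡 6) ∞ (EuclideanSpace ℝ (Fin 6))
    (fun x : M => TangentSpace (𝓡 6) x)]
  {A : AlmostHermitianStructure 6 M} {lam : ℝ} (hA : IsStrictNearlyKahlerOfConstantType A lam)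
  {L : Type*} [TopologicalSpace L] [T2Space L] [SecondCountableTopology L] [MeasurableSpace L]
  [BorelSpace L] [ChartedSpace (EuclideanSpace ℝ (Fin 3)) L]
  [IsManifold (𝓡 3) ∞ L]
  {ε : ℝ} {φ : ℝ → L → M}
  (hφ : ContMDiffOn (𝓘(ℝ, ℝ).prod (𝓡 3)) (𝓡 6) ∞ (fun p : ℝ × L => φ p.1 p.2)
    (Ioo (-ε) ε ×ˢ univ))

include hφ in
/-- The integral of a function supported in a chart, against the volume of a slice. -/
theorem integral_inducedVolume_localized {t : ℝ} (ht : t ∈ Ioo (-ε) ε) (x : L) (y₀ : M)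
    {C : Set (EuclideanSpace ℝ (Fin 3))} (hCO : ∀ u ∈ C, (t, u) ∈ variationDomain 3 6 ε φ x y₀)
    {h : L → ℝ} (hm : Measurable h)
    (h0 : ∀ y, h y ≠ 0 → y ∈ (extChartAt (𝓡 3) x).source ∧ extChartAt (𝓡 3) x y ∈ C) :
    ∫ y, h y ∂(inducedVolume 3 6 (φ t)) =
      ∫ u, C.indicator (fun u => h ((extChartAt (𝓡 3) x).symm u)) u *
        densityInChart φ x y₀ (t, u) := by
  rw [integral_inducedVolume_eq (φ t) (contMDiff_variation_slice hφ ht) x h hm.stronglyMeasurable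
    fun y hy => by_contra fun hn => hy (h0 y hn).1,
    ← integral_indicator (isOpen_extChartAt_target (I := 𝓡 3) x).measurableSet]
  refine integral_congr_ae (Filter.Eventually.of_forall fun u => ?_)
  by_cases hu : u ∈ C
  · have hz := hCO u hu
    simp only [indicator_of_mem hu, indicator_of_mem hz.1.2]
    rw [chartDensity_eq_gramDet hφ x y₀ hz, mul_comm]
    rfl
  · simp only [indicator_of_notMem hu, zero_mul]
    by_cases hut : u ∈ (extChartAt (𝓡 3) x).target
    · rw [indicator_of_mem hut]
      have : h ((extChartAt (𝓡 3) x).symm u) = 0 := by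
        by_contra hn
        have := (h0 _ hn).2
        rw [(extChartAt (𝓡 3) x).right_inv hut] at this
        exact hu this
      rw [this, mul_zero]
    · rw [indicator_of_notMem hut]

variable [RiemannianBundle (fun x : L => TangentSpace (𝓡 3) x)] (hε : 0 < ε)
  (hL : IsLagrangian A (φ 0)) {o : ∀ x : L, Orientation ℝ (TangentSpace (𝓡 3) x) (Fin 3)}
  (ho : IsCanonicalOrientation A lam (φ 0) o)
  {V : ∀ y : L, TangentSpace (𝓡 6) (φ 0 y)}
  (hV : ∀ y, V y = mfderiv 𝓘(ℝ, ℝ) (𝓡 6) (fun t => φ t y) 0 (1 : ℝ))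
  {K : Set L} (hK : IsClosed K) (hsupp : ∀ t ∈ Ioo (-ε) ε, ∀ y ∉ K, φ t y = φ 0 y)
  {W : ∀ y : L, TangentSpace (𝓡 3) y}
  (hW : ∀ y a b, fluxForm A lam φ y a b = (o y).volumeForm ![W y, a, b])

/-- The integrand of the second variation. -/
noncomputable def secondVariationIntegrand
    (A : AlmostHermitianStructure 6 M) (lam : ℝ) (f : L → M)
    (o : ∀ x : L, Orientation ℝ (TangentSpace (𝓡 3) x) (Fin 3))
    (V : ∀ y : L, TangentSpace (𝓡 6) (f y)) (y : L) : ℝ :=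
  formInner (dOne (lOmega A f V) y - (3 * lam) • starLOmega A f o V y)
    (dOne (lOmega A f V) y + lam • starLOmega A f o V y) +
  formInner (dForm (starLOmega A f o V) y) (dForm (starLOmega A f o V) y)

include hε hV hK hsupp in
theorem secondVariationIntegrand_eq_zero {y : L} (hy : y ∉ K) :
    secondVariationIntegrand A lam (φ 0) o V y = 0 := by
  rw [secondVariationIntegrand, dOne_lOmega_eq_zero hε hV hK hsupp hy,
    dForm_starLOmega_eq_zero hε hV hK hsupp hy, starLOmega_eq_zero hε hV hsupp hy]
  simp [formInner]

include hA hφ hε hL ho hV in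
theorem continuous_secondVariationIntegrand :
    Continuous (secondVariationIntegrand A lam (φ 0) o V) :=
  (continuous_formInner_two hA hφ hε hL ho hV).add (continuous_formInner_three hA hφ hε hL ho hV)

include hA hφ hε hL ho hV hK hsupp in
/-- Outside of `K` the density of the variation is constant to second order. -/
theorem fderiv_fderiv_densityInChart_eq_zero (x : L) (y₀ : M) {u : EuclideanSpace ℝ (Fin 3)}
    (hz : (0, u) ∈ variationDomain 3 6 ε φ x y₀) (hu : (extChartAt (𝓡 3) x).symm u ∉ K) :
    fderiv ℝ (fun z => fderiv ℝ (densityInChart φ x y₀) z timeDir) (0, u) timeDir = 0 := by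
  have hl := (isLocalNearlyKahler_chart A hA y₀).lam_pos
  have h1 := fderiv_fderiv_densityInChart hA hφ hL ho x y₀ hz hV
  have h2 := secondVariationIntegrand_eq_zero (A := A) (lam := lam) (o := o) hε hV hK hsupp hu
  rw [secondVariationIntegrand] at h2
  rw [h1, h2, mul_zero, zero_add]
  refine Finset.sum_eq_zero fun i _ => ?_
  have hc : ContinuousAt (extChartAt (𝓡 3) x).symm u :=
    (continuousOn_extChartAt_symm x).continuousAt ((isOpen_extChartAt_target x).mem_nhds hz.1.2)
  have e : fluxField A lam φ x y₀ i =ᶠ[𝓝 u] fun _ => 0 := by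
    filter_upwards [(isOpen_initialSlice (isOpen_variationDomain hφ x y₀)).mem_nhds hz,
      hc.eventually (hK.isOpen_compl.mem_nhds hu)] with q hq hqK
    have h3 := fluxForm_chart hA hφ x y₀ hq (stdFrame (i + 1)) (stdFrame (i + 2))
    rw [fluxForm_eq_zero hε hsupp hqK] at h3
    have h4 := (mul_eq_zero.1 h3.symm).resolve_left (inv_ne_zero hl.ne')
    rw [fluxField]
    exact mul_eq_zero_of_right _ h4
  rw [e.fderiv_eq]
  simp

include hA hφ hε hL ho hV hK hsupp hW in
/-- The first and second variation of the volume, localized by a cutoff function `ρ` supported in a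
chart: the divergence of the flux field turns into a derivative of `ρ`. -/
theorem second_variation_localized (x : L) {C : Set (EuclideanSpace ℝ (Fin 3))} (hC : IsCompact C)
    {δ : ℝ} (hδ : 0 < δ) (hδε : δ ≤ ε) (hCO : Icc (-δ) δ ×ˢ C ⊆ immersionDomain ε φ x (φ 0 x))
    {ρ : L → ℝ} (hρ : ContMDiff (𝓡 3) 𝓘(ℝ, ℝ) ∞ ρ) (hρ0 : ∀ y, 0 ≤ ρ y) (hρ1 : ∀ y, ρ y ≤ 1)
    (hρC : ∀ y, ρ y ≠ 0 → y ∈ (extChartAt (𝓡 3) x).source ∧ extChartAt (𝓡 3) x y ∈ C) :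
    ∃ D : ℝ → ℝ,
      (∀ t ∈ Ioo (-δ) δ, HasDerivAt (fun s => ∫ y, K.indicator ρ y ∂(inducedVolume 3 6 (φ s)))
        (D t) t) ∧
      HasDerivAt D (∫ y, ρ y * secondVariationIntegrand A lam (φ 0) o V y
          ∂(inducedVolume 3 6 (φ 0)) -
        ∫ y, mvfderiv (𝓡 3) ρ y (W y) ∂(inducedVolume 3 6 (φ 0))) 0 := by
  set c := extChartAt (𝓡 3) x with hc
  set R := densityInChart φ x (φ 0 x) with hRdef
  set Q := secondVariationIntegrand A lam (φ 0) o V with hQdef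
  have hOo := isOpen_immersionDomain hA hφ x (φ 0 x)
  have hRs := contDiffOn_densityInChart hA hφ x (φ 0 x)
  have h0δ : (0 : ℝ) ∈ Ioo (-δ) δ := ⟨neg_neg_iff_pos.2 hδ, hδ⟩
  have hCt : ∀ t ∈ Ioo (-δ) δ, ∀ u ∈ C, (t, u) ∈ variationDomain 3 6 ε φ x (φ 0 x) :=
    fun t ht u hu => (hCO ⟨⟨ht.1.le, ht.2.le⟩, hu⟩).1
  have hCT : C ⊆ c.target := fun u hu => (hCt 0 h0δ u hu).1.2
  have hKρ : Measurable (K.indicator ρ) := hρ.continuous.measurable.indicator hK.measurableSet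
  have hKρC : ∀ y, K.indicator ρ y ≠ 0 → y ∈ c.source ∧ c y ∈ C := fun y hy =>
    hρC y fun h => hy (by by_cases hyK : y ∈ K <;> simp [hyK, h])
  -- The weight `χ` is cut off along `K` and only measurable; it serves to differentiate under the
  -- integral sign. Integration by parts uses the smooth weight `ψ` below. The two may be exchanged,
  -- since the second time derivative of the density vanishes outside of `K`.
  set χ : EuclideanSpace ℝ (Fin 3) → ℝ := C.indicator fun u => K.indicator ρ (c.symm u) with hχ
  have hχm : Measurable χ := measurable_indicator_comp_symm x hC.isClosed hCT hKρ
  have hχb : ∀ u, |χ u| ≤ 1 := fun u => by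
    have h1 : ∀ y, |K.indicator ρ y| ≤ 1 := fun y => by
      by_cases hy : y ∈ K
      · simp only [indicator_of_mem hy, abs_of_nonneg (hρ0 y), hρ1 y]
      · simp [hy]
    by_cases hu : u ∈ C
    · simpa only [hχ, indicator_of_mem hu] using h1 _
    · simp [hχ, hu]
  have hχ0 : ∀ u ∉ C, χ u = 0 := fun u hu => by simp [hχ, hu]
  have hI : ∀ t ∈ Ioo (-δ) δ, ∫ y, K.indicator ρ y ∂(inducedVolume 3 6 (φ t)) =
      ∫ u, χ u * R (t, u) := fun t ht =>
    integral_inducedVolume_localized hφ ⟨by linarith [ht.1], by linarith [ht.2]⟩ x (φ 0 x)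
      (hCt t ht) hKρ hKρC
  have hR1 : ContDiffOn ℝ 1 R (immersionDomain ε φ x (φ 0 x)) := hRs.of_le (by simp)
  have hR2 : ContDiffOn ℝ 1 (fun z => fderiv ℝ R z (1, 0)) (immersionDomain ε φ x (φ 0 x)) :=
    (hRs.fderiv_of_isOpen hOo (m := 1) (by norm_num; exact ENat.LEInfty.out)).clm_apply
      contDiffOn_const
  refine ⟨fun t => ∫ u, χ u * fderiv ℝ R (t, u) (1, 0), fun t ht => ?_, ?_⟩
  · refine (hasDerivAt_integral_weight hOo hR1 hC hCO hχm hχb hχ0 ht).congr_of_eventuallyEq ?_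
    filter_upwards [Ioo_mem_nhds ht.1 ht.2] with s hs using hI s hs
  refine (hasDerivAt_integral_weight hOo hR2 hC hCO hχm hχb hχ0 h0δ).congr_deriv ?_
  -- The second derivative of the density is the integrand plus a divergence.
  set Ω : Set (EuclideanSpace ℝ (Fin 3)) := {q | (0, q) ∈ variationDomain 3 6 ε φ x (φ 0 x)}
    with hΩdef
  have hΩ : IsOpen Ω := isOpen_initialSlice (isOpen_variationDomain hφ x (φ 0 x))
  have hCΩ : C ⊆ Ω := fun u hu => hCt 0 h0δ u hu
  set ψ : EuclideanSpace ℝ (Fin 3) → ℝ := C.indicator fun u => ρ (c.symm u) with hψ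
  have hψ0 : ∀ u ∉ C, ψ u = 0 := fun u hu => by simp [hψ, hu]
  have hψe : ∀ u ∈ c.target, ψ u = ρ (c.symm u) := fun u hu => by
    by_cases huC : u ∈ C
    · simp [hψ, huC]
    · rw [hψ0 u huC]
      by_contra hn
      have := (hρC _ (Ne.symm hn)).2
      rw [c.right_inv hu] at this
      exact huC this
  have hψs : ContDiffOn ℝ ∞ ψ Ω := by
    have h1 : ContDiffOn ℝ ∞ (ρ ∘ c.symm) Ω :=
      (hρ.comp_contMDiffOn ((contMDiffOn_extChartAt_symm x).mono fun q hq => hq.1.2)).contDiffOn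
    exact h1.congr fun u hu => hψe u hu.1.2
  have hZ := contDiffOn_fluxField hA hφ hL x (φ 0 x)
  have hint : ∀ h : EuclideanSpace ℝ (Fin 3) → ℝ, ContinuousOn h Ω →
      Integrable (fun u => ψ u * h u) := fun h hh => by
    have h1 : ContinuousOn (fun u => ψ u * h u) C := (hψs.continuousOn.mul hh).mono hCΩ
    refine (integrableOn_iff_integrable_of_support_subset fun u hu => ?_).1
      (h1.integrableOn_compact hC)
    by_contra hn
    exact hu (by simp [hψ0 u hn])
  have hRΩ : ContinuousOn (fun u => R (0, u)) Ω :=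
    ((contDiffOn_initialSlice hRs).mono
      (s := {q | (0, q) ∈ immersionDomain ε φ x (φ 0 x)})
      fun q hq => mem_immersionDomain hφ hL x (φ 0 x) hq).continuousOn
  have hQc : Continuous Q := continuous_secondVariationIntegrand hA hφ hε hL ho hV
  have hQΩ : ContinuousOn (fun u => R (0, u) * Q (c.symm u)) Ω :=
    hRΩ.mul (hQc.comp_continuousOn ((continuousOn_extChartAt_symm x).mono fun q hq => hq.1.2))
  have hZΩ : ∀ i, ContinuousOn (fun u => fderiv ℝ (fluxField A lam φ x (φ 0 x) i) u (stdFrame i)) Ω :=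
    fun i => ((hZ i).continuousOn_fderiv_of_isOpen hΩ (by simp)).clm_apply continuousOn_const
  have e1 : ∀ u, χ u * fderiv ℝ (fun z => fderiv ℝ R z (1, 0)) (0, u) (1, 0) =
      ψ u * (R (0, u) * Q (c.symm u)) +
        ∑ i, ψ u * fderiv ℝ (fluxField A lam φ x (φ 0 x) i) u (stdFrame i) := by
    intro u
    by_cases hu : u ∈ C
    · have h1 := fderiv_fderiv_densityInChart hA hφ hL ho x (φ 0 x) (hCΩ hu) hV
      rw [← Finset.mul_sum, ← mul_add]
      refine Eq.trans ?_ (congrArg (fun r => ψ u * r) h1)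
      by_cases hyK : c.symm u ∈ K
      · simp only [hχ, hψ, indicator_of_mem hu, indicator_of_mem hyK]
        rfl
      · have h2 := fderiv_fderiv_densityInChart_eq_zero hA hφ hε hL ho hV hK hsupp x (φ 0 x)
          (hCΩ hu) hyK
        exact (congrArg (fun r => χ u * r) h2).trans
          ((mul_zero _).trans ((mul_zero _).symm.trans (congrArg (fun r => ψ u * r) h2.symm)))
    · simp [hχ0 u hu, hψ0 u hu]
  have e2 : ∫ u, ψ u * (R (0, u) * Q (c.symm u)) =
      ∫ y, ρ y * Q y ∂(inducedVolume 3 6 (φ 0)) := by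
    rw [integral_inducedVolume_localized hφ ⟨neg_neg_iff_pos.2 hε, hε⟩ x (φ 0 x) (hCt 0 h0δ)
      (h := fun y => ρ y * Q y) (hρ.continuous.mul hQc).measurable fun y hy => hρC y (left_ne_zero_of_mul hy)]
    refine integral_congr_ae (Filter.Eventually.of_forall fun u => ?_)
    by_cases hu : u ∈ C
    · simp only [hψ, indicator_of_mem hu]
      ring
    · simp [hψ, hu]
  have hWc : Continuous fun y => mvfderiv (𝓡 3) ρ y (W y) :=
    continuous_mvfderiv_fluxVector hA hφ hε hL ho hW hρ
  have hWC : ∀ y, mvfderiv (𝓡 3) ρ y (W y) ≠ 0 → y ∈ c.source ∧ c y ∈ C := by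
    intro y hy
    have hcl : IsClosed (c.symm '' C) :=
      (hC.image_of_continuousOn ((continuousOn_extChartAt_symm x).mono hCT)).isClosed
    have hmem : y ∈ c.symm '' C := by
      by_contra hn
      refine hy (mvfderiv_eq_zero_of_eventually_const (c := 0) ?_ _)
      filter_upwards [hcl.isOpen_compl.mem_nhds hn] with w hw
      by_contra hne
      obtain ⟨h1, h2⟩ := hρC w hne
      exact hw ⟨c w, h2, c.left_inv h1⟩
    obtain ⟨u, hu, rfl⟩ := hmem
    exact ⟨c.map_target (hCT hu), by rwa [c.right_inv (hCT hu)]⟩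
  have hZint : ∀ i, Integrable (fun u => fderiv ℝ ψ u (stdFrame i) *
      fluxField A lam φ x (φ 0 x) i u) := fun i => by
    have h1 : ContinuousOn (fun u => fderiv ℝ ψ u (stdFrame i) *
        fluxField A lam φ x (φ 0 x) i u) C :=
      (((hψs.continuousOn_fderiv_of_isOpen hΩ (by simp)).clm_apply continuousOn_const).mul
        (hZ i).continuousOn).mono hCΩ
    refine (integrableOn_iff_integrable_of_support_subset fun u hu => ?_).1
      (h1.integrableOn_compact hC)
    by_contra hn
    have e : ψ =ᶠ[𝓝 u] fun _ => 0 := by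
      filter_upwards [hC.isClosed.isOpen_compl.mem_nhds hn] with q hq using hψ0 q hq
    exact hu (by simp [e.fderiv_eq])
  have e3 : ∫ u, ∑ i, fderiv ℝ ψ u (stdFrame i) * fluxField A lam φ x (φ 0 x) i u =
      ∫ y, mvfderiv (𝓡 3) ρ y (W y) ∂(inducedVolume 3 6 (φ 0)) := by
    rw [integral_inducedVolume_localized hφ ⟨neg_neg_iff_pos.2 hε, hε⟩ x (φ 0 x) (hCt 0 h0δ)
      hWc.measurable hWC]
    refine integral_congr_ae (Filter.Eventually.of_forall fun u => ?_)
    by_cases hu : u ∈ C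
    · have h1 := sum_mul_fluxField hA hφ hL ho x (φ 0 x) (hCΩ hu) (hW _)
        (mvfderiv (𝓡 3) ρ (c.symm u)).toLinearMap
      have e : ψ =ᶠ[𝓝 u] ρ ∘ c.symm := by
        filter_upwards [(isOpen_extChartAt_target (I := 𝓡 3) x).mem_nhds (hCT hu)] with q hq
          using hψe q hq
      have h2 : ∀ i, mvfderiv (𝓡 3) ρ (c.symm u) (chartFrame x u (stdFrame i)) =
          fderiv ℝ ψ u (stdFrame i) := fun i => by
        rw [e.fderiv_eq]
        exact mvfderiv_chartFrame x (hCT hu) ((hρ _).mdifferentiableAt (by simp)) _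
      simp only [indicator_of_mem hu]
      refine Eq.trans (Finset.sum_congr rfl fun i _ => ?_) (h1.trans (mul_comm _ _))
      exact congrArg (fun r : ℝ => r * _) (h2 i).symm
    · have e : ψ =ᶠ[𝓝 u] fun _ => 0 := by
        filter_upwards [hC.isClosed.isOpen_compl.mem_nhds hu] with q hq using hψ0 q hq
      simp only [indicator_of_notMem hu, e.fderiv_eq]
      simp
  rw [integral_congr_ae (Filter.Eventually.of_forall e1), integral_add (hint _ hQΩ)
    (integrable_finsetSum _ fun i _ => hint _ (hZΩ i)), e2, integral_finsetSum _
    fun i _ => hint _ (hZΩ i), sub_eq_add_neg, ← e3, integral_finsetSum _ fun i _ => hZint i,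
    ← Finset.sum_neg_distrib]
  congr 1
  refine Finset.sum_congr rfl fun i _ => ?_
  exact integral_mul_fderiv_of_compact_support hΩ ((hZ i).of_le (by simp)) (hψs.of_le (by simp)) hC
    hCΩ hψ0 (stdFrame i)

end LocalizedVariation

/-! ### The second variation of the total volume -/

section Globalization

variable {M : Type*} [TopologicalSpace M] [ChartedSpace (EuclideanSpace ℝ (Fin 6)) M]
  [IsManifold (𝓡 6) ∞ M] [RiemannianBundle (fun x : M => TangentSpace (𝓡 6) x)]
  [IsContMDiffRiemannianBundle (𝓡 6) ∞ (EuclideanSpace ℝ (Fin 6))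
    (fun x : M => TangentSpace (𝓡 6) x)]
  {A : AlmostHermitianStructure 6 M} {lam : ℝ} (hA : IsStrictNearlyKahlerOfConstantType A lam)
  {L : Type*} [TopologicalSpace L] [T2Space L] [SecondCountableTopology L] [MeasurableSpace L]
  [BorelSpace L] [ChartedSpace (EuclideanSpace ℝ (Fin 3)) L]
  [IsManifold (𝓡 3) ∞ L]
  {ε : ℝ} {φ : ℝ → L → M}
  (hφ : ContMDiffOn (𝓘(ℝ, ℝ).prod (𝓡 3)) (𝓡 6) ∞ (fun p : ℝ × L => φ p.1 p.2)
    (Ioo (-ε) ε ×ˢ univ))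
  [RiemannianBundle (fun x : L => TangentSpace (𝓡 3) x)] (hε : 0 < ε)
  (hL : IsLagrangian A (φ 0)) {o : ∀ x : L, Orientation ℝ (TangentSpace (𝓡 3) x) (Fin 3)}
  (ho : IsCanonicalOrientation A lam (φ 0) o)
  {V : ∀ y : L, TangentSpace (𝓡 6) (φ 0 y)}
  (hV : ∀ y, V y = mfderiv 𝓘(ℝ, ℝ) (𝓡 6) (fun t => φ t y) 0 (1 : ℝ))
  {K : Set L} (hK : IsCompact K) (hsupp : ∀ t ∈ Ioo (-ε) ε, ∀ y ∉ K, φ t y = φ 0 y)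

include hA hφ hε hL in
/-- Around every point there is a chart ball on which the variation is an immersion for a uniform
time. -/
theorem exists_immersion_ball (x : L) : ∃ r > 0, ∃ δ > 0,
    Icc (-δ) δ ×ˢ Metric.closedBall (extChartAt (𝓡 3) x x) r ⊆ immersionDomain ε φ x (φ 0 x) := by
  have hO := isOpen_immersionDomain hA hφ x (φ 0 x)
  have h0 := mem_immersionDomain hφ hL x (φ 0 x) (mem_variationDomain_self (φ := φ) hε x)
  obtain ⟨s, hs, hsO⟩ := Metric.nhds_basis_closedBall.mem_iff.1 (hO.mem_nhds h0)
  refine ⟨s, hs, s, hs, fun z hz => hsO ?_⟩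
  rw [← closedBall_prod_same]
  refine ⟨?_, hz.2⟩
  rw [Real.closedBall_eq_Icc, zero_sub, zero_add]
  exact hz.1

include hA hφ hε hL ho hV hK hsupp

/-- The second variation of the volume, for the volume measured by integrals. -/
theorem second_variation_volume : ∃ D : ℝ → ℝ,
    (∀ᶠ t in 𝓝 (0 : ℝ), inducedVolume 3 6 (φ t) K < ⊤ ∧
      HasDerivAt (fun s => (inducedVolume 3 6 (φ s)).real K) (D t) t) ∧
    HasDerivAt D (∫ y, secondVariationIntegrand A lam (φ 0) o V y
      ∂(inducedVolume 3 6 (φ 0))) 0 := by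
  classical
  have hlc : LocallyCompactSpace L := Manifold.locallyCompact_of_finiteDimensional (𝓡 3)
  choose W hW using exists_fluxVector (o := o) hA hφ hε
  choose r hr δ hδ hrδ using exists_immersion_ball hA hφ hε hL
  -- The partition of unity lives on a compact neighbourhood of `K`, so that its sum is locally
  -- constant at every point of `K`.
  obtain ⟨K', hK', hKK'⟩ := exists_compact_superset hK
  let N : L → Set L := fun x =>
    (extChartAt (𝓡 3) x).source ∩ extChartAt (𝓡 3) x ⁻¹' Metric.ball (extChartAt (𝓡 3) x x) (r x)
  have hN : ∀ x, IsOpen (N x) := fun x =>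
    (continuousOn_extChartAt x).isOpen_inter_preimage (isOpen_extChartAt_source x) Metric.isOpen_ball
  have hNx : ∀ x, x ∈ N x := fun x => ⟨mem_extChartAt_source x, Metric.mem_ball_self (hr x)⟩
  obtain ⟨T, hT⟩ := hK'.elim_finite_subcover N hN fun x _ => mem_iUnion.2 ⟨x, hNx x⟩
  obtain ⟨ρ, hρN⟩ := SmoothPartitionOfUnity.exists_isSubordinate (𝓡 3) hK'.isClosed
    (fun i : T => N i) (fun i => hN i) (by
      rw [iUnion_subtype]
      exact hT)
  obtain ⟨η, hη0, hηε, hηδ⟩ : ∃ η > 0, η ≤ ε ∧ ∀ i : T, η ≤ δ i := by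
    have h1 : ∀ᶠ η in 𝓝[>] (0 : ℝ), ∀ i : T, η < δ i := eventually_all.2 fun i =>
      mem_nhdsWithin_of_mem_nhds (Iio_mem_nhds (hδ i))
    have h2 : ∀ᶠ η in 𝓝[>] (0 : ℝ), η < ε := mem_nhdsWithin_of_mem_nhds (Iio_mem_nhds hε)
    obtain ⟨η, ⟨h3, h4⟩, h5⟩ := ((h1.and h2).and self_mem_nhdsWithin).exists
    exact ⟨η, h5, h4.le, fun i => (h3 i).le⟩
  have hsum : ∀ y ∈ K', ∑ i, ρ i y = 1 := fun y hy => by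
    rw [← finsum_eq_sum_of_fintype]
    exact ρ.sum_eq_one hy
  have hloc := fun i : T => second_variation_localized hA hφ hε hL ho hV hK.isClosed hsupp hW
    (i : L) (isCompact_closedBall (extChartAt (𝓡 3) (i : L) i) (r i)) hη0 hηε
    ((prod_mono (Icc_subset_Icc (neg_le_neg (hηδ i)) (hηδ i)) subset_rfl).trans (hrδ i))
    (ρ i).contMDiff (ρ.nonneg i) (ρ.le_one i) fun y hy => by
      have := hρN i (subset_tsupport _ hy)
      exact ⟨this.1, Metric.ball_subset_closedBall this.2⟩
  choose D hD hD0 using hloc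
  have hη : Ioo (-η) η ∈ 𝓝 (0 : ℝ) := Ioo_mem_nhds (neg_neg_iff_pos.2 hη0) hη0
  have hfin : ∀ t ∈ Ioo (-η) η, IsFiniteMeasureOnCompacts (inducedVolume 3 6 (φ t)) := fun t ht => by
    have := isLocallyFiniteMeasure_inducedVolume (φ t) (contMDiff_variation_slice hφ
      ⟨by linarith [ht.1], by linarith [ht.2]⟩)
    infer_instance
  have hind : ∀ t ∈ Ioo (-η) η, ∀ i, Integrable (K.indicator (ρ i)) (inducedVolume 3 6 (φ t)) := by
    intro t ht i
    have := hfin t ht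
    exact ((ρ i).contMDiff.continuous.continuousOn.integrableOn_compact hK).integrable_indicator
      hK.measurableSet
  have hvol : ∀ t ∈ Ioo (-η) η, (inducedVolume 3 6 (φ t)).real K =
      ∑ i, ∫ y, K.indicator (ρ i) y ∂(inducedVolume 3 6 (φ t)) := by
    intro t ht
    rw [← integral_finsetSum _ fun i _ => hind t ht i, ← integral_indicator_one hK.measurableSet]
    refine integral_congr_ae (Filter.Eventually.of_forall fun y => ?_)
    by_cases hy : y ∈ K
    · simp only [indicator_of_mem hy, hsum y (interior_subset (hKK' hy)), Pi.one_apply]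
    · simp [hy]
  refine ⟨fun t => ∑ i, D i t, ?_, ?_⟩
  · filter_upwards [hη] with t ht
    have := hfin t ht
    refine ⟨hK.measure_lt_top, (HasDerivAt.fun_sum fun i _ => hD i t ht).congr_of_eventuallyEq ?_⟩
    filter_upwards [Ioo_mem_nhds ht.1 ht.2] with s hs using hvol s hs
  refine (HasDerivAt.fun_sum fun i _ => hD0 i).congr_deriv ?_
  have := hfin 0 (mem_of_mem_nhds hη)
  have hQc : Continuous (secondVariationIntegrand A lam (φ 0) o V) :=
    continuous_secondVariationIntegrand hA hφ hε hL ho hV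
  have hQ0 : ∀ y ∉ K, secondVariationIntegrand A lam (φ 0) o V y = 0 := fun y hy =>
    secondVariationIntegrand_eq_zero hε hV hK.isClosed hsupp hy
  have hi1 : ∀ i, Integrable (fun y => ρ i y * secondVariationIntegrand A lam (φ 0) o V y)
      (inducedVolume 3 6 (φ 0)) := fun i =>
    ((ρ i).contMDiff.continuous.mul hQc).integrable_of_hasCompactSupport
      (HasCompactSupport.intro hK fun y hy => by simp [hQ0 y hy])
  have hi2 : ∀ i, Integrable (fun y => mvfderiv (𝓡 3) (ρ i) y (W y)) (inducedVolume 3 6 (φ 0)) :=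
    fun i => (continuous_mvfderiv_fluxVector hA hφ hε hL ho hW
      (ρ i).contMDiff).integrable_of_hasCompactSupport (HasCompactSupport.intro hK fun y hy => by
        rw [fluxVector_eq_zero hε hsupp hy (hW y), map_zero])
  rw [Finset.sum_sub_distrib, ← integral_finsetSum _ fun i _ => hi1 i,
    ← integral_finsetSum _ fun i _ => hi2 i]
  -- The cutoff functions add up to one near `K`, so that the sum of their derivatives vanishes.
  have e1 : ∀ y, ∑ i, ρ i y * secondVariationIntegrand A lam (φ 0) o V y =
      secondVariationIntegrand A lam (φ 0) o V y := fun y => by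
    by_cases hy : y ∈ K
    · rw [← Finset.sum_mul, hsum y (interior_subset (hKK' hy)), one_mul]
    · simp [hQ0 y hy]
  have e2 : ∀ y, ∑ i, mvfderiv (𝓡 3) (ρ i) y (W y) = 0 := fun y => by
    by_cases hy : y ∈ K
    · rw [← (mvfderiv_sum Finset.univ (fun i _ =>
        ((ρ i).contMDiff y).mdifferentiableAt (by simp)) (W y)).2]
      refine mvfderiv_eq_zero_of_eventually_const (c := 1) ?_ _
      filter_upwards [isOpen_interior.mem_nhds (hKK' hy)] with w hw
      rw [Finset.sum_apply]
      exact hsum w (interior_subset hw)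
    · simp [fluxVector_eq_zero hε hsupp hy (hW y)]
  simp only [e1, e2, integral_zero, sub_zero]

end Globalization

end NearlyKahler

theorem mainTheorem3
    {M : Type*} [TopologicalSpace M] [T2Space M] [SecondCountableTopology M]
    [ChartedSpace (EuclideanSpace ℝ (Fin 6)) M] [IsManifold (𝓡 6) ∞ M]
    [RiemannianBundle (fun x : M => TangentSpace (𝓡 6) x)]
    [IsContMDiffRiemannianBundle (𝓡 6) ∞ (EuclideanSpace ℝ (Fin 6))
      (fun x : M => TangentSpace (𝓡 6) x)]
    (A : NearlyKahler.AlmostHermitianStructure 6 M) (lam : ℝ)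
    (hA : NearlyKahler.IsStrictNearlyKahlerOfConstantType A lam)
    {L : Type*} [TopologicalSpace L] [T2Space L] [SecondCountableTopology L]
    [MeasurableSpace L] [BorelSpace L]
    [ChartedSpace (EuclideanSpace ℝ (Fin 3)) L] [IsManifold (𝓡 3) ∞ L]
    [RiemannianBundle (fun x : L => TangentSpace (𝓡 3) x)]
    [IsContMDiffRiemannianBundle (𝓡 3) ∞ (EuclideanSpace ℝ (Fin 3))
      (fun x : L => TangentSpace (𝓡 3) x)]
    (f : L → M) (hf : NearlyKahler.IsLagrangian A f)
    (o : ∀ x : L, Orientation ℝ (TangentSpace (𝓡 3) x) (Fin 3))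
    (ho : NearlyKahler.IsCanonicalOrientation A lam f o)
    (V : ∀ x : L, TangentSpace (𝓡 6) (f x)) (hV : NearlyKahler.IsNormalField f V)
    (K : Set L) (hK : IsCompact K) (ε : ℝ) (φ : ℝ → L → M)
    (hφ : NearlyKahler.IsVariation f V K ε φ) :
    Integrable (fun x => NearlyKahler.formInner
        (NearlyKahler.dOne (NearlyKahler.lOmega A f V) x -
          (3 * lam) • NearlyKahler.starLOmega A f o V x)
        (NearlyKahler.dOne (NearlyKahler.lOmega A f V) x +
          lam • NearlyKahler.starLOmega A f o V x))
      (NearlyKahler.inducedVolume 3 6 f) ∧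
    Integrable (fun x => NearlyKahler.formInner
        (NearlyKahler.dForm (NearlyKahler.starLOmega A f o V) x)
        (NearlyKahler.dForm (NearlyKahler.starLOmega A f o V) x))
      (NearlyKahler.inducedVolume 3 6 f) ∧
    (∀ᶠ t in 𝓝 (0 : ℝ), NearlyKahler.inducedVolume 3 6 (φ t) K < ⊤ ∧
      DifferentiableAt ℝ (fun s => (NearlyKahler.inducedVolume 3 6 (φ s)).real K) t) ∧
    HasDerivAt (deriv fun t => (NearlyKahler.inducedVolume 3 6 (φ t)).real K)
      ((∫ x, NearlyKahler.formInner
        (NearlyKahler.dOne (NearlyKahler.lOmega A f V) x -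
          (3 * lam) • NearlyKahler.starLOmega A f o V x)
        (NearlyKahler.dOne (NearlyKahler.lOmega A f V) x +
          lam • NearlyKahler.starLOmega A f o V x)
        ∂(NearlyKahler.inducedVolume 3 6 f)) +
      ∫ x, NearlyKahler.formInner
        (NearlyKahler.dForm (NearlyKahler.starLOmega A f o V) x)
        (NearlyKahler.dForm (NearlyKahler.starLOmega A f o V) x)
        ∂(NearlyKahler.inducedVolume 3 6 f)) 0 := by
  obtain rfl := hφ.zero
  have hV : ∀ y, V y = mfderiv 𝓘(ℝ, ℝ) (𝓡 6) (fun t => φ t y) 0 (1 : ℝ) := fun y =>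
    (eq_of_heq (Bundle.TotalSpace.mk.inj (hφ.velocity y)).2).symm
  have hε := hφ.pos
  have hs := hφ.smooth
  have hfin := NearlyKahler.isLocallyFiniteMeasure_inducedVolume (φ 0)
    (NearlyKahler.contMDiff_variation_slice hs ⟨neg_neg_iff_pos.2 hε, hε⟩)
  have h1 : Integrable (fun x => NearlyKahler.formInner
        (NearlyKahler.dOne (NearlyKahler.lOmega A (φ 0) V) x -
          (3 * lam) • NearlyKahler.starLOmega A (φ 0) o V x)
        (NearlyKahler.dOne (NearlyKahler.lOmega A (φ 0) V) x +
          lam • NearlyKahler.starLOmega A (φ 0) o V x))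
      (NearlyKahler.inducedVolume 3 6 (φ 0)) :=
    (NearlyKahler.continuous_formInner_two hA hs hε hf ho hV).integrable_of_hasCompactSupport
      (HasCompactSupport.intro hK fun y hy => by
        rw [NearlyKahler.dOne_lOmega_eq_zero hε hV hK.isClosed hφ.support hy,
          NearlyKahler.starLOmega_eq_zero hε hV hφ.support hy]
        simp [NearlyKahler.formInner])
  have h2 : Integrable (fun x => NearlyKahler.formInner
        (NearlyKahler.dForm (NearlyKahler.starLOmega A (φ 0) o V) x)
        (NearlyKahler.dForm (NearlyKahler.starLOmega A (φ 0) o V) x))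
      (NearlyKahler.inducedVolume 3 6 (φ 0)) :=
    (NearlyKahler.continuous_formInner_three hA hs hε hf ho hV).integrable_of_hasCompactSupport
      (HasCompactSupport.intro hK fun y hy => by
        rw [NearlyKahler.dForm_starLOmega_eq_zero hε hV hK.isClosed hφ.support hy]
        simp [NearlyKahler.formInner])
  obtain ⟨D, hD, hD0⟩ := NearlyKahler.second_variation_volume hA hs hε hf ho hV hK hφ.support
  refine ⟨h1, h2, hD.mono fun t ht => ⟨ht.1, ht.2.differentiableAt⟩, ?_⟩
  rw [← integral_add h1 h2]
  exact hD0.congr_of_eventuallyEq (hD.mono fun t ht => ht.2.deriv)
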